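/- Let $X_1,X_2,\dots$ be independent real random variables with common density $p_X(\cdot-\theta)$, $\theta\in\mathbb R$, where the density $p_X$ is symmetric about $0$, $p_X(0)>0$, $p_X$ is continuous at $0$, and $p_X$ has three continuous bounded derivatives on some interval $(0,x_0)$, $x_0>0$. Put $p_0=p_X(0)$, $p_1=p_X'(0+)$, $p_2=p_X''(0+)$. Let $r>0$, and for each $n\in\mathbb N=\{1,2,\dots\}$ let $N_n$ be a random variable, defined on the same probability space and independent of $(X_1,X_2,\dots)$, with the shifted negative binomial distribution $$\mathbb P(N_n=j)=\frac{\Gamma(j+r-1)}{\Gamma(j)\,\Gamma(r)}\Big(\frac1n\Big)^{r}\Big(1-\frac1n\Big)^{j-1},\qquad j=1,2,\dots,$$ and let $g_n=\mathbb E N_n=r(n-1)+1$ and $N_n^*=2\lfloor N_n/2\rfloor$. Let $M_m$ be the median of $X_1,\dots,X_m$, that is, in terms of the order statistics of $X_1,\dots,X_m$, $M_m=X_{(j)}$ if $m=2j-1$ and $M_m=(X_{(j)}+X_{(j+1)})/2$ if $m=2j$. Consider the standardized median of the sample of random size $$T_n=2p_0\sqrt{\frac{g_nN_n^*}{N_n}}\,\big(M_{N_n}-\theta\big).$$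 Let $S_{2r}$ be the distribution function of Student's $t$-distribution with $2r$ degrees of freedom. Let $0<\alpha<1$, let $u$ be the $\alpha$-quantile of $S_{2r}$, i.e. $S_{2r}(u)=\alpha$, and for each $n$ let $x=x_n$ be an $\alpha$-quantile of $T_n$, i.e. $\mathbb P(T_n<x_n)\le\alpha\le\mathbb P(T_n\le x_n)$. Then, as $n\to\infty$, $$x_n=u-\frac{p_1\,u|u|}{4p_0^2\sqrt{g_n}}\,\mathbf 1_{(1/2,\infty)}(r)+\frac{B_2(u)}{g_n}\,\mathbf 1_{(1,\infty)}(r)+\begin{cases}\mathcal O\big(n^{-\min\{r,3/2\}}\big),& r\ne 3/2,\\ \mathcal O\big(\ln(n)\,n^{-3/2}\big),& r=3/2,\end{cases}$$ where, for $r>1$, $$B_2(u)=\frac{p_1^2u^3}{8p_0^4}-\frac{(5-r)u^3+(5r+2)u}{4(2r-1)}-\frac{u^3}{4}\Big(1+\frac{p_2}{6p_0^3}\Big).$$ -/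

import Mathlib

open MeasureTheory ProbabilityTheory Filter Topology

noncomputable section

namespace RandomMedian

/-- Regularity of the parent density `p`: it is a nonnegative measurable function, symmetric about
zero, positive and continuous at zero, and on some interval `(0, x₀)` it has three continuous
bounded derivatives. -/
structure RegularDensity (p : ℝ → ℝ) : Prop where
  measurable : Measurable p
  nonneg : ∀ x, 0 ≤ p x
  symm : ∀ x, p (-x) = p x
  pos_zero : 0 < p 0
  continuousAt_zero : ContinuousAt p 0
  smooth : ∃ x₀ > 0, ContDiffOn ℝ 3 p (Set.Ioo 0 x₀) ∧
    ∃ K : ℝ, ∀ k ∈ Finset.Icc 1 3, ∀ x ∈ Set.Ioo 0 x₀, |iteratedDeriv k p x| ≤ K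

/-- The order statistic `X_(k)`, `1 ≤ k ≤ m`, of the first `m` observations
`x 0, …, x (m - 1)` (value `0` if `k` is out of range). -/
def orderStat (x : ℕ → ℝ) (m k : ℕ) : ℝ :=
  if h : k - 1 < m then
    x (Tuple.sort (fun i : Fin m => x i) ⟨k - 1, h⟩)
  else 0

/-- The sample median of the first `m` observations: `X_(j)` if `m = 2 j - 1`, and
`(X_(j) + X_(j+1)) / 2` if `m = 2 j`. -/
def sampleMedian (x : ℕ → ℝ) (m : ℕ) : ℝ :=
  if Odd m then orderStat x m ((m + 1) / 2)
  else (orderStat x m (m / 2) + orderStat x m (m / 2 + 1)) / 2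

/-- The probability mass at `j = 1, 2, …` of the negative binomial distribution with parameters
`1 / n` and `r`, shifted by one. -/
def negBinMass (r : ℝ) (n j : ℕ) : ℝ :=
  Real.Gamma (j + r - 1) / (Real.Gamma j * Real.Gamma r) *
    (1 / (n : ℝ)) ^ r * (1 - 1 / (n : ℝ)) ^ (j - 1)

/-- `g_n = r (n - 1) + 1`, the mean of the shifted negative binomial distribution. -/
def g (r : ℝ) (n : ℕ) : ℝ := r * ((n : ℝ) - 1) + 1

/-- The standardized median `2 p₀ √(g_n N* / N) (M_N - θ)` of a sample of size `N`, where
`N* = 2 [N / 2]`. -/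
def standardizedMedian (p₀ gn θ : ℝ) (x : ℕ → ℝ) (N : ℕ) : ℝ :=
  2 * p₀ * √(gn * ((2 * (N / 2) : ℕ) : ℝ) / (N : ℝ)) * (sampleMedian x N - θ)

/-- Density of Student's `t`-distribution with `ν` degrees of freedom. -/
def studentDensity (ν x : ℝ) : ℝ :=
  Real.Gamma ((ν + 1) / 2) / (√(ν * Real.pi) * Real.Gamma (ν / 2)) *
    (1 + x ^ 2 / ν) ^ (-(ν + 1) / 2)

/-- Distribution function of Student's `t`-distribution with `ν` degrees of freedom. -/
def studentCDF (ν x : ℝ) : ℝ := ∫ t in Set.Iic x, studentDensity ν t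

/-- `x` is an `α`-quantile of the random variable `T`: `P(T < x) ≤ α ≤ P(T ≤ x)`. Every solution of
`P(T ≤ x) = α` is one, and so is `inf {x | α ≤ P(T ≤ x)}`. -/
def IsQuantile {Ω : Type*} [MeasurableSpace Ω] (P : Measure Ω) (T : Ω → ℝ) (α x : ℝ) : Prop :=
  P.real {ω | T ω < x} ≤ α ∧ α ≤ P.real {ω | T ω ≤ x}

/-- The second-order coefficient of the Cornish–Fisher expansion. -/
def B₂ (r p₀ p₁ p₂ u : ℝ) : ℝ :=
  p₁ ^ 2 * u ^ 3 / (8 * p₀ ^ 4) - ((5 - r) * u ^ 3 + (5 * r + 2) * u) / (4 * (2 * r - 1))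
    - u ^ 3 / 4 * (1 + p₂ / (6 * p₀ ^ 3))

/-- The order of the remainder. -/
def rate (r : ℝ) (n : ℕ) : ℝ :=
  if r = 3 / 2 then Real.log n * (n : ℝ) ^ (-(3 / 2) : ℝ) else (n : ℝ) ^ (-min r (3 / 2))

end RandomMedian

end

namespace RandomMedian

/-! ### The Laplace transform of the negative binomial distribution -/

/-! Write F for the centred distribution function of p, G = g_n and y = x/(2 p₀ √G). Given N_n = j
with j ≥ 2, the event T_n ≤ x says that the centred median is at most y √(j/j*), j* = 2⌊j/2⌋. The
proof expands this probability in j, mixes over j, and inverts.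

Fixed sample size. For j = 2k+1 the probability is a binomial tail, hence a symmetric beta integral,
and `betaOdd_expansion` expands it around the normal law with error O(k⁻²). Sizes 2k and 2k+1 differ
only when exactly k of the first 2k observations lie below the level;
`LocallyRegular.abs_prob_even_sub_odd_le` shows that this costs O(k^{-3/2}). With w = 2√G F(y) and z
= w√(j/G), the cubic Edgeworth term z³φ(z)/(4j) equals F(y)² zφ(z) up to negligible error. It is
therefore a dilation of the argument that does not depend on j, and replacing w by `inflate G w`
leaves only `medianApprox`, that is Φ - 1/2 plus (3/4) zφ(z)/j
(`RegularDensity.prob_standardizedMedian_approx`).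

Mixing. Craig's formula writes Φ(z) - 1/2 as 1/2 minus an average over ω of exp(-z²(1+ω²)/2). Since
z² is proportional to j, averaging over j produces the Laplace transform of N_n at ε =
w²(1+ω²)/(2G). That transform is e^{-ε} D^{-r} with D close to 1 + Gε/r, and (1 + Gε/r)^{-r} is the
kernel of the corresponding formula for Student's law with 2r degrees of freedom. An expansion of
the Laplace transform uniform in ε ≥ 0 (`lap_expansion_of_one_lt`, `lap_expansion_of_le_one`) thus
gives the mixture (`tsum_medianApprox_sub_mixApprox_le`). The errors of order j^{-3/2} average to E
N_n^{-3/2}, which is where the logarithm at r = 3/2 appears (`tsum_negBinMass_mul_rpow_le`).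

Inversion. The distribution function of T_n at x is now, up to the rate, a smooth perturbation of
S_{2r} at a point v. `mixApprox_inversion` solves for v in terms of u; the Taylor expansion of F
makes v a cubic perturbation of x, undone by `cubic_inversion`; `quantile_substitution` composes the
two. Atoms of T_n do no harm, because the approximating function is continuous
(`IsQuantile.abs_sub_le`). -/

theorem ascPochhammer_eval_eq_Gamma_div {r : ℝ} (hr : 0 < r) (i : ℕ) :
    (ascPochhammer ℝ i).eval r = Real.Gamma (r + i) / Real.Gamma r := by
  have hG := (Real.Gamma_pos_of_pos hr).ne'
  induction i with
  | zero => simp [hG]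
  | succ i ih =>
    have : r + i ≠ 0 := by positivity
    rw [ascPochhammer_succ_eval, ih]
    push_cast
    rw [← add_assoc, Real.Gamma_add_one this]
    ring

/-- The binomial series of (1 - z)^{-r}; its coefficients, rising factorials over i!, are recast in
the Gamma form of the negative binomial masses. -/
theorem hasSum_Gamma_mul_pow {r : ℝ} (hr : 0 < r) {z : ℝ} (hz : |z| < 1) :
    HasSum (fun i : ℕ => Real.Gamma (r + i) / (Real.Gamma (i + 1) * Real.Gamma r) * z ^ i)
      ((1 - z) ^ (-r)) := by
  have h := (Real.one_div_one_sub_rpow_hasFPowerSeriesOnBall_zero r).hasSum (y := z)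
    (by simpa [Metric.mem_eball, edist_dist, ENNReal.ofReal_lt_one] using hz)
  rw [zero_add, one_div, ← Real.rpow_neg (by linarith [le_abs_self z])] at h
  refine h.congr_fun fun i => ?_
  rw [FormalMultilinearSeries.ofScalars_apply_eq, Ring.choose]
  have h2 := Ring.factorial_nsmul_multichoose_eq_ascPochhammer r i
  rw [Polynomial.ascPochhammer_smeval_eq_eval, ascPochhammer_eval_eq_Gamma_div hr, nsmul_eq_mul] at h2
  have h3 : r + i - 1 - i + 1 = r := by ring
  have hf : ((i.factorial : ℕ) : ℝ) ≠ 0 := by positivity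
  have hG := (Real.Gamma_pos_of_pos hr).ne'
  rw [h3, Real.Gamma_nat_eq_factorial, smul_eq_mul]
  congr 1
  field_simp at h2 ⊢
  linarith

/-- The denominator `1 + (n - 1)(1 - e^{-s})` in the Laplace transform. -/
noncomputable def lapDen (n : ℕ) (s : ℝ) : ℝ := 1 + ((n : ℝ) - 1) * (1 - Real.exp (-s))

theorem one_le_lapDen {n : ℕ} (hn : 1 ≤ n) {s : ℝ} (hs : 0 ≤ s) : 1 ≤ lapDen n s := by
  have h1 : (1 : ℝ) ≤ n := by exact_mod_cast hn
  have h2 : Real.exp (-s) ≤ 1 := Real.exp_le_one_iff.2 (by linarith)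
  unfold lapDen
  nlinarith

theorem hasSum_negBinMass_mul_exp {r : ℝ} (hr : 0 < r) {n : ℕ} (hn : 1 ≤ n) {s : ℝ} (hs : 0 ≤ s) :
    HasSum (fun i : ℕ => negBinMass r n (i + 1) * Real.exp (-(s * (i + 1))))
      (Real.exp (-s) * lapDen n s ^ (-r)) := by
  have h1 : (1 : ℝ) ≤ n := by exact_mod_cast hn
  have h0 : (0 : ℝ) < n := by linarith
  have hE : Real.exp (-s) ≤ 1 := Real.exp_le_one_iff.2 (by linarith)
  have hE0 := Real.exp_pos (-s)
  have hq0 : 0 ≤ 1 - 1 / (n : ℝ) := by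
    rw [sub_nonneg, div_le_one h0]; exact h1
  have hq1 : 1 - 1 / (n : ℝ) < 1 := by
    have : 0 < 1 / (n : ℝ) := by positivity
    linarith
  set q : ℝ := 1 - 1 / (n : ℝ) with hq
  have hz : |q * Real.exp (-s)| < 1 := by
    rw [abs_of_nonneg (by positivity)]
    nlinarith
  have h := (hasSum_Gamma_mul_pow hr hz).mul_left (Real.exp (-s) * (1 / (n : ℝ)) ^ r)
  have e : Real.exp (-s) * (1 / (n : ℝ)) ^ r * (1 - q * Real.exp (-s)) ^ (-r) =
      Real.exp (-s) * lapDen n s ^ (-r) := by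
    -- The factor n^{-r} of the masses turns 1 - q e^{-s} into a quantity equal to 1 at s = 0.
    have hD : lapDen n s = n * (1 - q * Real.exp (-s)) := by
      unfold lapDen; rw [hq]; field_simp; ring
    rw [hD, Real.mul_rpow h0.le (by linarith [(abs_lt.1 hz).2]), one_div, Real.inv_rpow h0.le,
      Real.rpow_neg h0.le]
    ring
  rw [e] at h
  refine h.congr_fun fun i => ?_
  unfold negBinMass
  have e1 : ((i + 1 : ℕ) : ℝ) + r - 1 = r + i := by push_cast; ring
  have e2 : ((i + 1 : ℕ) : ℝ) = i + 1 := by push_cast; ring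
  have e3 : Real.exp (-(s * (i + 1))) = Real.exp (-s) * Real.exp (-s) ^ i := by
    rw [← Real.exp_nat_mul, ← Real.exp_add]; ring_nf
  rw [e1, e2, e3, mul_pow, Nat.add_sub_cancel]
  ring

theorem negBinMass_nonneg {r : ℝ} (hr : 0 < r) {n : ℕ} (hn : 1 ≤ n) (i : ℕ) :
    0 ≤ negBinMass r n (i + 1) := by
  have h1 : (1 : ℝ) ≤ n := by exact_mod_cast hn
  have hq0 : 0 ≤ 1 - 1 / (n : ℝ) := by
    rw [sub_nonneg, div_le_one (by linarith)]; exact h1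
  unfold negBinMass
  have a1 := Real.Gamma_pos_of_pos hr
  have a2 : 0 < Real.Gamma ((i + 1 : ℕ) : ℝ) := Real.Gamma_pos_of_pos (by positivity)
  have a3 : 0 < Real.Gamma (((i + 1 : ℕ) : ℝ) + r - 1) :=
    Real.Gamma_pos_of_pos (by push_cast; linarith [(Nat.cast_nonneg i : (0 : ℝ) ≤ i)])
  positivity

theorem hasSum_negBinMass {r : ℝ} (hr : 0 < r) {n : ℕ} (hn : 1 ≤ n) :
    HasSum (fun i : ℕ => negBinMass r n (i + 1)) 1 := by
  simpa [lapDen] using hasSum_negBinMass_mul_exp hr hn le_rfl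

/-! ### Taylor bounds -/

theorem abs_sub_le_of_hasDerivAt {f f' : ℝ → ℝ} {a b M : ℝ}
    (hf : ∀ x ∈ Set.uIcc a b, HasDerivAt f (f' x) x) (hM : ∀ x ∈ Set.uIcc a b, |f' x| ≤ M) :
    |f b - f a| ≤ M * |b - a| := by
  have := Convex.norm_image_sub_le_of_norm_hasDerivWithin_le (f := f) (f' := f')
    (s := Set.uIcc a b) (C := M) (x := a) (y := b) (fun x hx => (hf x hx).hasDerivWithinAt)
    (fun x hx => by simpa using hM x hx) (convex_uIcc a b) Set.left_mem_uIcc Set.right_mem_uIcc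
  simpa using this

/-- The mean value inequality applied to x ↦ f x - f'(a) x; the factor 1/2 of Taylor's formula is
given away. -/
theorem abs_sub_sub_le_of_hasDerivAt {f f' f'' : ℝ → ℝ} {a b M : ℝ}
    (hf : ∀ x ∈ Set.uIcc a b, HasDerivAt f (f' x) x)
    (hf' : ∀ x ∈ Set.uIcc a b, HasDerivAt f' (f'' x) x)
    (hM : ∀ x ∈ Set.uIcc a b, |f'' x| ≤ M) :
    |f b - f a - f' a * (b - a)| ≤ M * (b - a) ^ 2 := by
  have hM0 : 0 ≤ M := (abs_nonneg _).trans (hM a Set.left_mem_uIcc)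
  have h := abs_sub_le_of_hasDerivAt (f := fun x => f x - f' a * x) (f' := fun x => f' x - f' a)
    (a := a) (b := b) (M := M * |b - a|)
    (fun x hx => by
      simpa using! (hf x hx).sub ((hasDerivAt_id x).const_mul (f' a)))
    (fun x hx => by
      have hsub : Set.uIcc a x ⊆ Set.uIcc a b := Set.uIcc_subset_uIcc_left hx
      refine (abs_sub_le_of_hasDerivAt (fun z hz => hf' z (hsub hz))
        (fun z hz => hM z (hsub hz))).trans ?_
      exact mul_le_mul_of_nonneg_left (Set.abs_sub_left_of_mem_uIcc hx) hM0)
  have e : f b - f' a * b - (f a - f' a * a) = f b - f a - f' a * (b - a) := by ring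
  rw [e, mul_assoc, abs_mul_abs_self] at h
  rw [pow_two]; exact h

/-- To be applied to the ratio of the exact to the linearised denominator, which `lap_ratio_bounds`
places in [1/4, 1]. -/
theorem abs_rpow_neg_sub_le {r : ℝ} (hr : 0 < r) {t : ℝ} (ht : t ∈ Set.Icc (1 / 4 : ℝ) 1) :
    |t ^ (-r) - 1 + r * (t - 1)| ≤ r * (r + 1) * 4 ^ (r + 2) * (t - 1) ^ 2 := by
  have hpos : ∀ x ∈ Set.uIcc 1 t, 1 / 4 ≤ x := by
    intro x hx
    rw [Set.uIcc_of_ge ht.2] at hx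
    exact ht.1.trans hx.1
  have h := abs_sub_sub_le_of_hasDerivAt (f := fun x : ℝ => x ^ (-r))
    (f' := fun x => -r * x ^ (-r - 1)) (f'' := fun x => -r * ((-r - 1) * x ^ (-r - 1 - 1)))
    (a := 1) (b := t) (M := r * (r + 1) * 4 ^ (r + 2))
    (fun x hx => Real.hasDerivAt_rpow_const (Or.inl (by linarith [hpos x hx])))
    (fun x hx => (Real.hasDerivAt_rpow_const (Or.inl (by linarith [hpos x hx]))).const_mul _)
    (fun x hx => by
      have h4 : x ^ (-r - 1 - 1) ≤ 4 ^ (r + 2) := by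
        have : (-r - 1 - 1) = -(r + 2) := by ring
        rw [this, Real.rpow_neg (by linarith [hpos x hx]), ← Real.inv_rpow (by linarith [hpos x hx])]
        refine Real.rpow_le_rpow (by have := hpos x hx; positivity) ?_ (by linarith)
        rw [inv_le_comm₀ (by linarith [hpos x hx]) (by norm_num)]
        linarith [hpos x hx]
      have h5 : 0 ≤ x ^ (-r - 1 - 1) := Real.rpow_nonneg (by linarith [hpos x hx]) _
      rw [abs_le]
      constructor <;> nlinarith [mul_le_mul_of_nonneg_left h4 (by positivity : 0 ≤ r * (r + 1)),
        mul_nonneg (by positivity : 0 ≤ r * (r + 1)) h5])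
  simpa [sub_eq_add_neg] using h

/-! ### Uniform expansion of the Laplace transform -/

/-- With y = 1 + gε/r one has ε ≤ (r/g) y, so y^{-r} pays for powers of ε up to the r-th and each
such power is worth 1/g. This trade makes the expansion uniform in ε and caps its order at r. -/
theorem rpow_neg_mul_rpow_le {r m g ε : ℝ} (hr : 0 < r) (hm : 0 ≤ m) (hmr : m ≤ r) (hg : 0 < g)
    (hε : 0 ≤ ε) : (1 + g * ε / r) ^ (-r) * ε ^ m ≤ (r / g) ^ m := by
  set y := 1 + g * ε / r with hy
  have hy1 : 1 ≤ y := by rw [hy]; have : 0 ≤ g * ε / r := by positivity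
                         linarith
  have h1 : ε ≤ (r / g) * y := by
    rw [hy]; field_simp; linarith
  have h2 : ε ^ m ≤ (r / g) ^ m * y ^ m := by
    rw [← Real.mul_rpow (by positivity) (by linarith)]
    exact Real.rpow_le_rpow hε h1 hm
  have h3 : y ^ (-r) * y ^ m ≤ 1 := by
    rw [← Real.rpow_add (by linarith)]
    exact Real.rpow_le_one_of_one_le_of_nonpos hy1 (by linarith)
  have h4 : 0 ≤ y ^ (-r) := by positivity
  calc y ^ (-r) * ε ^ m ≤ y ^ (-r) * ((r / g) ^ m * y ^ m) := by gcongr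
    _ = (y ^ (-r) * y ^ m) * (r / g) ^ m := by ring
    _ ≤ 1 * (r / g) ^ m := by gcongr
    _ = _ := one_mul _

theorem abs_mul_three_sub_le {α β γ A ε : ℝ} (hA : 0 ≤ A) (hε : 0 ≤ ε) (hε1 : ε ≤ 1)
    (h1 : |α| ≤ A * ε) (h2 : |β| ≤ A * ε) (h3 : |γ| ≤ A * ε) :
    |(1 + α) * (1 + β) * (1 + γ) - (1 + α + β + γ)| ≤ (3 * A ^ 2 + A ^ 3) * ε ^ 2 := by
  have e : (1 + α) * (1 + β) * (1 + γ) - (1 + α + β + γ) = α * β + α * γ + β * γ + α * β * γ := by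
    ring
  have p1 : |α * β| ≤ A * ε * (A * ε) := by rw [abs_mul]; gcongr
  have p2 : |α * γ| ≤ A * ε * (A * ε) := by rw [abs_mul]; gcongr
  have p3 : |β * γ| ≤ A * ε * (A * ε) := by rw [abs_mul]; gcongr
  have p4 : |α * β * γ| ≤ A * ε * (A * ε) * (A * ε) := by rw [abs_mul]; gcongr
  have p5 : A * ε * (A * ε) * (A * ε) ≤ A ^ 3 * ε ^ 2 := by
    have : A ^ 3 * ε ^ 2 * ε ≤ A ^ 3 * ε ^ 2 * 1 := by gcongr
    nlinarith
  rw [e]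
  refine (abs_add_le _ _).trans ?_
  have := (abs_add_le (α * β + α * γ) (β * γ))
  have := (abs_add_le (α * β) (α * γ))
  nlinarith

/-- Everything follows from r(D - y) = g(1 - e^{-ε} - ε) - (1 - e^{-ε}) and gε ≤ ry: the latter
turns an absolute error gε² or gε³ into a relative error ε or ε². -/
theorem lap_ratio_bounds {r : ℝ} (hr : 0 < r) {g ε : ℝ} (hg : 2 ≤ g) (hε : 0 ≤ ε) (hε1 : ε ≤ 1) :
    let D := 1 + (g - 1) / r * (1 - Real.exp (-ε))
    let y := 1 + g * ε / r
    y / 4 ≤ D ∧ D ≤ y ∧ |D / y - 1| ≤ (1 + 1 / r) * ε ∧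
      |D / y - 1 + (g * ε ^ 2 / 2 + ε) / (r * y)| ≤ (1 + 1 / r) * ε ^ 2 := by
  intro D y
  have hy1 : 1 ≤ y := by
    have : 0 ≤ g * ε / r := by positivity
    simp only [y]; linarith
  have he := Real.exp_bound (x := -ε) (by rw [abs_neg, abs_of_nonneg hε]; exact hε1)
    (n := 3) (by norm_num)
  simp only [Finset.sum_range_succ, Finset.range_zero, Finset.sum_empty, abs_neg,
    abs_of_nonneg hε] at he
  norm_num [Nat.factorial] at he
  have he2 := Real.one_sub_le_exp_neg ε
  have hle : Real.exp (-ε) ≤ 1 := Real.exp_le_one_iff.2 (by linarith)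
  have hD : r * D = r + (g - 1) * (1 - Real.exp (-ε)) := by simp only [D]; field_simp
  have hY : r * y = r + g * ε := by simp only [y]; field_simp
  have hE5 : ε / 2 ≤ 1 - Real.exp (-ε) := by
    have h1 : Real.exp (-ε) ≤ 1 / (1 + ε) := by
      rw [Real.exp_neg, one_div]
      exact inv_anti₀ (by linarith) (by linarith [Real.add_one_le_exp ε])
    have h2 : 1 / (1 + ε) ≤ 1 - ε / 2 := by
      rw [div_le_iff₀ (by linarith)]; nlinarith
    linarith
  have hry : 0 < r * y := by positivity
  have key : D / y - 1 = (r * D - r * y) / (r * y) := by field_simp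
  have hgy : g * ε ≤ r * y := by rw [hY]; linarith
  have hry1 : 1 ≤ 1 / r * (r * y) := by
    have : 1 / r * (r * y) = y := by field_simp
    rw [this]; exact hy1
  obtain ⟨he3, he4⟩ := abs_le.1 he
  generalize Real.exp (-ε) = E at *
  have hg0 : 0 ≤ g := by linarith
  have hE6 : 1 - E ≤ ε := by linarith
  have hε2 : ε ^ 2 ≤ ε := by nlinarith
  have hε3 : 0 ≤ ε ^ 3 := by positivity
  have a3 : g * ε * ε ≤ r * y * ε := mul_le_mul_of_nonneg_right hgy hε
  have a5 : g * ε * ε ^ 2 ≤ r * y * ε ^ 2 := mul_le_mul_of_nonneg_right hgy (sq_nonneg ε)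
  have a4 : 1 * ε ≤ 1 / r * (r * y) * ε := mul_le_mul_of_nonneg_right hry1 hε
  have a6 : 1 * ε ^ 2 ≤ 1 / r * (r * y) * ε ^ 2 := mul_le_mul_of_nonneg_right hry1 (sq_nonneg ε)
  refine ⟨?_, ?_, ?_, ?_⟩
  · have : r * (y / 4) ≤ r * D := by
      rw [hD, mul_div_assoc', hY]
      have : (g - 1) * (ε / 2) ≤ (g - 1) * (1 - E) :=
        mul_le_mul_of_nonneg_left hE5 (by linarith)
      nlinarith
    exact le_of_mul_le_mul_left this hr
  · have : r * D ≤ r * y := by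
      rw [hD, hY]
      have : (g - 1) * (1 - E) ≤ (g - 1) * ε := mul_le_mul_of_nonneg_left hE6 (by linarith)
      nlinarith
    exact le_of_mul_le_mul_left this hr
  · rw [key, abs_div, abs_of_pos hry, div_le_iff₀ hry]
    have hX : r * D - r * y = g * (1 - E - ε) - (1 - E) := by rw [hD, hY]; ring
    rw [hX]
    generalize r * y = Q at *
    generalize 1 / r = ρ at *
    have a1 : g * (1 - E - ε) ≤ 0 := mul_nonpos_of_nonneg_of_nonpos hg0 (by linarith)
    have a2 : g * (-ε ^ 2) ≤ g * (1 - E - ε) :=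
      mul_le_mul_of_nonneg_left (by nlinarith) hg0
    have hε0 : 0 ≤ (1 + ρ) * ε * Q := by linarith
    rw [abs_le]
    constructor
    · linarith
    · linarith
  · rw [key, ← add_div, abs_div, abs_of_pos hry, div_le_iff₀ hry]
    have hX : r * D - r * y + (g * ε ^ 2 / 2 + ε) =
        g * (1 - E - ε + ε ^ 2 / 2) + (ε - (1 - E)) := by rw [hD, hY]; ring
    rw [hX]
    generalize r * y = Q at *
    generalize 1 / r = ρ at *
    have b1 : g * (1 - E - ε + ε ^ 2 / 2) ≤ g * (ε ^ 3) :=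
      mul_le_mul_of_nonneg_left (by linarith) hg0
    have b2 : g * (-ε ^ 3) ≤ g * (1 - E - ε + ε ^ 2 / 2) :=
      mul_le_mul_of_nonneg_left (by linarith) hg0
    have b3 : ε - (1 - E) ≤ ε ^ 2 := by nlinarith
    have b4 : 0 ≤ ε - (1 - E) := by linarith
    rw [abs_le]
    constructor
    · linarith
    · linarith

/-- After D^{-r} = y^{-r} t^{-r} with t = D/y, the factors e^{-ε}, t^{-r} and 1 - 3ε/2 all differ
from 1 by O(ε), so their product is linear in the deviations up to O(ε²). The factor 1 - 3ε/2 is the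
trace of the term (3/4) zφ(z)/j of `medianApprox`. -/
theorem lap_expansion_near_zero {r : ℝ} (hr : 0 < r) : ∃ C, 0 ≤ C ∧ ∀ g ε : ℝ, 2 ≤ g → 0 ≤ ε → ε ≤ 1 →
    |Real.exp (-ε) * (1 + (g - 1) / r * (1 - Real.exp (-ε))) ^ (-r) * (1 - 3 * ε / 2) -
      (1 + g * ε / r) ^ (-r) *
        (1 + ((r - 2) * g * ε ^ 2 / (2 * r * (1 + g * ε / r)) - 3 * ε / 2))| ≤
      C * ((1 + g * ε / r) ^ (-r) * ε ^ 2) := by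
  set C1 := r * (r + 1) * 4 ^ (r + 2) with hC1
  have hC1' : 0 ≤ C1 := by positivity
  set B := 1 + 1 / r with hB
  have hB0 : 1 ≤ B := by rw [hB]; have : 0 < 1 / r := by positivity
                         linarith
  set A := r * B + C1 * B ^ 2 + 2 with hA
  have hA0 : 2 ≤ A := by have : 0 ≤ r * B + C1 * B ^ 2 := by positivity
                         linarith
  refine ⟨(3 * A ^ 2 + A ^ 3) + (1 + C1 * B ^ 2 + r * B), by positivity, ?_⟩
  intro g ε hg hε hε1
  obtain ⟨h1, h2, h3, h4⟩ := lap_ratio_bounds hr hg hε hε1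
  set D := 1 + (g - 1) / r * (1 - Real.exp (-ε)) with hD
  set y := 1 + g * ε / r with hy
  have hy1 : 1 ≤ y := by
    have : 0 ≤ g * ε / r := by positivity
    rw [hy]; linarith
  have hy0 : 0 < y := by linarith
  set t := D / y with ht
  have htI : t ∈ Set.Icc (1 / 4 : ℝ) 1 := by
    constructor
    · rw [ht, le_div_iff₀ hy0]; linarith
    · rw [ht, div_le_iff₀ hy0]; linarith
  have hT := abs_rpow_neg_sub_le hr htI
  have hDt : D ^ (-r) = y ^ (-r) * t ^ (-r) := by
    rw [← Real.mul_rpow hy0.le (by linarith [htI.1])]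
    congr 1; rw [ht]; field_simp
  have hex := Real.abs_exp_sub_one_sub_id_le (x := -ε) (by rw [abs_neg, abs_of_nonneg hε]; exact hε1)
  set E := Real.exp (-ε) with hE
  have hsq : (t - 1) ^ 2 ≤ B ^ 2 * ε ^ 2 := by
    rw [← mul_pow, ← sq_abs]; gcongr
  have hT2 : |t ^ (-r) - 1 + r * (t - 1)| ≤ C1 * B ^ 2 * ε ^ 2 := by
    refine hT.trans ?_
    rw [mul_assoc C1]; gcongr
  have hε2 : ε ^ 2 ≤ ε := by nlinarith
  have hα : |E - 1| ≤ A * ε := by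
    have hε' : |E - 1| ≤ 2 * ε := by
      have := abs_add_le (E - 1 - -ε) (-ε)
      rw [sub_add_cancel, abs_neg, abs_of_nonneg hε] at this
      have h5 : (-ε) ^ 2 = ε ^ 2 := by ring
      linarith
    exact hε'.trans (by gcongr)
  have hβ : |t ^ (-r) - 1| ≤ A * ε := by
    have h5 := abs_sub (t ^ (-r) - 1 + r * (t - 1)) (r * (t - 1))
    rw [add_sub_cancel_right, abs_mul, abs_of_pos hr] at h5
    have u1 : r * |t - 1| ≤ r * (B * ε) := by gcongr
    have hCB : C1 * B ^ 2 * ε ^ 2 ≤ C1 * B ^ 2 * ε := by gcongr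
    have : A * ε = r * (B * ε) + C1 * B ^ 2 * ε + 2 * ε := by rw [hA]; ring
    linarith
  have hγ : |-(3 * ε / 2)| ≤ A * ε := by
    rw [abs_neg, abs_of_nonneg (by positivity)]
    have : 2 * ε ≤ A * ε := by gcongr
    linarith
  have hM := abs_mul_three_sub_le (by linarith : 0 ≤ A) hε hε1 hα hβ hγ
  -- The first-order parts of t^{-r} and e^{-ε} nearly cancel; their sum carries the factor r - 2.
  have hid : (r - 2) * g * ε ^ 2 / (2 * r * y) = (g * ε ^ 2 / 2 + ε) / y - ε := by
    rw [eq_sub_iff_add_eq, div_add' _ _ _ (by positivity), div_eq_div_iff (by positivity) hy0.ne']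
    have : r * y = r + g * ε := by rw [hy]; field_simp
    linear_combination (2 * y * ε) * this
  have hid2 : (g * ε ^ 2 / 2 + ε) / y = r * ((g * ε ^ 2 / 2 + ε) / (r * y)) := by
    field_simp
  set w := (g * ε ^ 2 / 2 + ε) / (r * y)
  rw [hid, hid2, hDt]
  have e : E * (y ^ (-r) * t ^ (-r)) * (1 - 3 * ε / 2) - y ^ (-r) * (1 + (r * w - ε - 3 * ε / 2)) =
      y ^ (-r) * (((1 + (E - 1)) * (1 + (t ^ (-r) - 1)) * (1 + -(3 * ε / 2)) -
        (1 + (E - 1) + (t ^ (-r) - 1) + -(3 * ε / 2))) +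
        ((E - 1 - -ε) + (t ^ (-r) - 1 + r * (t - 1)) - r * (t - 1 + w))) := by ring
  have hyr : 0 ≤ y ^ (-r) := by positivity
  rw [e, abs_mul, abs_of_nonneg hyr]
  rw [show ∀ K : ℝ, K * (y ^ (-r) * ε ^ 2) = y ^ (-r) * (K * ε ^ 2) by intro K; ring]
  refine mul_le_mul_of_nonneg_left ?_ hyr
  refine (abs_add_le _ _).trans ?_
  rw [add_mul _ (1 + C1 * B ^ 2 + r * B)]
  refine add_le_add hM ?_
  refine (abs_sub _ _).trans ?_
  rw [abs_mul, abs_of_pos hr]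
  have u1 : r * |t - 1 + w| ≤ r * (B * ε ^ 2) := by gcongr
  have u2 := abs_add_le (E - 1 - -ε) (t ^ (-r) - 1 + r * (t - 1))
  have h5 : (-ε) ^ 2 = ε ^ 2 := by ring
  have : (1 + C1 * B ^ 2 + r * B) * ε ^ 2 = ε ^ 2 + C1 * B ^ 2 * ε ^ 2 + r * (B * ε ^ 2) := by ring
  linarith

theorem lapDen_lower {r : ℝ} (hr : 0 < r) {g ε : ℝ} (hg : 2 ≤ g) (hε1 : 1 ≤ ε) :
    g / (4 * r) ≤ 1 + (g - 1) / r * (1 - Real.exp (-ε)) := by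
  have h1 : Real.exp (-ε) ≤ 1 / 2 := by
    have : Real.exp (-ε) ≤ 1 / (1 + ε) := by
      rw [Real.exp_neg, one_div]
      exact inv_anti₀ (by linarith) (by linarith [Real.add_one_le_exp ε])
    refine this.trans ?_
    rw [div_le_div_iff₀ (by linarith) (by norm_num)]; linarith
  have h2 : (g / 2) / r * (1 / 2) ≤ (g - 1) / r * (1 - Real.exp (-ε)) := by
    have : 0 ≤ (g - 1) / r := div_nonneg (by linarith) hr.le
    gcongr <;> linarith
  have h3 : g / (4 * r) = (g / 2) / r * (1 / 2) := by field_simp; norm_num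
  linarith

/-- Beyond ε = 1 no expansion is needed: the denominator is of order g, so the transform is already
O(g^{-r}). -/
theorem lap_tail {r : ℝ} (hr : 0 < r) {g ε : ℝ} (hg : 2 ≤ g) (hε1 : 1 ≤ ε) :
    |Real.exp (-ε) * (1 + (g - 1) / r * (1 - Real.exp (-ε))) ^ (-r) * (1 - 3 * ε / 2)| ≤
      3 * (4 * r) ^ r * g ^ (-r) := by
  have h := lapDen_lower hr hg hε1
  have hpos : 0 < g / (4 * r) := by positivity
  have h1 : (1 + (g - 1) / r * (1 - Real.exp (-ε))) ^ (-r) ≤ (4 * r) ^ r * g ^ (-r) := by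
    refine (Real.rpow_le_rpow_of_nonpos hpos h (by linarith)).trans_eq ?_
    rw [Real.div_rpow (by linarith) (by positivity), Real.rpow_neg (by positivity : 0 ≤ 4 * r)]
    field_simp
  have h0 : 0 ≤ (1 + (g - 1) / r * (1 - Real.exp (-ε))) ^ (-r) :=
    Real.rpow_nonneg (hpos.le.trans h) _
  have h2 : |Real.exp (-ε) * (1 - 3 * ε / 2)| ≤ 3 := by
    have hE := Real.exp_pos (-ε)
    have hε2 : Real.exp (-ε) * (1 + ε) ≤ 1 := by
      rw [Real.exp_neg, inv_mul_le_iff₀ (Real.exp_pos _)]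
      linarith [Real.add_one_le_exp ε]
    rw [abs_le]; constructor <;> nlinarith
  calc _ = |Real.exp (-ε) * (1 - 3 * ε / 2)| *
        (1 + (g - 1) / r * (1 - Real.exp (-ε))) ^ (-r) := by
        rw [mul_right_comm, abs_mul, abs_of_nonneg h0]
    _ ≤ 3 * ((4 * r) ^ r * g ^ (-r)) := by gcongr
    _ = _ := by ring

/-- Second-order expansion of the Laplace transform, uniformly on the half-line. -/
theorem lap_expansion_of_one_lt {r : ℝ} (hr : 1 < r) : ∃ C, 0 ≤ C ∧ ∀ g ε : ℝ, 2 ≤ g → 0 ≤ ε →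
    |Real.exp (-ε) * (1 + (g - 1) / r * (1 - Real.exp (-ε))) ^ (-r) * (1 - 3 * ε / 2) -
      (1 + g * ε / r) ^ (-r) *
        (1 + ((r - 2) * g * ε ^ 2 / (2 * r * (1 + g * ε / r)) - 3 * ε / 2))| ≤
      C * g ^ (-min r (3 / 2)) := by
  have hr0 : 0 < r := by linarith
  obtain ⟨C, hC, h⟩ := lap_expansion_near_zero hr0
  -- The quadratic error would allow min(r, 2); the cap 3/2 is all that the median approximation can
  -- use.
  set m := min r (3 / 2) with hm
  have hm0 : 0 ≤ m := le_min hr0.le (by norm_num)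
  have hmr : m ≤ r := min_le_left _ _
  have hm2 : m ≤ 2 := (min_le_right _ _).trans (by norm_num)
  have hcr : ∀ q g : ℝ, 2 ≤ g → (r / g) ^ q = r ^ q * g ^ (-q) := by
    intro q g hg
    rw [Real.div_rpow hr0.le (by linarith), Real.rpow_neg (by linarith)]; rfl
  refine ⟨C * r ^ m + (3 * (4 * r) ^ r + (3 + |r - 2|) * r ^ r), by positivity, ?_⟩
  intro g ε hg hε
  have hg0 : 0 < g := by linarith
  have hgm : 0 ≤ g ^ (-m) := by positivity
  set y := 1 + g * ε / r with hy
  have hge : 0 ≤ g * ε / r := by positivity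
  have hy1 : 1 ≤ y := by rw [hy]; linarith
  have hyr : 0 ≤ y ^ (-r) := by positivity
  rcases le_or_gt ε 1 with hε1 | hε1
  · refine (h g ε hg hε hε1).trans ?_
    have h1 : ε ^ 2 ≤ ε ^ m := by
      rw [← Real.rpow_two]
      exact Real.rpow_le_rpow_of_exponent_ge_of_imp hε hε1 hm2 (fun _ h => absurd h (by norm_num))
    calc C * (y ^ (-r) * ε ^ 2) ≤ C * (y ^ (-r) * ε ^ m) := by gcongr
      _ ≤ C * (r / g) ^ m := by
        gcongr; exact rpow_neg_mul_rpow_le hr0 hm0 hmr hg0 hε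
      _ = C * r ^ m * g ^ (-m) := by rw [hcr m g hg]; ring
      _ ≤ _ := by
        gcongr
        have : 0 ≤ 3 * (4 * r) ^ r + (3 + |r - 2|) * r ^ r := by positivity
        linarith
  · refine (abs_sub _ _).trans ?_
    have hgr : g ^ (-r) ≤ g ^ (-m) :=
      Real.rpow_le_rpow_of_exponent_le (by linarith) (by linarith)
    have h1 := lap_tail hr0 hg hε1.le
    have h2 : |y ^ (-r) * (1 + ((r - 2) * g * ε ^ 2 / (2 * r * y) - 3 * ε / 2))| ≤
        (3 + |r - 2|) * r ^ r * g ^ (-r) := by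
      rw [abs_mul, abs_of_nonneg hyr]
      have h3 : |1 + ((r - 2) * g * ε ^ 2 / (2 * r * y) - 3 * ε / 2)| ≤ (3 + |r - 2|) * ε := by
        have e : (r - 2) * g * ε ^ 2 / (2 * r * y) = (r - 2) * ε * ((g * ε / r) / y) / 2 := by
          field_simp
        have h4 : (g * ε / r) / y ≤ 1 := by
          rw [div_le_one (by linarith), hy]; linarith
        have h5 : 0 ≤ (g * ε / r) / y := by positivity
        have h6 : |(r - 2) * ε * ((g * ε / r) / y) / 2| ≤ |r - 2| * ε := by
          rw [abs_div, abs_mul, abs_mul, abs_of_nonneg h5, abs_of_nonneg hε,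
            abs_of_pos (by norm_num : (0 : ℝ) < 2)]
          have : |r - 2| * ε * (g * ε / r / y) ≤ |r - 2| * ε * 1 := by gcongr
          have : 0 ≤ |r - 2| * ε := by positivity
          linarith
        rw [e]
        obtain ⟨u, v⟩ := abs_le.1 h6
        rw [abs_le]; constructor <;> nlinarith
      -- For ε > 1 and r > 1 the linear growth of the correction is still within the power ε^r that
      -- y^{-r} can absorb.
      have h7 : ε ≤ ε ^ r := Real.self_le_rpow_of_one_le hε1.le hr.le
      calc y ^ (-r) * |1 + ((r - 2) * g * ε ^ 2 / (2 * r * y) - 3 * ε / 2)|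
          ≤ y ^ (-r) * ((3 + |r - 2|) * ε ^ r) := by
            gcongr; exact h3.trans (by gcongr)
        _ = (3 + |r - 2|) * (y ^ (-r) * ε ^ r) := by ring
        _ ≤ (3 + |r - 2|) * (r / g) ^ r := by
            gcongr; exact rpow_neg_mul_rpow_le hr0 hr0.le le_rfl hg0 hε
        _ = _ := by rw [hcr r g hg]; ring
    have h8 : 0 ≤ C * r ^ m := by positivity
    calc _ ≤ 3 * (4 * r) ^ r * g ^ (-r) + (3 + |r - 2|) * r ^ r * g ^ (-r) := add_le_add h1 h2
      _ = (3 * (4 * r) ^ r + (3 + |r - 2|) * r ^ r) * g ^ (-r) := by ring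
      _ ≤ (3 * (4 * r) ^ r + (3 + |r - 2|) * r ^ r) * g ^ (-m) := by gcongr
      _ ≤ _ := mul_le_mul_of_nonneg_right (by linarith) hgm

/-- First-order expansion of the Laplace transform, uniformly on the half-line. -/
theorem lap_expansion_of_le_one {r : ℝ} (hr0 : 0 < r) (hr : r ≤ 1) :
    ∃ C, 0 ≤ C ∧ ∀ g ε : ℝ, 2 ≤ g → 0 ≤ ε →
    |Real.exp (-ε) * (1 + (g - 1) / r * (1 - Real.exp (-ε))) ^ (-r) * (1 - 3 * ε / 2) -
      (1 + g * ε / r) ^ (-r)| ≤ C * g ^ (-r) := by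
  obtain ⟨C, hC, h⟩ := lap_expansion_near_zero hr0
  have hcr : ∀ g : ℝ, 2 ≤ g → (r / g) ^ r = r ^ r * g ^ (-r) := by
    intro g hg
    rw [Real.div_rpow hr0.le (by linarith), Real.rpow_neg (by linarith)]; rfl
  refine ⟨(C + |r - 2| + 2) * r ^ r + (3 * (4 * r) ^ r + r ^ r), by positivity, ?_⟩
  intro g ε hg hε
  have hg0 : 0 < g := by linarith
  have hgm : 0 ≤ g ^ (-r) := by positivity
  set y := 1 + g * ε / r with hy
  have hge : 0 ≤ g * ε / r := by positivity
  have hy1 : 1 ≤ y := by rw [hy]; linarith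
  have hyr : 0 ≤ y ^ (-r) := by positivity
  have hkey := rpow_neg_mul_rpow_le hr0 hr0.le le_rfl hg0 hε
  rw [hcr g hg, ← hy] at hkey
  rcases le_or_gt ε 1 with hε1 | hε1
  · have h0 := h g ε hg hε hε1
    -- For r ≤ 1 the terms linear in ε already fall under ε^r, hence below g^{-r}, and only the
    -- leading term survives.
    have h1 : ε ≤ ε ^ r := by
      conv_lhs => rw [← Real.rpow_one ε]
      exact Real.rpow_le_rpow_of_exponent_ge_of_imp hε hε1 hr (fun _ h => absurd h (by norm_num))
    have h2 : ε ^ 2 ≤ ε ^ r := (by nlinarith : ε ^ 2 ≤ ε).trans h1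
    have e : (r - 2) * g * ε ^ 2 / (2 * r * y) = (r - 2) * ε * ((g * ε / r) / y) / 2 := by
      field_simp
    have h4 : (g * ε / r) / y ≤ 1 := by
      rw [div_le_one (by linarith), hy]; linarith
    have h5 : 0 ≤ (g * ε / r) / y := by positivity
    have h6 : |(r - 2) * ε * ((g * ε / r) / y) / 2| ≤ |r - 2| * ε := by
      rw [abs_div, abs_mul, abs_mul, abs_of_nonneg h5, abs_of_nonneg hε,
        abs_of_pos (by norm_num : (0 : ℝ) < 2)]
      have : |r - 2| * ε * (g * ε / r / y) ≤ |r - 2| * ε * 1 := by gcongr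
      have : 0 ≤ |r - 2| * ε := by positivity
      linarith
    have h3 : |(r - 2) * g * ε ^ 2 / (2 * r * y) - 3 * ε / 2| ≤ (|r - 2| + 2) * ε := by
      rw [e]
      refine (abs_sub _ _).trans ?_
      rw [abs_of_nonneg (by positivity : 0 ≤ 3 * ε / 2)]
      linarith
    set B := (r - 2) * g * ε ^ 2 / (2 * r * y) - 3 * ε / 2
    set Z := Real.exp (-ε) * (1 + (g - 1) / r * (1 - Real.exp (-ε))) ^ (-r) * (1 - 3 * ε / 2)
    have e2 : Z - y ^ (-r) = (Z - y ^ (-r) * (1 + B)) + y ^ (-r) * B := by ring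
    rw [e2]
    refine (abs_add_le _ _).trans ?_
    rw [abs_mul, abs_of_nonneg hyr]
    calc _ ≤ C * (y ^ (-r) * ε ^ 2) + y ^ (-r) * ((|r - 2| + 2) * ε) := by gcongr
      _ ≤ C * (y ^ (-r) * ε ^ r) + y ^ (-r) * ((|r - 2| + 2) * ε ^ r) := by gcongr
      _ = (C + |r - 2| + 2) * (y ^ (-r) * ε ^ r) := by ring
      _ ≤ (C + |r - 2| + 2) * (r ^ r * g ^ (-r)) := by gcongr
      _ = (C + |r - 2| + 2) * r ^ r * g ^ (-r) := by ring
      _ ≤ _ := by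
        gcongr
        have : 0 ≤ 3 * (4 * r) ^ r + r ^ r := by positivity
        linarith
  · refine (abs_sub _ _).trans ?_
    have h1 := lap_tail hr0 hg hε1.le
    have h2 : |y ^ (-r)| ≤ r ^ r * g ^ (-r) := by
      rw [abs_of_nonneg hyr]
      refine le_trans ?_ hkey
      have : 1 ≤ ε ^ r := Real.one_le_rpow hε1.le hr0.le
      nlinarith
    calc _ ≤ 3 * (4 * r) ^ r * g ^ (-r) + r ^ r * g ^ (-r) := add_le_add h1 h2
      _ = (3 * (4 * r) ^ r + r ^ r) * g ^ (-r) := by ring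
      _ ≤ _ := by
        refine mul_le_mul_of_nonneg_right ?_ hgm
        have : 0 ≤ (C + |r - 2| + 2) * r ^ r := by positivity
        linarith

/-! ### The moment of order -3/2 of the random sample size. -/

theorem integrableOn_rpow_mul_exp {s a : ℝ} (hs : 0 < s) (ha : 0 < a) :
    IntegrableOn (fun v : ℝ => v ^ (s - 1) * Real.exp (-(a * v))) (Set.Ioi 0) := by
  -- The integral of a non-integrable function is 0 by convention, so a nonzero value proves
  -- integrability. The same device recurs below.
  refine Integrable.of_integral_ne_zero ?_
  rw [Real.integral_rpow_mul_exp_neg_mul_Ioi hs ha]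
  have := Real.Gamma_pos_of_pos hs
  positivity

theorem g_sub_one_div {r : ℝ} (hr : 0 < r) (n : ℕ) : (g r n - 1) / r = (n : ℝ) - 1 := by
  unfold g; field_simp; ring

theorem lapDen_eq {r : ℝ} (hr : 0 < r) (n : ℕ) (s : ℝ) :
    lapDen n s = 1 + (g r n - 1) / r * (1 - Real.exp (-s)) := by
  rw [g_sub_one_div hr]; rfl

theorem integral_rpow_one_add_mul_le {q c : ℝ} (hc : 0 < c) (hq : q ≠ 1) :
    ∫ v in (0 : ℝ)..1, (1 + c * v) ^ (-q) = ((1 + c) ^ (1 - q) - 1) / (c * (1 - q)) := by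
  have hq' : 1 - q ≠ 0 := sub_ne_zero.2 hq.symm
  have hpos : ∀ v ∈ Set.uIcc (0 : ℝ) 1, 0 < 1 + c * v := by
    intro v hv
    rw [Set.uIcc_of_le zero_le_one] at hv
    have := mul_nonneg hc.le hv.1
    linarith
  have h := intervalIntegral.integral_eq_sub_of_hasDerivAt
    (f := fun v => (1 + c * v) ^ (1 - q) / (c * (1 - q))) (f' := fun v => (1 + c * v) ^ (-q))
    (a := 0) (b := 1) (fun v hv => by
      have h1 : HasDerivAt (fun v => 1 + c * v) c v := by
        simpa using ((hasDerivAt_id v).const_mul c).const_add 1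
      have h2 := (h1.rpow_const (p := 1 - q) (Or.inl (hpos v hv).ne')).div_const (c * (1 - q))
      refine h2.congr_deriv ?_
      have : (1 - q - 1) = -q := by ring
      rw [this]; field_simp)
    (by
      refine ContinuousOn.intervalIntegrable ?_
      exact ContinuousOn.rpow_const (by fun_prop) (fun v hv => Or.inl (hpos v hv).ne'))
  rw [h, mul_zero, mul_one, add_zero, Real.one_rpow, ← sub_div]

theorem integral_inv_one_add_mul {c : ℝ} (hc : 0 < c) :
    ∫ v in (0 : ℝ)..1, (1 + c * v) ^ (-1 : ℝ) = Real.log (1 + c) / c := by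
  have hpos : ∀ v ∈ Set.uIcc (0 : ℝ) 1, 0 < 1 + c * v := by
    intro v hv
    rw [Set.uIcc_of_le zero_le_one] at hv
    have := mul_nonneg hc.le hv.1
    linarith
  have h := intervalIntegral.integral_eq_sub_of_hasDerivAt
    (f := fun v => Real.log (1 + c * v) / c) (f' := fun v => (1 + c * v) ^ (-1 : ℝ))
    (a := 0) (b := 1) (fun v hv => by
      have h1 : HasDerivAt (fun v => 1 + c * v) c v := by
        simpa using ((hasDerivAt_id v).const_mul c).const_add 1
      have h2 := (h1.log (hpos v hv).ne').div_const c
      refine h2.congr_deriv ?_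
      rw [Real.rpow_neg_one]; field_simp)
    (by
      refine ContinuousOn.intervalIntegrable ?_
      exact ContinuousOn.rpow_const (by fun_prop) (fun v hv => Or.inl (hpos v hv).ne'))
  rw [h]; simp

/-- The origin of the three regimes of `rate`: with q = r - 1/2 the integral of (1 + nv/4)^{-q} over
[0, 1] is of order n^{-q} for q < 1, n^{-1} log n for q = 1 and n^{-1} for q > 1. -/
theorem integral_sqrt_mul_rpow_le {r : ℝ} : ∃ C, 0 ≤ C ∧ ∀ n : ℕ, 2 ≤ n →
    ∫ v in (0 : ℝ)..1, (n / 4 : ℝ) ^ (-(1 / 2) : ℝ) * (1 + n / 4 * v) ^ (-(r - 1 / 2)) ≤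
      C * rate r n := by
  by_cases hr : r = 3 / 2
  · refine ⟨4 ^ (3 / 2 : ℝ), by positivity, fun n hn => ?_⟩
    have hn2 : (2 : ℝ) ≤ n := by exact_mod_cast hn
    have hc : (0 : ℝ) < n / 4 := by linarith
    subst hr
    rw [intervalIntegral.integral_const_mul, show (-(3 / 2 - 1 / 2) : ℝ) = -1 by norm_num,
      integral_inv_one_add_mul hc, rate, if_pos rfl]
    have h1 : Real.log (1 + n / 4) ≤ Real.log n := Real.log_le_log (by linarith) (by linarith)
    have e : (n / 4 : ℝ) ^ (-(1 / 2) : ℝ) / (n / 4) = 4 ^ (3 / 2 : ℝ) * (n : ℝ) ^ (-(3 / 2) : ℝ) := by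
      have : (n / 4 : ℝ) ^ (-(1 / 2) : ℝ) / (n / 4) = (n / 4 : ℝ) ^ (-(3 / 2) : ℝ) := by
        rw [show (-(3 / 2) : ℝ) = -(1 / 2) - 1 by norm_num, Real.rpow_sub hc, Real.rpow_one]
      rw [this, Real.div_rpow (by linarith) (by norm_num), Real.rpow_neg (by norm_num : (0:ℝ) ≤ 4)]
      field_simp
    calc _ = (n / 4 : ℝ) ^ (-(1 / 2) : ℝ) / (n / 4) * Real.log (1 + n / 4) := by ring
      _ ≤ (n / 4 : ℝ) ^ (-(1 / 2) : ℝ) / (n / 4) * Real.log n := by gcongr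
      _ = _ := by rw [e]; ring
  · set q := r - 1 / 2 with hq
    have hq1 : q ≠ 1 := fun h => hr (by rw [hq] at h; linarith)
    have hq1' : 1 - q ≠ 0 := sub_ne_zero.2 hq1.symm
    refine ⟨4 ^ (3 / 2 : ℝ) / |1 - q|, by positivity, fun n hn => ?_⟩
    have hn2 : (2 : ℝ) ≤ n := by exact_mod_cast hn
    have hc : (0 : ℝ) < n / 4 := by linarith
    rw [intervalIntegral.integral_const_mul, integral_rpow_one_add_mul_le hc hq1, rate, if_neg hr]
    have e : (n / 4 : ℝ) ^ (-(1 / 2) : ℝ) / (n / 4) = 4 ^ (3 / 2 : ℝ) * (n : ℝ) ^ (-(3 / 2) : ℝ) := by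
      have : (n / 4 : ℝ) ^ (-(1 / 2) : ℝ) / (n / 4) = (n / 4 : ℝ) ^ (-(3 / 2) : ℝ) := by
        rw [show (-(3 / 2) : ℝ) = -(1 / 2) - 1 by norm_num, Real.rpow_sub hc, Real.rpow_one]
      rw [this, Real.div_rpow (by linarith) (by norm_num), Real.rpow_neg (by norm_num : (0:ℝ) ≤ 4)]
      field_simp
    have key : ((1 + n / 4 : ℝ) ^ (1 - q) - 1) / (1 - q) ≤ n ^ (3 / 2 - min r (3 / 2)) / |1 - q| := by
      rcases lt_or_gt_of_ne hr with h | h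
      · have h0 : 0 < 1 - q := by rw [hq]; linarith
        rw [min_eq_left h.le, abs_of_pos h0, show 3 / 2 - r = 1 - q by rw [hq]; ring]
        gcongr
        have : (1 + n / 4 : ℝ) ^ (1 - q) ≤ n ^ (1 - q) :=
          Real.rpow_le_rpow (by linarith) (by linarith) h0.le
        linarith
      · have h0 : 1 - q < 0 := by rw [hq]; linarith
        rw [min_eq_right h.le, abs_of_neg h0, sub_self, Real.rpow_zero, ← neg_div_neg_eq]
        have : 0 < -(1 - q) := by linarith
        gcongr
        have : 0 ≤ (1 + n / 4 : ℝ) ^ (1 - q) := by positivity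
        linarith
    have e2 : (n : ℝ) ^ (-(3 / 2) : ℝ) * n ^ (3 / 2 - min r (3 / 2)) = (n : ℝ) ^ (-min r (3 / 2)) := by
      rw [← Real.rpow_add (by linarith)]; congr 1; ring
    calc _ = (n / 4 : ℝ) ^ (-(1 / 2) : ℝ) / (n / 4) *
          (((1 + n / 4 : ℝ) ^ (1 - q) - 1) / (1 - q)) := by field_simp
      _ ≤ (n / 4 : ℝ) ^ (-(1 / 2) : ℝ) / (n / 4) * (n ^ (3 / 2 - min r (3 / 2)) / |1 - q|) := by
          gcongr
      _ = _ := by rw [e, ← e2]; ring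

/-- The bound n ≥ 3 ensures log n ≥ 1 in the critical case. -/
theorem rpow_neg_min_le_rate {r : ℝ} {n : ℕ} (hn : 3 ≤ n) :
    (n : ℝ) ^ (-min r (3 / 2)) ≤ rate r n := by
  have hn3 : (3 : ℝ) ≤ n := by exact_mod_cast hn
  unfold rate
  split_ifs with h
  · rw [h, min_self]
    have : 1 ≤ Real.log n := by
      rw [Real.le_log_iff_exp_le (by linarith)]
      linarith [Real.exp_one_lt_d9]
    have h0 : 0 ≤ (n : ℝ) ^ (-(3 / 2) : ℝ) := by positivity
    nlinarith
  · exact le_rfl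

/-- From v ≤ (4/n)(1 + nv/4) the factor √v is merged into the power of 1 + nv/4, which leaves an
elementary integral. -/
theorem integrand_near_zero {r : ℝ} (hr : 0 < r) {n : ℕ} (hn : 2 ≤ n) {v : ℝ} (hv : 0 < v)
    (hv1 : v ≤ 1) : v ^ (1 / 2 : ℝ) * (Real.exp (-v) * lapDen n v ^ (-r)) ≤
      (n / 4 : ℝ) ^ (-(1 / 2) : ℝ) * (1 + n / 4 * v) ^ (-(r - 1 / 2)) := by
  have hn2 : (2 : ℝ) ≤ n := by exact_mod_cast hn
  have hc : (0 : ℝ) < n / 4 := by linarith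
  have hE : Real.exp (-v) ≤ 1 := Real.exp_le_one_iff.2 (by linarith)
  have hE5 : v / 2 ≤ 1 - Real.exp (-v) := by
    have h1 : Real.exp (-v) ≤ 1 / (1 + v) := by
      rw [Real.exp_neg, one_div]
      exact inv_anti₀ (by linarith) (by linarith [Real.add_one_le_exp v])
    have h2 : 1 / (1 + v) ≤ 1 - v / 2 := by
      rw [div_le_iff₀ (by linarith)]; nlinarith
    linarith
  have hcv : 0 < 1 + n / 4 * v := by positivity
  have hD : 1 + n / 4 * v ≤ lapDen n v := by
    unfold lapDen
    have : (n / 2 : ℝ) * (v / 2) ≤ ((n : ℝ) - 1) * (1 - Real.exp (-v)) := by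
      apply mul_le_mul (by linarith) hE5 (by linarith) (by linarith)
    linarith
  have h1 : lapDen n v ^ (-r) ≤ (1 + n / 4 * v) ^ (-r) :=
    Real.rpow_le_rpow_of_nonpos hcv hD (by linarith)
  have h2 : v ^ (1 / 2 : ℝ) ≤ (n / 4 : ℝ) ^ (-(1 / 2) : ℝ) * (1 + n / 4 * v) ^ (1 / 2 : ℝ) := by
    rw [Real.rpow_neg hc.le, ← Real.inv_rpow hc.le, ← Real.mul_rpow (by positivity) hcv.le]
    refine Real.rpow_le_rpow hv.le ?_ (by norm_num)
    rw [mul_add, inv_mul_cancel_left₀ hc.ne']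
    have : 0 < (n / 4 : ℝ)⁻¹ := by positivity
    linarith
  have h0 : 0 ≤ lapDen n v ^ (-r) := Real.rpow_nonneg (hcv.le.trans hD) _
  calc _ ≤ ((n / 4 : ℝ) ^ (-(1 / 2) : ℝ) * (1 + n / 4 * v) ^ (1 / 2 : ℝ)) *
        (1 * (1 + n / 4 * v) ^ (-r)) := by gcongr
    _ = (n / 4 : ℝ) ^ (-(1 / 2) : ℝ) * ((1 + n / 4 * v) ^ (1 / 2 : ℝ) * (1 + n / 4 * v) ^ (-r)) := by
        ring
    _ = _ := by
        rw [← Real.rpow_add hcv]; congr 2; ring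

/-- The moment `E N^{-3/2}` of the shifted negative binomial distribution. -/
theorem tsum_negBinMass_mul_rpow_le {r : ℝ} (hr : 0 < r) : ∃ C, 0 ≤ C ∧ ∀ n : ℕ, 3 ≤ n →
    Summable (fun i : ℕ => negBinMass r n (i + 1) * ((i : ℝ) + 1) ^ (-(3 / 2) : ℝ)) ∧
    ∑' i : ℕ, negBinMass r n (i + 1) * ((i : ℝ) + 1) ^ (-(3 / 2) : ℝ) ≤ C * rate r n := by
  obtain ⟨C, hC, hI⟩ := integral_sqrt_mul_rpow_le (r := r)
  set G := Real.Gamma (3 / 2) with hG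
  have hG0 : 0 < G := Real.Gamma_pos_of_pos (by norm_num)
  refine ⟨(C + 4 ^ r * G) / G, by positivity, fun n hn => ?_⟩
  have hn1 : 1 ≤ n := by omega
  have hn2 : 2 ≤ n := by omega
  have hn3 : (3 : ℝ) ≤ n := by exact_mod_cast hn
  have hm := fun i => negBinMass_nonneg hr hn1 i
  have hsum : Summable (fun i : ℕ => negBinMass r n (i + 1) * ((i : ℝ) + 1) ^ (-(3 / 2) : ℝ)) := by
    refine Summable.of_nonneg_of_le (fun i => mul_nonneg (hm i) (by positivity)) (fun i => ?_)
      (hasSum_negBinMass hr hn1).summable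
    have : ((i : ℝ) + 1) ^ (-(3 / 2) : ℝ) ≤ 1 :=
      Real.rpow_le_one_of_one_le_of_nonpos (by linarith [(Nat.cast_nonneg i : (0 : ℝ) ≤ i)])
        (by norm_num)
    nlinarith [hm i]
  refine ⟨hsum, ?_⟩
  -- Γ(3/2) j^{-3/2} is the integral of v^{1/2} e^{-jv}; summing over j turns the moment into an
  -- integral of the Laplace transform.
  have hint : ∀ i : ℕ, IntegrableOn (fun v : ℝ => negBinMass r n (i + 1) *
      (v ^ (3 / 2 - 1 : ℝ) * Real.exp (-((i + 1 : ℝ) * v)))) (Set.Ioi 0) := fun i =>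
    (integrableOn_rpow_mul_exp (by norm_num) (by positivity)).const_mul _
  have hval : ∀ i : ℕ, ∫ v in Set.Ioi (0 : ℝ), negBinMass r n (i + 1) *
      (v ^ (3 / 2 - 1 : ℝ) * Real.exp (-((i + 1 : ℝ) * v))) =
      G * (negBinMass r n (i + 1) * ((i : ℝ) + 1) ^ (-(3 / 2) : ℝ)) := fun i => by
    rw [integral_const_mul, Real.integral_rpow_mul_exp_neg_mul_Ioi (by norm_num) (by positivity),
      one_div, Real.inv_rpow (by positivity), ← Real.rpow_neg (by positivity)]
    ring
  have hnorm : ∀ i : ℕ, ∫ v in Set.Ioi (0 : ℝ), ‖negBinMass r n (i + 1) *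
      (v ^ (3 / 2 - 1 : ℝ) * Real.exp (-((i + 1 : ℝ) * v)))‖ =
      G * (negBinMass r n (i + 1) * ((i : ℝ) + 1) ^ (-(3 / 2) : ℝ)) := fun i => by
    rw [← hval i]
    refine setIntegral_congr_fun measurableSet_Ioi fun v hv => ?_
    have hv : (0 : ℝ) < v := hv
    simp only [Real.norm_eq_abs]
    exact abs_of_nonneg (mul_nonneg (hm i) (by positivity))
  have hS := hasSum_integral_of_summable_integral_norm hint
    (by simp_rw [hnorm]; exact hsum.mul_left G)
  simp_rw [hval] at hS
  have hS2 := (hsum.hasSum.mul_left G).unique hS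
  have htot : ∀ v ∈ Set.Ioi (0 : ℝ), ∑' i : ℕ, negBinMass r n (i + 1) *
      (v ^ (3 / 2 - 1 : ℝ) * Real.exp (-((i + 1 : ℝ) * v))) =
      v ^ (1 / 2 : ℝ) * (Real.exp (-v) * lapDen n v ^ (-r)) := by
    intro v hv
    have hv : (0 : ℝ) < v := hv
    have h := (hasSum_negBinMass_mul_exp hr hn1 hv.le).mul_left (v ^ (1 / 2 : ℝ))
    rw [← h.tsum_eq]
    refine tsum_congr fun i => ?_
    rw [mul_comm v, show (3 / 2 - 1 : ℝ) = 1 / 2 by norm_num]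
    ring
  rw [setIntegral_congr_fun measurableSet_Ioi htot] at hS2
  have hpos : ∀ v : ℝ, 0 < v → 0 ≤ v ^ (1 / 2 : ℝ) * (Real.exp (-v) * lapDen n v ^ (-r)) := by
    intro v hv
    have := one_le_lapDen hn1 hv.le
    positivity
  have hgn : (4 : ℝ) ^ r * n ^ (-r) = (n / 4 : ℝ) ^ (-r) := by
    rw [Real.div_rpow (by linarith) (by norm_num), Real.rpow_neg (by norm_num : (0:ℝ) ≤ 4)]
    field_simp
  have hfin : ∫ v in Set.Ioi (0 : ℝ), v ^ (1 / 2 : ℝ) * (Real.exp (-v) * lapDen n v ^ (-r)) ≤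
      (C + 4 ^ r * G) * rate r n := by
    have hA : IntegrableOn (fun v : ℝ => (n / 4 : ℝ) ^ (-(1 / 2) : ℝ) *
        (1 + n / 4 * v) ^ (-(r - 1 / 2))) (Set.Ioc 0 1) := by
      rw [← intervalIntegrable_iff_integrableOn_Ioc_of_le zero_le_one]
      refine ContinuousOn.intervalIntegrable ?_
      refine continuousOn_const.mul (ContinuousOn.rpow_const (by fun_prop) (fun v hv => Or.inl ?_))
      rw [Set.uIcc_of_le zero_le_one] at hv
      have : 0 ≤ (n / 4 : ℝ) * v := mul_nonneg (by positivity) hv.1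
      linarith
    have hB : IntegrableOn (fun v : ℝ => 4 ^ r * (n : ℝ) ^ (-r) *
        (v ^ (3 / 2 - 1 : ℝ) * Real.exp (-(1 * v)))) (Set.Ioi 0) :=
      (integrableOn_rpow_mul_exp (by norm_num) one_pos).const_mul _
    have h1 : ∫ v in Set.Ioi (0 : ℝ), v ^ (1 / 2 : ℝ) * (Real.exp (-v) * lapDen n v ^ (-r)) ≤
        ∫ v in Set.Ioi (0 : ℝ), ((Set.Ioc (0 : ℝ) 1).indicator (fun v : ℝ =>
          (n / 4 : ℝ) ^ (-(1 / 2) : ℝ) * (1 + n / 4 * v) ^ (-(r - 1 / 2))) v +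
          4 ^ r * (n : ℝ) ^ (-r) * (v ^ (3 / 2 - 1 : ℝ) * Real.exp (-(1 * v)))) := by
      refine integral_mono_of_nonneg ?_ ?_ ?_
      · exact (ae_restrict_iff' measurableSet_Ioi).2 (ae_of_all _ fun v hv => hpos v hv)
      · refine Integrable.add ?_ hB
        rw [integrable_indicator_iff measurableSet_Ioc]
        rw [IntegrableOn, Measure.restrict_restrict measurableSet_Ioc]
        exact hA.mono_set Set.inter_subset_left
      · refine (ae_restrict_iff' measurableSet_Ioi).2 (ae_of_all _ fun v hv => ?_)
        have hv : (0 : ℝ) < v := hv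
        have hB0 : 0 ≤ 4 ^ r * (n : ℝ) ^ (-r) * (v ^ (3 / 2 - 1 : ℝ) * Real.exp (-(1 * v))) := by
          positivity
        by_cases hv1 : v ≤ 1
        · have : v ∈ Set.Ioc (0 : ℝ) 1 := ⟨hv, hv1⟩
          simp only [Set.indicator_of_mem this]
          linarith [integrand_near_zero hr hn2 hv hv1]
        · have : v ∉ Set.Ioc (0 : ℝ) 1 := fun h => hv1 h.2
          simp only [Set.indicator_of_notMem this, zero_add]
          have hD : (n / 4 : ℝ) ≤ lapDen n v := by
            have hh : Real.exp (-v) ≤ 1 / 2 := by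
              have : Real.exp (-v) ≤ 1 / (1 + v) := by
                rw [Real.exp_neg, one_div]
                exact inv_anti₀ (by linarith) (by linarith [Real.add_one_le_exp v])
              refine this.trans ?_
              rw [div_le_div_iff₀ (by linarith) (by norm_num)]; linarith
            unfold lapDen
            nlinarith
          have h2 : lapDen n v ^ (-r) ≤ 4 ^ r * n ^ (-r) := by
            rw [hgn]
            exact Real.rpow_le_rpow_of_nonpos (by positivity) hD (by linarith)
          rw [one_mul, show (3 / 2 - 1 : ℝ) = 1 / 2 by norm_num]
          calc _ = lapDen n v ^ (-r) * (v ^ (1 / 2 : ℝ) * Real.exp (-v)) := by ring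
            _ ≤ _ := by gcongr
    refine h1.trans ?_
    rw [integral_add, integral_const_mul, Real.integral_rpow_mul_exp_neg_mul_Ioi (by norm_num) one_pos,
      setIntegral_indicator measurableSet_Ioc, Set.inter_eq_right.2 Set.Ioc_subset_Ioi_self,
      ← intervalIntegral.integral_of_le zero_le_one]
    · have h3 : (n : ℝ) ^ (-r) ≤ rate r n := by
        refine le_trans ?_ (rpow_neg_min_le_rate hn)
        exact Real.rpow_le_rpow_of_exponent_le (by linarith) (neg_le_neg (min_le_left _ _))
      rw [add_mul]
      refine add_le_add (hI n hn2) ?_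
      rw [div_one, Real.one_rpow, one_mul, ← hG]
      calc _ = 4 ^ r * G * (n : ℝ) ^ (-r) := by ring
        _ ≤ _ := by gcongr
    · rw [integrable_indicator_iff measurableSet_Ioc, IntegrableOn,
        Measure.restrict_restrict measurableSet_Ioc]
      exact hA.mono_set Set.inter_subset_left
    · exact hB
  rw [div_mul_eq_mul_div, le_div_iff₀ hG0, mul_comm, hS2]
  exact hfin

/-! ### Integral representations of the normal and Student distributions -/

/-- The standard normal density. -/
noncomputable def npdf (t : ℝ) : ℝ := (√(2 * Real.pi))⁻¹ * Real.exp (-(t ^ 2 / 2))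

/-- The odd part `Φ - 1/2` of the standard normal distribution function. -/
noncomputable def ncdf (z : ℝ) : ℝ := ∫ t in (0 : ℝ)..z, npdf t

theorem continuous_npdf : Continuous npdf := by unfold npdf; fun_prop

theorem integral_Ioi_one_add_sq_inv : ∫ ω in Set.Ioi (0 : ℝ), (1 + ω ^ 2)⁻¹ = Real.pi / 2 := by
  rw [integral_Ioi_inv_one_add_sq]; simp

theorem one_add_sq_pos (ω : ℝ) : 0 < 1 + ω ^ 2 := by positivity

/-- The t-derivative of -h(t²(1+ω²)/2) is t(1+ω²) k(t²(1+ω²)/2), so integrating over t and then over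
ω gives the left side; positivity of k permits the swap. With h = e^{-v} it yields Craig's formula,
with h = (1 + v/r)^{-r} its Student analogue. -/
theorem craig_fubini {h k : ℝ → ℝ} (hh : ∀ v, 0 ≤ v → HasDerivAt h (-k v) v)
    (hk0 : ∀ v, 0 ≤ v → 0 ≤ k v) (hk : ContinuousOn k (Set.Ici 0)) (hh0 : ∀ v, 0 ≤ v → 0 ≤ h v)
    {z : ℝ} (hz : 0 ≤ z) :
    ∫ ω in Set.Ioi (0 : ℝ), (h 0 - h (z ^ 2 / 2 * (1 + ω ^ 2))) * (1 + ω ^ 2)⁻¹ =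
      ∫ t in (0 : ℝ)..z, ∫ ω in Set.Ioi (0 : ℝ), t * k (t ^ 2 / 2 * (1 + ω ^ 2)) := by
  have hv : ∀ t ω : ℝ, 0 ≤ t ^ 2 / 2 * (1 + ω ^ 2) := fun t ω => by positivity
  have hcont : Continuous (fun p : ℝ × ℝ => p.2 * k (p.2 ^ 2 / 2 * (1 + p.1 ^ 2))) := by
    refine continuous_snd.mul ?_
    exact hk.comp_continuous (by fun_prop) (fun p => hv _ _)
  have hinner : ∀ ω : ℝ, ∫ t in (0 : ℝ)..z, t * k (t ^ 2 / 2 * (1 + ω ^ 2)) =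
      (h 0 - h (z ^ 2 / 2 * (1 + ω ^ 2))) * (1 + ω ^ 2)⁻¹ := by
    intro ω
    have hp := one_add_sq_pos ω
    rw [intervalIntegral.integral_eq_sub_of_hasDerivAt
      (f := fun t => -h (t ^ 2 / 2 * (1 + ω ^ 2)) * (1 + ω ^ 2)⁻¹)]
    · simp; ring
    · intro t _
      have h1 : HasDerivAt (fun t : ℝ => t ^ 2 / 2 * (1 + ω ^ 2)) (t * (1 + ω ^ 2)) t := by
        refine (((hasDerivAt_pow 2 t).div_const 2).mul_const (1 + ω ^ 2)).congr_deriv ?_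
        simp
      refine (((hh _ (hv t ω)).comp t h1).neg.mul_const (1 + ω ^ 2)⁻¹).congr_deriv ?_
      field_simp
    · exact (hcont.comp (by fun_prop : Continuous fun t : ℝ => (ω, t))).intervalIntegrable _ _
  have hmono : ∀ v, 0 ≤ v → h v ≤ h 0 := by
    have : AntitoneOn h (Set.Ici 0) := by
      refine antitoneOn_of_hasDerivWithinAt_nonpos (convex_Ici 0) (f' := fun v => -k v)
        (fun v hv => (hh v hv).continuousAt.continuousWithinAt) ?_ ?_
      · intro v hv
        rw [interior_Ici] at hv
        exact (hh v (le_of_lt hv)).hasDerivWithinAt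
      · intro v hv
        rw [interior_Ici] at hv
        linarith [hk0 v (le_of_lt hv)]
    exact fun v hv => this Set.self_mem_Ici hv hv
  have hint : Integrable (fun ω => (h 0 - h (z ^ 2 / 2 * (1 + ω ^ 2))) * (1 + ω ^ 2)⁻¹)
      (volume.restrict (Set.Ioi (0 : ℝ))) := by
    refine (integrable_inv_one_add_sq.integrableOn.const_mul (h 0)).mono' ?_ ?_
    · refine Continuous.aestronglyMeasurable ?_
      have hc : ContinuousOn h (Set.Ici 0) := fun v hv => (hh v hv).continuousAt.continuousWithinAt
      refine Continuous.mul ?_ ?_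
      · exact continuous_const.sub (hc.comp_continuous (by fun_prop) (fun ω => hv z ω))
      · exact Continuous.inv₀ (by fun_prop) (fun ω => (one_add_sq_pos ω).ne')
    · refine ae_of_all _ fun ω => ?_
      have hp := one_add_sq_pos ω
      rw [Real.norm_eq_abs, abs_of_nonneg (mul_nonneg (by linarith [hmono _ (hv z ω)]) (by positivity))]
      gcongr
      linarith [hh0 _ (hv z ω)]
  simp_rw [intervalIntegral.integral_of_le hz] at hinner ⊢
  rw [integral_integral_swap]
  · exact integral_congr_ae (ae_of_all _ fun ω => (hinner ω).symm)
  · rw [← integrable_swap_iff]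
    rw [integrable_prod_iff]
    · constructor
      · refine ae_of_all _ fun ω => ?_
        exact ((hcont.comp (by fun_prop : Continuous fun t : ℝ => (ω, t))).integrableOn_Ioc)
      · refine hint.congr (ae_of_all _ fun ω => ?_)
        show _ = ∫ t in Set.Ioc 0 z, ‖t * k (t ^ 2 / 2 * (1 + ω ^ 2))‖
        refine (hinner ω).symm.trans ?_
        refine setIntegral_congr_fun measurableSet_Ioc fun t ht => ?_
        exact (abs_of_nonneg (mul_nonneg ht.1.le (hk0 _ (hv t ω)))).symm
    · exact hcont.aestronglyMeasurable

theorem integral_Ioi_const_mul_inv {c : ℝ} :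
    ∫ ω in Set.Ioi (0 : ℝ), c * (1 + ω ^ 2)⁻¹ = c * (Real.pi / 2) := by
  rw [integral_const_mul, integral_Ioi_one_add_sq_inv]

theorem integrableOn_mul_inv_one_add_sq {f : ℝ → ℝ} {C : ℝ} (hf : Measurable f)
    (hC : ∀ ω, |f ω| ≤ C) :
    IntegrableOn (fun ω => f ω * (1 + ω ^ 2)⁻¹) (Set.Ioi (0 : ℝ)) := by
  refine (integrable_inv_one_add_sq.integrableOn.const_mul C).mono' ?_ ?_
  · exact (by fun_prop : Measurable fun ω => f ω * (1 + ω ^ 2)⁻¹).aestronglyMeasurable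
  · refine ae_of_all _ fun ω => ?_
    have hp := one_add_sq_pos ω
    rw [norm_mul, Real.norm_eq_abs, Real.norm_eq_abs, abs_of_pos (inv_pos.2 hp)]
    gcongr
    exact hC ω

theorem integral_exp_neg_sq_mul {z : ℝ} (hz : 0 < z) :
    ∫ ω in Set.Ioi (0 : ℝ), z * Real.exp (-(z ^ 2 / 2 * (1 + ω ^ 2))) =
      Real.pi * npdf z := by
  have e : ∀ ω : ℝ, z * Real.exp (-(z ^ 2 / 2 * (1 + ω ^ 2))) =
      z * Real.exp (-(z ^ 2 / 2)) * Real.exp (-(z ^ 2 / 2) * ω ^ 2) := by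
    intro ω
    rw [mul_assoc, ← Real.exp_add]; ring_nf
  simp_rw [e]
  rw [integral_const_mul, integral_gaussian_Ioi]
  have h1 : Real.pi / (z ^ 2 / 2) = (2 * Real.pi) / z ^ 2 := by field_simp
  have h2 : √(2 * Real.pi) * √(2 * Real.pi) = 2 * Real.pi := Real.mul_self_sqrt (by positivity)
  have h3 : 0 < √(2 * Real.pi) := by positivity
  rw [h1, Real.sqrt_div (by positivity), Real.sqrt_sq hz.le, npdf]
  field_simp
  linarith [h2]

/-- Craig's formula for the normal distribution function. -/
theorem ncdf_eq {z : ℝ} (hz : 0 ≤ z) :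
    ncdf z = 1 / 2 - Real.pi⁻¹ *
      ∫ ω in Set.Ioi (0 : ℝ), Real.exp (-(z ^ 2 / 2 * (1 + ω ^ 2))) * (1 + ω ^ 2)⁻¹ := by
  have h := craig_fubini (h := fun v => Real.exp (-v)) (k := fun v => Real.exp (-v))
    (fun v _ => by simpa using (hasDerivAt_neg v).exp) (fun v _ => (Real.exp_pos _).le)
    (by fun_prop) (fun v _ => (Real.exp_pos _).le) hz
  have h2 : ∫ t in (0 : ℝ)..z, ∫ ω in Set.Ioi (0 : ℝ), t * Real.exp (-(t ^ 2 / 2 * (1 + ω ^ 2))) =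
      Real.pi * ncdf z := by
    rw [ncdf, ← intervalIntegral.integral_const_mul]
    refine intervalIntegral.integral_congr_ae ?_
    refine ae_of_all _ fun t ht => ?_
    rw [Set.uIoc_of_le hz] at ht
    exact integral_exp_neg_sq_mul ht.1
  rw [h2] at h
  simp only [neg_zero, Real.exp_zero, sub_mul] at h
  rw [integral_sub, integral_Ioi_const_mul_inv, one_mul] at h
  · have hpi : Real.pi⁻¹ * Real.pi = 1 := inv_mul_cancel₀ Real.pi_ne_zero
    linear_combination (-Real.pi⁻¹) * h + (1 / 2 - ncdf z) * hpi
  · exact integrable_inv_one_add_sq.integrableOn.const_mul 1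
  · refine integrableOn_mul_inv_one_add_sq (C := 1) (by fun_prop) fun ω => ?_
    rw [abs_of_pos (Real.exp_pos _), Real.exp_le_one_iff]
    have : 0 ≤ z ^ 2 / 2 * (1 + ω ^ 2) := by positivity
    linarith

/-- The integral `∫₀^∞ (1 + ω²)^{-ρ} dω`. -/
theorem integral_one_add_sq_rpow {ρ : ℝ} (hρ : 1 / 2 < ρ) :
    ∫ ω in Set.Ioi (0 : ℝ), (1 + ω ^ 2) ^ (-ρ) =
      √Real.pi * Real.Gamma (ρ - 1 / 2) / (2 * Real.Gamma ρ) := by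
  have hρ0 : 0 < ρ := by linarith
  have hG := Real.Gamma_pos_of_pos hρ0
  -- Γ(ρ)(1+ω²)^{-ρ} is a Gamma integral in x; integrating over ω first leaves a Gaussian and then
  -- another Gamma integral.
  have hgauss : ∀ x ∈ Set.Ioi (0 : ℝ),
      ∫ ω in Set.Ioi (0 : ℝ), x ^ (ρ - 1) * Real.exp (-((1 + ω ^ 2) * x)) =
        √Real.pi / 2 * (x ^ (ρ - 1 / 2 - 1) * Real.exp (-(1 * x))) := by
    intro x hx
    have hx : (0 : ℝ) < x := hx
    have e : ∀ ω : ℝ, x ^ (ρ - 1) * Real.exp (-((1 + ω ^ 2) * x)) =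
        x ^ (ρ - 1) * Real.exp (-x) * Real.exp (-x * ω ^ 2) := by
      intro ω; rw [mul_assoc, ← Real.exp_add]; ring_nf
    simp_rw [e]
    rw [integral_const_mul, integral_gaussian_Ioi, Real.sqrt_div Real.pi_pos.le,
      show ρ - 1 / 2 - 1 = ρ - 1 - 1 / 2 by ring, Real.rpow_sub hx (ρ - 1), Real.sqrt_eq_rpow x, one_mul]
    ring
  have hswap : ∫ x in Set.Ioi (0 : ℝ), ∫ ω in Set.Ioi (0 : ℝ),
      x ^ (ρ - 1) * Real.exp (-((1 + ω ^ 2) * x)) =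
      ∫ ω in Set.Ioi (0 : ℝ), ∫ x in Set.Ioi (0 : ℝ),
      x ^ (ρ - 1) * Real.exp (-((1 + ω ^ 2) * x)) := by
    refine integral_integral_swap ?_
    rw [integrable_prod_iff]
    · constructor
      · refine (ae_restrict_iff' measurableSet_Ioi).2 (ae_of_all _ fun x hx => ?_)
        refine Integrable.of_integral_ne_zero ?_
        have hx' : (0 : ℝ) < x := hx
        have := hgauss x hx
        simp only [Function.uncurry_apply_pair]
        rw [this]; positivity
      · have hI := (integrableOn_rpow_mul_exp (s := ρ - 1 / 2) (a := 1) (by linarith) one_pos).const_mul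
          (√Real.pi / 2)
        refine hI.congr ((ae_restrict_iff' measurableSet_Ioi).2 (ae_of_all _ fun x hx => ?_))
        refine (hgauss x hx).symm.trans ?_
        refine integral_congr_ae (ae_of_all _ fun ω => ?_)
        have hx' : (0 : ℝ) < x := hx
        simp only [Function.uncurry_apply_pair, Real.norm_eq_abs]
        exact (abs_of_nonneg (by positivity)).symm
    · refine Measurable.aestronglyMeasurable ?_
      unfold Function.uncurry
      fun_prop
  have hL : ∫ x in Set.Ioi (0 : ℝ), ∫ ω in Set.Ioi (0 : ℝ),
      x ^ (ρ - 1) * Real.exp (-((1 + ω ^ 2) * x)) = √Real.pi / 2 * Real.Gamma (ρ - 1 / 2) := by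
    rw [setIntegral_congr_fun measurableSet_Ioi hgauss, integral_const_mul,
      Real.integral_rpow_mul_exp_neg_mul_Ioi (by linarith) one_pos]
    simp
  have hR : ∀ ω : ℝ, ∫ x in Set.Ioi (0 : ℝ), x ^ (ρ - 1) * Real.exp (-((1 + ω ^ 2) * x)) =
      Real.Gamma ρ * (1 + ω ^ 2) ^ (-ρ) := by
    intro ω
    have hp := one_add_sq_pos ω
    rw [Real.integral_rpow_mul_exp_neg_mul_Ioi hρ0 hp, one_div, Real.inv_rpow hp.le,
      Real.rpow_neg hp.le, mul_comm]
  simp_rw [hR] at hswap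
  rw [hL, integral_const_mul] at hswap
  rw [eq_div_iff (by positivity)]
  linear_combination -2 * hswap

theorem integral_add_mul_sq_rpow {a c ρ : ℝ} (ha : 0 < a) (hc : 0 < c) :
    ∫ ω in Set.Ioi (0 : ℝ), (a + c * ω ^ 2) ^ (-ρ) =
      a ^ (1 / 2 - ρ) / √c * ∫ ω in Set.Ioi (0 : ℝ), (1 + ω ^ 2) ^ (-ρ) := by
  have hs : 0 < √(c / a) := by positivity
  have h := integral_comp_mul_left_Ioi (fun x : ℝ => (1 + x ^ 2) ^ (-ρ)) 0 hs
  rw [mul_zero, smul_eq_mul] at h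
  have e : ∀ ω : ℝ, (a + c * ω ^ 2) ^ (-ρ) = a ^ (-ρ) * (1 + (√(c / a) * ω) ^ 2) ^ (-ρ) := by
    intro ω
    rw [← Real.mul_rpow ha.le (by positivity), mul_pow, Real.sq_sqrt (by positivity)]
    congr 1; field_simp
  simp_rw [e]
  rw [integral_const_mul, h, Real.sqrt_div hc.le, show 1 / 2 - ρ = -ρ + 1 / 2 by ring, Real.rpow_add ha,
    ← Real.sqrt_eq_rpow]
  field_simp

theorem integrableOn_add_mul_sq_rpow {a c ρ : ℝ} (ha : 0 < a) (hc : 0 < c) (hρ : 1 / 2 < ρ) :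
    IntegrableOn (fun ω => (a + c * ω ^ 2) ^ (-ρ)) (Set.Ioi (0 : ℝ)) := by
  refine Integrable.of_integral_ne_zero ?_
  rw [integral_add_mul_sq_rpow ha hc, integral_one_add_sq_rpow hρ]
  have h1 := Real.Gamma_pos_of_pos (show 0 < ρ by linarith)
  have h2 := Real.Gamma_pos_of_pos (show 0 < ρ - 1 / 2 by linarith)
  positivity

/-! ### Student's distribution and its kernel representation. -/

theorem continuous_studentDensity {ν : ℝ} (hν : 0 < ν) : Continuous (studentDensity ν) := by
  unfold studentDensity
  refine continuous_const.mul (Continuous.rpow_const (by fun_prop) fun x => Or.inl ?_)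
  positivity

theorem studentDensity_neg (ν x : ℝ) : studentDensity ν (-x) = studentDensity ν x := by
  simp [studentDensity]

theorem studentDensity_pos {ν : ℝ} (hν : 0 < ν) (x : ℝ) : 0 < studentDensity ν x := by
  unfold studentDensity
  have h1 := Real.Gamma_pos_of_pos (show 0 < (ν + 1) / 2 by linarith)
  have h2 := Real.Gamma_pos_of_pos (show 0 < ν / 2 by linarith)
  have := Real.pi_pos
  positivity

theorem studentDensity_two_mul {r : ℝ} (t : ℝ) :
    studentDensity (2 * r) t = Real.Gamma (r + 1 / 2) / (√(2 * r * Real.pi) * Real.Gamma r) *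
      (1 + t ^ 2 / (2 * r)) ^ (-(r + 1 / 2)) := by
  unfold studentDensity
  rw [show (2 * r + 1) / 2 = r + 1 / 2 by ring, show 2 * r / 2 = r by ring,
    show -(2 * r + 1) / 2 = -(r + 1 / 2) by ring]

theorem integral_Ioi_studentDensity {r : ℝ} (hr : 0 < r) :
    ∫ t in Set.Ioi (0 : ℝ), studentDensity (2 * r) t = 1 / 2 := by
  have e : ∀ t : ℝ, studentDensity (2 * r) t =
      Real.Gamma (r + 1 / 2) / (√(2 * r * Real.pi) * Real.Gamma r) *
      (1 + 1 / (2 * r) * t ^ 2) ^ (-(r + 1 / 2)) := by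
    intro t; rw [studentDensity_two_mul]; congr 2; ring
  simp_rw [e]
  rw [integral_const_mul, integral_add_mul_sq_rpow one_pos (by positivity),
    integral_one_add_sq_rpow (by linarith), add_sub_cancel_right]
  have h1 := Real.Gamma_pos_of_pos hr
  have h2 := Real.Gamma_pos_of_pos (show 0 < r + 1 / 2 by linarith)
  have h3 := Real.pi_pos
  rw [Real.sqrt_mul (by positivity), Real.one_rpow, Real.sqrt_div zero_le_one, Real.sqrt_one]
  have h4 : 0 < √(2 * r) := by positivity
  have h5 : 0 < √Real.pi := by positivity
  field_simp

theorem integrable_studentDensity {r : ℝ} (hr : 0 < r) :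
    Integrable (studentDensity (2 * r)) := by
  have h : IntegrableOn (studentDensity (2 * r)) (Set.Ioi 0) :=
    Integrable.of_integral_ne_zero (by rw [integral_Ioi_studentDensity hr]; norm_num)
  rw [← integrableOn_univ, ← Set.Iic_union_Ioi (a := (0 : ℝ))]
  refine IntegrableOn.union ?_ h
  rw [integrableOn_Iic_iff_integrableOn_Iio]
  have h2 := ((Measure.measurePreserving_neg (volume : Measure ℝ)).integrableOn_comp_preimage
    (MeasurableEquiv.neg ℝ).measurableEmbedding).2 h
  have h3 : studentDensity (2 * r) ∘ Neg.neg = studentDensity (2 * r) :=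
    funext fun x => studentDensity_neg _ x
  simpa [h3] using h2

theorem studentCDF_eq {r : ℝ} (hr : 0 < r) (w : ℝ) :
    studentCDF (2 * r) w = 1 / 2 + ∫ t in (0 : ℝ)..w, studentDensity (2 * r) t := by
  have hI := integrable_studentDensity hr
  have h0 : ∫ t in Set.Iic (0 : ℝ), studentDensity (2 * r) t = 1 / 2 := by
    rw [← integral_Ioi_studentDensity hr]
    have := integral_comp_neg_Iic (0 : ℝ) (studentDensity (2 * r))
    simpa [studentDensity_neg] using this
  have := intervalIntegral.integral_Iic_sub_Iic (a := (0 : ℝ)) (b := w) (f := studentDensity (2 * r))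
    (μ := volume) hI.integrableOn hI.integrableOn
  unfold studentCDF
  linarith

theorem hasDerivAt_studentKernel {r : ℝ} (hr : 0 < r) {v : ℝ} (hv : 0 ≤ v) (ρ : ℝ) :
    HasDerivAt (fun v => (1 + v / r) ^ (-ρ)) (-(ρ / r * (1 + v / r) ^ (-(ρ + 1)))) v := by
  have h1 : HasDerivAt (fun v => 1 + v / r) (1 / r) v := by
    simpa using ((hasDerivAt_id v).div_const r).const_add 1
  have h0 : 1 + v / r ≠ 0 := by positivity
  refine (h1.rpow_const (p := -ρ) (Or.inl h0)).congr_deriv ?_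
  rw [show -ρ - 1 = -(ρ + 1) by ring]; ring

theorem kernel_eq {r : ℝ} (hr : 0 < r) (t ω : ℝ) :
    1 + t ^ 2 / 2 * (1 + ω ^ 2) / r = (1 + t ^ 2 / (2 * r)) + t ^ 2 / (2 * r) * ω ^ 2 := by
  field_simp
  ring

/-- The integrals entering the second-order term. -/
theorem integral_mul_kernel {r ρ t : ℝ} (hr : 0 < r) (hρ : 1 / 2 < ρ) (ht : 0 ≤ t) :
    ∫ ω in Set.Ioi (0 : ℝ), t * (1 + t ^ 2 / 2 * (1 + ω ^ 2) / r) ^ (-ρ) =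
      if t = 0 then 0 else √(2 * r) * (1 + t ^ 2 / (2 * r)) ^ (1 / 2 - ρ) *
        (√Real.pi * Real.Gamma (ρ - 1 / 2) / (2 * Real.Gamma ρ)) := by
  -- For t > 0 the substitution in ω cancels the factor t, so the value does not tend to 0 with t; t
  -- = 0 has to be treated apart.
  split_ifs with h
  · simp [h]
  have ht0 : 0 < t := lt_of_le_of_ne ht (Ne.symm h)
  simp_rw [kernel_eq hr]
  rw [integral_const_mul, integral_add_mul_sq_rpow (by positivity) (by positivity),
    integral_one_add_sq_rpow hρ, Real.sqrt_div (by positivity), Real.sqrt_sq ht]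
  have h4 : 0 < √(2 * r) := by positivity
  field_simp

/-- The exponent r + 1 is that of the derivative of (1 + v/r)^{-r}; this is the inner integral of
`craig_fubini` for the Student kernel. -/
theorem integral_mul_kernel_succ {r t : ℝ} (hr : 0 < r) (ht : 0 < t) :
    ∫ ω in Set.Ioi (0 : ℝ), t * (1 + t ^ 2 / 2 * (1 + ω ^ 2) / r) ^ (-(r + 1)) =
      Real.pi * studentDensity (2 * r) t := by
  rw [integral_mul_kernel hr (by linarith) ht.le, if_neg ht.ne', studentDensity_two_mul,
    show 1 / 2 - (r + 1) = -(r + 1 / 2) by ring, show r + 1 - 1 / 2 = r + 1 / 2 by ring,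
    Real.Gamma_add_one hr.ne', Real.sqrt_mul (show 0 ≤ 2 * r by positivity) Real.pi]
  have h1 := Real.Gamma_pos_of_pos hr
  have h3 := Real.pi_pos
  have h4 : 0 < √(2 * r) := by positivity
  have h5 : 0 < √Real.pi := by positivity
  have h6 : √(2 * r) * √(2 * r) = 2 * r := Real.mul_self_sqrt (by positivity)
  have h7 : √Real.pi * √Real.pi = Real.pi := Real.mul_self_sqrt h3.le
  have e1 : √(2 * r) * (√Real.pi * Real.Gamma (r + 1 / 2) / (2 * (r * Real.Gamma r))) =
      Real.pi * (Real.Gamma (r + 1 / 2) / (√(2 * r) * √Real.pi * Real.Gamma r)) := by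
    rw [mul_div_assoc', mul_div_assoc', div_eq_div_iff (by positivity) (by positivity)]
    linear_combination (√(2 * r) * √(2 * r) * Real.Gamma (r + 1 / 2) * Real.Gamma r) * h7 +
      Real.pi * Real.Gamma (r + 1 / 2) * Real.Gamma r * h6
  linear_combination (1 + t ^ 2 / (2 * r)) ^ (-(r + 1 / 2)) * e1

/-- Craig-type formula for Student's distribution. -/
theorem integral_studentDensity_eq {r : ℝ} (hr : 0 < r) {w : ℝ} (hw : 0 ≤ w) :
    ∫ t in (0 : ℝ)..w, studentDensity (2 * r) t = 1 / 2 - Real.pi⁻¹ *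
      ∫ ω in Set.Ioi (0 : ℝ), (1 + w ^ 2 / 2 * (1 + ω ^ 2) / r) ^ (-r) * (1 + ω ^ 2)⁻¹ := by
  have h := craig_fubini (h := fun v => (1 + v / r) ^ (-r))
    (k := fun v => r / r * (1 + v / r) ^ (-(r + 1)))
    (fun v hv => hasDerivAt_studentKernel hr hv r) (fun v hv => by positivity)
    (continuousOn_const.mul (ContinuousOn.rpow_const (by fun_prop) fun v hv => Or.inl (by
      have hv : (0 : ℝ) ≤ v := hv
      positivity)))
    (fun v hv => by positivity) hw
  have h2 : ∫ t in (0 : ℝ)..w, ∫ ω in Set.Ioi (0 : ℝ),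
      t * (r / r * (1 + t ^ 2 / 2 * (1 + ω ^ 2) / r) ^ (-(r + 1))) =
      Real.pi * ∫ t in (0 : ℝ)..w, studentDensity (2 * r) t := by
    rw [← intervalIntegral.integral_const_mul]
    refine intervalIntegral.integral_congr_ae ?_
    refine ae_of_all _ fun t ht => ?_
    rw [Set.uIoc_of_le hw] at ht
    simp_rw [div_self hr.ne', one_mul]
    exact integral_mul_kernel_succ hr ht.1
  rw [h2] at h
  simp only [zero_div, add_zero, Real.one_rpow, sub_mul] at h
  rw [integral_sub, integral_Ioi_const_mul_inv, one_mul] at h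
  · have hpi : Real.pi⁻¹ * Real.pi = 1 := inv_mul_cancel₀ Real.pi_ne_zero
    linear_combination (-Real.pi⁻¹) * h +
      (1 / 2 - ∫ t in (0 : ℝ)..w, studentDensity (2 * r) t) * hpi
  · exact integrable_inv_one_add_sq.integrableOn.const_mul 1
  · refine integrableOn_mul_inv_one_add_sq (C := 1) (by fun_prop) fun ω => ?_
    have h1 : 0 ≤ w ^ 2 / 2 * (1 + ω ^ 2) / r := by positivity
    rw [abs_of_nonneg (by positivity)]
    exact Real.rpow_le_one_of_one_le_of_nonpos (by linarith) (by linarith)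

/-- The second-order term: `∫ v y^{-r}((r-5) - (r-2)/y)/2`, where `y = 1 + v / r`. -/
theorem integral_second_order {r : ℝ} (hr : 1 < r) {w : ℝ} (hw : 0 ≤ w) :
    IntegrableOn (fun ω => w ^ 2 / 2 * ((r - 5) / 2 * (1 + w ^ 2 / 2 * (1 + ω ^ 2) / r) ^ (-r) -
        (r - 2) / 2 * (1 + w ^ 2 / 2 * (1 + ω ^ 2) / r) ^ (-(r + 1)))) (Set.Ioi (0 : ℝ)) ∧
    ∫ ω in Set.Ioi (0 : ℝ), w ^ 2 / 2 * ((r - 5) / 2 * (1 + w ^ 2 / 2 * (1 + ω ^ 2) / r) ^ (-r) -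
        (r - 2) / 2 * (1 + w ^ 2 / 2 * (1 + ω ^ 2) / r) ^ (-(r + 1))) =
      -(Real.pi * studentDensity (2 * r) w *
        (((5 - r) * w ^ 3 + (5 * r + 2) * w) / (4 * (2 * r - 1)))) := by
  have hr0 : 0 < r := by linarith
  rcases hw.eq_or_lt with rfl | hw0
  · simp
  have hI : ∀ ρ : ℝ, 1 / 2 < ρ →
      IntegrableOn (fun ω => w * (1 + w ^ 2 / 2 * (1 + ω ^ 2) / r) ^ (-ρ)) (Set.Ioi (0 : ℝ)) := by
    intro ρ hρ
    simp_rw [kernel_eq hr0]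
    exact (integrableOn_add_mul_sq_rpow (by positivity) (by positivity) hρ).const_mul w
  have e : ∀ ω : ℝ, w ^ 2 / 2 * ((r - 5) / 2 * (1 + w ^ 2 / 2 * (1 + ω ^ 2) / r) ^ (-r) -
        (r - 2) / 2 * (1 + w ^ 2 / 2 * (1 + ω ^ 2) / r) ^ (-(r + 1))) =
      w * (r - 5) / 4 * (w * (1 + w ^ 2 / 2 * (1 + ω ^ 2) / r) ^ (-r)) -
      w * (r - 2) / 4 * (w * (1 + w ^ 2 / 2 * (1 + ω ^ 2) / r) ^ (-(r + 1))) := fun ω => by ring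
  have i1 := (hI r (by linarith)).const_mul (w * (r - 5) / 4)
  have i2 := (hI (r + 1) (by linarith)).const_mul (w * (r - 2) / 4)
  -- The exponents r and r + 1 are related by the Gamma recursion; the shift Γ(r + 1/2) = (r - 1/2)
  -- Γ(r - 1/2) is the source of the denominator 2r - 1 in B₂.
  have hlow : ∫ ω in Set.Ioi (0 : ℝ), w * (1 + w ^ 2 / 2 * (1 + ω ^ 2) / r) ^ (-r) =
      Real.pi * studentDensity (2 * r) w * ((2 * r + w ^ 2) / (2 * r - 1)) := by
    rw [← integral_mul_kernel_succ hr0 hw0, integral_mul_kernel hr0 (by linarith) hw,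
      integral_mul_kernel hr0 (by linarith) hw, if_neg hw0.ne', if_neg hw0.ne',
      show 1 / 2 - r = (1 / 2 - (r + 1)) + 1 by ring, Real.rpow_add_one (by positivity),
      Real.Gamma_add_one hr0.ne', show r + 1 - 1 / 2 = (r - 1 / 2) + 1 by ring,
      Real.Gamma_add_one (by linarith : r - 1 / 2 ≠ 0)]
    have h1 := Real.Gamma_pos_of_pos hr0
    have h2 : 0 < 2 * r - 1 := by linarith
    field_simp
  simp_rw [e]
  refine ⟨i1.sub i2, ?_⟩
  rw [integral_sub i1 i2, integral_const_mul (w * (r - 5) / 4), integral_const_mul (w * (r - 2) / 4), hlow,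
    integral_mul_kernel_succ hr0 hw0]
  have h2 : (2 * r - 1) ≠ 0 := by linarith
  generalize studentDensity (2 * r) w = S
  obtain ⟨d, hd⟩ : ∃ d, d = 2 * r - 1 := ⟨_, rfl⟩
  have hr' : r = (d + 1) / 2 := by linarith
  rw [← hd] at h2 ⊢
  field_simp
  rw [hr']
  ring

/-- The odd part of the second-order normal approximation for the median, after the cubic term has
been absorbed into the argument. -/
noncomputable def medianApprox (z j : ℝ) : ℝ := ncdf z + 3 / 4 * (z * npdf z) / j

/-! ### Mixing the normal approximation over the sample size. -/

theorem abs_exp_mul_le {ε j : ℝ} (hε : 0 ≤ ε) (hj : 1 ≤ j) :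
    |Real.exp (-(ε * j)) * (1 - 3 * ε / 2)| ≤ 3 := by
  have hE := Real.exp_pos (-(ε * j))
  have hε2 : Real.exp (-(ε * j)) * (1 + ε) ≤ 1 := by
    rw [Real.exp_neg, inv_mul_le_iff₀ (Real.exp_pos _)]
    have : ε * 1 ≤ ε * j := by gcongr
    linarith [Real.add_one_le_exp (ε * j)]
  rw [abs_le]; constructor <;> nlinarith

/-- With z = w√(j/g) the ratio z²/j = w²/g is free of j. Hence the term (3/4) zφ(z)/j becomes the
factor 1 - 3ε/2, and j enters only through e^{-εj}, ready for the Laplace transform. -/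
theorem medianApprox_eq {w g j : ℝ} (hw : 0 ≤ w) (hg : 0 < g) (hj : 1 ≤ j) :
    medianApprox (w * √(j / g)) j = 1 / 2 - Real.pi⁻¹ * ∫ ω in Set.Ioi (0 : ℝ),
      Real.exp (-(w ^ 2 / 2 * (1 + ω ^ 2) / g * j)) * (1 - 3 * (w ^ 2 / 2 * (1 + ω ^ 2) / g) / 2) *
        (1 + ω ^ 2)⁻¹ := by
  have hj0 : 0 < j := by linarith
  set z := w * √(j / g) with hz
  have hz0 : 0 ≤ z := by positivity
  have hz2 : z ^ 2 = w ^ 2 * (j / g) := by rw [hz, mul_pow, Real.sq_sqrt (by positivity)]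
  have hε : ∀ ω : ℝ, 0 ≤ w ^ 2 / 2 * (1 + ω ^ 2) / g := fun ω => by positivity
  have hzε : ∀ ω : ℝ, z ^ 2 / 2 * (1 + ω ^ 2) = w ^ 2 / 2 * (1 + ω ^ 2) / g * j := by
    intro ω; rw [hz2]; field_simp
  have h1 := ncdf_eq hz0
  have h2 : z * npdf z = Real.pi⁻¹ *
      ∫ ω in Set.Ioi (0 : ℝ), z * (z * Real.exp (-(z ^ 2 / 2 * (1 + ω ^ 2)))) := by
    rcases hz0.eq_or_lt with h | h
    · simp [← h]
    · rw [integral_const_mul, integral_exp_neg_sq_mul h]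
      field_simp
  have e : ∀ ω : ℝ, Real.exp (-(w ^ 2 / 2 * (1 + ω ^ 2) / g * j)) *
      (1 - 3 * (w ^ 2 / 2 * (1 + ω ^ 2) / g) / 2) * (1 + ω ^ 2)⁻¹ =
      Real.exp (-(z ^ 2 / 2 * (1 + ω ^ 2))) * (1 + ω ^ 2)⁻¹ -
        3 / 4 / j * (z * (z * Real.exp (-(z ^ 2 / 2 * (1 + ω ^ 2))))) := by
    intro ω
    have hp := one_add_sq_pos ω
    rw [← mul_assoc z z, ← pow_two, hzε ω, hz2]
    field_simp
    ring
  have i1 : IntegrableOn (fun ω => Real.exp (-(z ^ 2 / 2 * (1 + ω ^ 2))) * (1 + ω ^ 2)⁻¹)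
      (Set.Ioi (0 : ℝ)) := by
    refine integrableOn_mul_inv_one_add_sq (C := 1) (by fun_prop) fun ω => ?_
    rw [abs_of_pos (Real.exp_pos _), Real.exp_le_one_iff]
    have : 0 ≤ z ^ 2 / 2 * (1 + ω ^ 2) := by positivity
    linarith
  have i2 : IntegrableOn (fun ω => Real.exp (-(w ^ 2 / 2 * (1 + ω ^ 2) / g * j)) *
      (1 - 3 * (w ^ 2 / 2 * (1 + ω ^ 2) / g) / 2) * (1 + ω ^ 2)⁻¹) (Set.Ioi (0 : ℝ)) :=
    integrableOn_mul_inv_one_add_sq (C := 3) (by fun_prop) fun ω => abs_exp_mul_le (hε ω) hj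
  have i3 : IntegrableOn (fun ω => 3 / 4 / j * (z * (z * Real.exp (-(z ^ 2 / 2 * (1 + ω ^ 2))))))
      (Set.Ioi (0 : ℝ)) := by
    refine (i1.sub i2).congr (ae_of_all _ fun ω => ?_)
    simp only [Pi.sub_apply]
    rw [e ω]; ring
  simp_rw [e]
  rw [integral_sub i1 i3, integral_const_mul, medianApprox, h1, h2]
  ring

theorem abs_integral_sub_le {f h : ℝ → ℝ} {C : ℝ}
    (hf : IntegrableOn f (Set.Ioi (0 : ℝ))) (hh : IntegrableOn h (Set.Ioi (0 : ℝ)))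
    (hC : ∀ ω, |f ω - h ω| ≤ C * (1 + ω ^ 2)⁻¹) :
    |Real.pi⁻¹ * (∫ ω in Set.Ioi (0 : ℝ), f ω) - Real.pi⁻¹ * ∫ ω in Set.Ioi (0 : ℝ), h ω| ≤
      C / 2 := by
  rw [← mul_sub, ← integral_sub hf hh, abs_mul, abs_of_pos (inv_pos.2 Real.pi_pos)]
  have h1 : |∫ ω in Set.Ioi (0 : ℝ), (f ω - h ω)| ≤
      ∫ ω in Set.Ioi (0 : ℝ), C * (1 + ω ^ 2)⁻¹ := by
    rw [← Real.norm_eq_abs]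
    exact norm_integral_le_of_norm_le (integrable_inv_one_add_sq.integrableOn.const_mul C)
      (ae_of_all _ hC)
  rw [integral_Ioi_const_mul_inv] at h1
  have hpi := Real.pi_pos
  calc _ ≤ Real.pi⁻¹ * (C * (Real.pi / 2)) := by gcongr
    _ = C / 2 := by field_simp

theorem hasSum_medianApprox {r : ℝ} (hr : 0 < r) {n : ℕ} (hn : 1 ≤ n) {w : ℝ} (hw : 0 ≤ w) :
    IntegrableOn (fun ω : ℝ => Real.exp (-(w ^ 2 / 2 * (1 + ω ^ 2) / g r n)) *
        lapDen n (w ^ 2 / 2 * (1 + ω ^ 2) / g r n) ^ (-r) *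
        (1 - 3 * (w ^ 2 / 2 * (1 + ω ^ 2) / g r n) / 2) * (1 + ω ^ 2)⁻¹) (Set.Ioi (0 : ℝ)) ∧
    HasSum (fun i : ℕ => negBinMass r n (i + 1) * medianApprox (w * √(((i : ℝ) + 1) / g r n)) (i + 1))
      (1 / 2 - Real.pi⁻¹ * ∫ ω in Set.Ioi (0 : ℝ),
        Real.exp (-(w ^ 2 / 2 * (1 + ω ^ 2) / g r n)) *
        lapDen n (w ^ 2 / 2 * (1 + ω ^ 2) / g r n) ^ (-r) *
        (1 - 3 * (w ^ 2 / 2 * (1 + ω ^ 2) / g r n) / 2) * (1 + ω ^ 2)⁻¹) := by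
  have hn1 : (1 : ℝ) ≤ n := by exact_mod_cast hn
  have hg : 0 < g r n := by
    unfold g
    have : 0 ≤ r * ((n : ℝ) - 1) := mul_nonneg hr.le (by linarith)
    linarith
  have hm := fun i => negBinMass_nonneg hr hn i
  have hε : ∀ ω : ℝ, 0 ≤ w ^ 2 / 2 * (1 + ω ^ 2) / g r n := fun ω => by positivity
  have hi1 : ∀ i : ℕ, (1 : ℝ) ≤ (i : ℝ) + 1 := fun i => by
    linarith [(Nat.cast_nonneg i : (0 : ℝ) ≤ i)]
  set F : ℕ → ℝ → ℝ := fun i ω => negBinMass r n (i + 1) *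
    (Real.exp (-(w ^ 2 / 2 * (1 + ω ^ 2) / g r n * ((i : ℝ) + 1))) *
      (1 - 3 * (w ^ 2 / 2 * (1 + ω ^ 2) / g r n) / 2) * (1 + ω ^ 2)⁻¹) with hF
  have hFi : ∀ i, IntegrableOn (F i) (Set.Ioi (0 : ℝ)) := fun i =>
    (integrableOn_mul_inv_one_add_sq (C := 3) (by fun_prop)
      fun ω => abs_exp_mul_le (hε ω) (hi1 i)).const_mul _
  -- A majorant summable in i and integrable in ω, which justifies summing under the integral.
  have hFn : ∀ i ω, ‖F i ω‖ ≤ negBinMass r n (i + 1) * (3 * (1 + ω ^ 2)⁻¹) := by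
    intro i ω
    have hp := one_add_sq_pos ω
    simp only [hF]
    rw [norm_mul, norm_mul, Real.norm_eq_abs, abs_of_nonneg (hm i), Real.norm_eq_abs,
      Real.norm_eq_abs, abs_of_pos (inv_pos.2 hp)]
    have := abs_exp_mul_le (hε ω) (hi1 i)
    have := hm i
    gcongr
  have hsum : Summable fun i => ∫ ω in Set.Ioi (0 : ℝ), ‖F i ω‖ := by
    refine Summable.of_nonneg_of_le (fun i => integral_nonneg fun ω => norm_nonneg _) (fun i => ?_)
      ((hasSum_negBinMass hr hn).summable.mul_right (3 * (Real.pi / 2)))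
    refine (integral_mono_of_nonneg (ae_of_all _ fun ω => norm_nonneg _)
      ((integrable_inv_one_add_sq.integrableOn.const_mul 3).const_mul _)
      (ae_of_all _ (hFn i))).trans_eq ?_
    rw [integral_const_mul, integral_Ioi_const_mul_inv]
  have hS := hasSum_integral_of_summable_integral_norm hFi hsum
  have htot : ∀ ω : ℝ, HasSum (fun i => F i ω) (Real.exp (-(w ^ 2 / 2 * (1 + ω ^ 2) / g r n)) *
        lapDen n (w ^ 2 / 2 * (1 + ω ^ 2) / g r n) ^ (-r) *
        (1 - 3 * (w ^ 2 / 2 * (1 + ω ^ 2) / g r n) / 2) * (1 + ω ^ 2)⁻¹) := by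
    intro ω
    have := (hasSum_negBinMass_mul_exp hr hn (hε ω)).mul_right
      ((1 - 3 * (w ^ 2 / 2 * (1 + ω ^ 2) / g r n) / 2) * (1 + ω ^ 2)⁻¹)
    rw [← mul_assoc] at this
    refine this.congr_fun fun i => ?_
    simp only [hF]; ring
  have htot' : ∀ ω : ℝ, ∑' i, F i ω = _ := fun ω => (htot ω).tsum_eq
  simp_rw [htot'] at hS
  refine ⟨?_, ?_⟩
  · refine integrableOn_mul_inv_one_add_sq (C := 3) ?_ fun ω => ?_
    · unfold lapDen; fun_prop
    · have h1 := abs_exp_mul_le (hε ω) le_rfl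
      rw [mul_one] at h1
      have h2 := one_le_lapDen hn (hε ω)
      have h3 : lapDen n (w ^ 2 / 2 * (1 + ω ^ 2) / g r n) ^ (-r) ≤ 1 :=
        Real.rpow_le_one_of_one_le_of_nonpos h2 (by linarith)
      have h4 : 0 ≤ lapDen n (w ^ 2 / 2 * (1 + ω ^ 2) / g r n) ^ (-r) := by positivity
      rw [mul_right_comm, abs_mul, abs_of_nonneg h4]
      exact (mul_le_mul h1 h3 h4 (by norm_num)).trans_eq (by norm_num)
  · have h1 := (hasSum_negBinMass hr hn).mul_right (1 / 2 : ℝ)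
    have h2 := h1.sub (hS.mul_left Real.pi⁻¹)
    rw [one_mul] at h2
    refine h2.congr_fun fun i => ?_
    simp only [hF]
    rw [medianApprox_eq hw hg (hi1 i), integral_const_mul]
    ring

/-- The cubic polynomial in the second-order term of the mixture. -/
noncomputable def mixPoly (r w : ℝ) : ℝ := ((5 - r) * w ^ 3 + (5 * r + 2) * w) / (4 * (2 * r - 1))

theorem integrableOn_studentKernel {r : ℝ} (hr : 0 < r) (w : ℝ) :
    IntegrableOn (fun ω : ℝ => (1 + w ^ 2 / 2 * (1 + ω ^ 2) / r) ^ (-r) * (1 + ω ^ 2)⁻¹)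
      (Set.Ioi (0 : ℝ)) := by
  refine integrableOn_mul_inv_one_add_sq (C := 1) (by fun_prop) fun ω => ?_
  have h1 : 0 ≤ w ^ 2 / 2 * (1 + ω ^ 2) / r := by positivity
  rw [abs_of_nonneg (by positivity)]
  exact Real.rpow_le_one_of_one_le_of_nonpos (by linarith) (by linarith)

theorem tsum_medianApprox_of_le_one {r : ℝ} (hr : 0 < r) (hr1 : r ≤ 1) :
    ∃ C, 0 ≤ C ∧ ∀ n : ℕ, 1 ≤ n → 2 ≤ g r n → ∀ w, 0 ≤ w →
      |∑' i : ℕ, negBinMass r n (i + 1) * medianApprox (w * √(((i : ℝ) + 1) / g r n)) (i + 1) -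
        ∫ t in (0 : ℝ)..w, studentDensity (2 * r) t| ≤ C * g r n ^ (-r) := by
  obtain ⟨C, hC, h⟩ := lap_expansion_of_le_one hr hr1
  refine ⟨C / 2, by positivity, fun n hn hg w hw => ?_⟩
  have hg0 : 0 < g r n := by linarith
  obtain ⟨hI, hS⟩ := hasSum_medianApprox hr hn hw
  rw [hS.tsum_eq, integral_studentDensity_eq hr hw, sub_sub_sub_cancel_left, abs_sub_comm]
  refine (abs_integral_sub_le (C := C * g r n ^ (-r)) hI (integrableOn_studentKernel hr w)
    fun ω => ?_).trans_eq (by ring)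
  have hp := one_add_sq_pos ω
  have hε : 0 ≤ w ^ 2 / 2 * (1 + ω ^ 2) / g r n := by positivity
  rw [← sub_mul, abs_mul, abs_of_pos (inv_pos.2 hp)]
  have := h _ _ hg hε
  rw [← lapDen_eq hr, mul_div_cancel₀ _ hg0.ne'] at this
  gcongr

theorem tsum_medianApprox_of_one_lt {r : ℝ} (hr : 1 < r) :
    ∃ C, 0 ≤ C ∧ ∀ n : ℕ, 1 ≤ n → 2 ≤ g r n → ∀ w, 0 ≤ w →
      |∑' i : ℕ, negBinMass r n (i + 1) * medianApprox (w * √(((i : ℝ) + 1) / g r n)) (i + 1) -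
        ((∫ t in (0 : ℝ)..w, studentDensity (2 * r) t) +
          studentDensity (2 * r) w * mixPoly r w / g r n)| ≤ C * g r n ^ (-min r (3 / 2)) := by
  have hr0 : 0 < r := by linarith
  obtain ⟨C, hC, h⟩ := lap_expansion_of_one_lt hr
  refine ⟨C / 2, by positivity, fun n hn hg w hw => ?_⟩
  have hg0 : 0 < g r n := by linarith
  obtain ⟨hI, hS⟩ := hasSum_medianApprox hr0 hn hw
  obtain ⟨hJ, hJv⟩ := integral_second_order hr hw
  have hK := integrableOn_studentKernel hr0 w
  have e : (∫ t in (0 : ℝ)..w, studentDensity (2 * r) t) +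
      studentDensity (2 * r) w * mixPoly r w / g r n = 1 / 2 - Real.pi⁻¹ *
      ∫ ω in Set.Ioi (0 : ℝ), ((1 + w ^ 2 / 2 * (1 + ω ^ 2) / r) ^ (-r) * (1 + ω ^ 2)⁻¹ +
        1 / g r n * (w ^ 2 / 2 * ((r - 5) / 2 * (1 + w ^ 2 / 2 * (1 + ω ^ 2) / r) ^ (-r) -
        (r - 2) / 2 * (1 + w ^ 2 / 2 * (1 + ω ^ 2) / r) ^ (-(r + 1))))) := by
    rw [integral_add hK (hJ.const_mul _), integral_const_mul, hJv, integral_studentDensity_eq hr0 hw,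
      mixPoly]
    have := Real.pi_ne_zero
    field_simp
    ring
  rw [hS.tsum_eq, e, sub_sub_sub_cancel_left, abs_sub_comm]
  refine (abs_integral_sub_le (C := C * g r n ^ (-min r (3 / 2))) hI (hK.add (hJ.const_mul _))
    fun ω => ?_).trans_eq (by ring)
  have hp := one_add_sq_pos ω
  have hε : 0 ≤ w ^ 2 / 2 * (1 + ω ^ 2) / g r n := by positivity
  have hv : 0 ≤ w ^ 2 / 2 * (1 + ω ^ 2) := by positivity
  have hh := h _ _ hg hε
  rw [← lapDen_eq hr0, mul_div_cancel₀ _ hg0.ne'] at hh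
  have hy : 0 < 1 + w ^ 2 / 2 * (1 + ω ^ 2) / r := by positivity
  -- With v = w²(1+ω²)/2 = r(y - 1), the second-order bracket becomes (v/g)((r-5)/2 - (r-2)/(2y)),
  -- and division by 1 + ω² leaves w²/2 in place of v.
  have key : (1 + w ^ 2 / 2 * (1 + ω ^ 2) / r) ^ (-r) * (1 + ω ^ 2)⁻¹ +
        1 / g r n * (w ^ 2 / 2 * ((r - 5) / 2 * (1 + w ^ 2 / 2 * (1 + ω ^ 2) / r) ^ (-r) -
        (r - 2) / 2 * (1 + w ^ 2 / 2 * (1 + ω ^ 2) / r) ^ (-(r + 1)))) =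
      (1 + w ^ 2 / 2 * (1 + ω ^ 2) / r) ^ (-r) *
        (1 + ((r - 2) * g r n * (w ^ 2 / 2 * (1 + ω ^ 2) / g r n) ^ 2 /
          (2 * r * (1 + w ^ 2 / 2 * (1 + ω ^ 2) / r)) -
          3 * (w ^ 2 / 2 * (1 + ω ^ 2) / g r n) / 2)) * (1 + ω ^ 2)⁻¹ := by
    have hv' : w ^ 2 / 2 * (1 + ω ^ 2) = r * ((1 + w ^ 2 / 2 * (1 + ω ^ 2) / r) - 1) := by
      field_simp; ring
    have hw' : w ^ 2 / 2 = w ^ 2 / 2 * (1 + ω ^ 2) * (1 + ω ^ 2)⁻¹ := by field_simp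
    rw [show -(r + 1) = -r - 1 by ring, Real.rpow_sub hy, Real.rpow_one]
    generalize 1 + w ^ 2 / 2 * (1 + ω ^ 2) / r = y at *
    rw [show w ^ 2 / 2 * ((r - 5) / 2 * y ^ (-r) - (r - 2) / 2 * (y ^ (-r) / y)) =
      (w ^ 2 / 2 * (1 + ω ^ 2)) * (1 + ω ^ 2)⁻¹ *
        ((r - 5) / 2 * y ^ (-r) - (r - 2) / 2 * (y ^ (-r) / y)) by rw [← hw']]
    rw [hv']
    generalize y ^ (-r) = Y
    field_simp
    ring
  simp only [Pi.add_apply]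
  rw [key, ← sub_mul, abs_mul, abs_of_pos (inv_pos.2 hp)]
  gcongr

/-! ### The symmetric beta distribution -/

theorem exp_neg_sub_bounds {u : ℝ} (hu : 0 ≤ u) : |Real.exp (-u) - 1 + u| ≤ u ^ 2 := by
  have h1 : Real.exp (-u) ≤ 1 / (1 + u) := by
    rw [Real.exp_neg, one_div]
    exact inv_anti₀ (by linarith) (by linarith [Real.add_one_le_exp u])
  have h2 : 1 / (1 + u) ≤ 1 - u + u ^ 2 := by
    rw [div_le_iff₀ (by linarith)]; nlinarith [pow_nonneg hu 3]
  have h3 := Real.one_sub_le_exp_neg u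
  rw [abs_le]; constructor <;> nlinarith

/-- For x ≤ 1/2 this is log(1 - x) = -x - x²/2 + O(x³) followed by a linearised exponential. For x >
1/2 each term is bounded separately, since then kx³ ≥ 1/8; the constant 17 leaves room for this. -/
theorem one_sub_pow_sub_le {k : ℕ} (hk : 1 ≤ k) {x : ℝ} (hx : 0 ≤ x) (hx1 : x ≤ 1) :
    |(1 - x) ^ k - Real.exp (-(k * x)) * (1 - k * x ^ 2 / 2)| ≤
      Real.exp (-(k * x)) * (17 * (k * x ^ 3) + 9 / 4 * (k * x ^ 2) ^ 2) := by
  have hk1 : (1 : ℝ) ≤ k := by exact_mod_cast hk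
  have hE := Real.exp_pos (-(k * x))
  rcases le_or_gt x (1 / 2) with h | h
  · have hl := Real.abs_log_sub_add_sum_range_le (x := x) (by rw [abs_of_nonneg hx]; linarith) 2
    simp only [Finset.sum_range_succ, Finset.range_zero, Finset.sum_empty, abs_of_nonneg hx] at hl
    norm_num at hl
    have h3 : x ^ 3 / (1 - x) ≤ 2 * x ^ 3 := by
      rw [div_le_iff₀ (by linarith)]
      nlinarith [pow_nonneg hx 3]
    have hlog : Real.log (1 - x) ≤ -x := by
      have := Real.log_le_sub_one_of_pos (show 0 < 1 - x by linarith)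
      linarith
    obtain ⟨l1, l2⟩ := abs_le.1 (hl.trans h3)
    set u := -(k * Real.log (1 - x)) - k * x with hu
    have hpow : (1 - x) ^ k = Real.exp (-(k * x)) * Real.exp (-u) := by
      rw [← Real.exp_add, hu, ← Real.exp_log (show 0 < 1 - x by linarith), ← Real.exp_nat_mul,
        Real.log_exp]
      ring_nf
    have hu0 : 0 ≤ u := by rw [hu]; nlinarith
    have hu1 : |u - k * x ^ 2 / 2| ≤ 2 * (k * x ^ 3) := by
      have e : u - k * x ^ 2 / 2 = -(k * (x + x ^ 2 / 2 + Real.log (1 - x))) := by rw [hu]; ring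
      rw [e, abs_neg, abs_mul, abs_of_pos (by linarith : (0 : ℝ) < k)]
      calc _ ≤ (k : ℝ) * (2 * x ^ 3) := by gcongr; exact hl.trans h3
        _ = _ := by ring
    have hu2 : u ≤ 3 / 2 * (k * x ^ 2) := by
      have h5 : k * x ^ 2 * x ≤ k * x ^ 2 * (1 / 2) := by gcongr
      have := (abs_le.1 hu1).2
      nlinarith
    have hu3 : u ^ 2 ≤ (3 / 2 * (k * x ^ 2)) ^ 2 := by gcongr
    have h6 := exp_neg_sub_bounds hu0
    rw [hpow, ← mul_sub, abs_mul, abs_of_pos hE]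
    refine mul_le_mul_of_nonneg_left ?_ hE.le
    have e : Real.exp (-u) - (1 - k * x ^ 2 / 2) = (Real.exp (-u) - 1 + u) - (u - k * x ^ 2 / 2) := by
      ring
    rw [e]
    refine (abs_sub _ _).trans ?_
    have : 0 ≤ k * x ^ 3 := by positivity
    nlinarith
  · have hp : (1 - x) ^ k ≤ Real.exp (-(k * x)) := by
      have : 1 - x ≤ Real.exp (-x) := Real.one_sub_le_exp_neg x
      calc (1 - x) ^ k ≤ Real.exp (-x) ^ k := pow_le_pow_left₀ (by linarith) this k
        _ = _ := by rw [← Real.exp_nat_mul]; ring_nf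
    have hp0 : 0 ≤ (1 - x) ^ k := pow_nonneg (by linarith) k
    have h3 : 1 / 8 ≤ k * x ^ 3 := by
      have : (1 / 2 : ℝ) ^ 3 ≤ x ^ 3 := by gcongr
      nlinarith
    have h4 : k * x ^ 2 / 2 ≤ k * x ^ 3 := by
      have : k * x ^ 2 * (1 / 2) ≤ k * x ^ 2 * x := by gcongr
      nlinarith
    have h5 : 0 ≤ k * x ^ 2 / 2 := by positivity
    have h6 : 0 ≤ 9 / 4 * (k * x ^ 2) ^ 2 := by positivity
    have h7 : Real.exp (-(k * x)) * (k * x ^ 2 / 2) ≤ Real.exp (-(k * x)) * (k * x ^ 3) := by gcongr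
    have h8 : Real.exp (-(k * x)) * (1 / 8) ≤ Real.exp (-(k * x)) * (k * x ^ 3) := by gcongr
    have h9 : 0 ≤ Real.exp (-(k * x)) * (9 / 4 * (k * x ^ 2) ^ 2) := by positivity
    have h10 : 0 ≤ Real.exp (-(k * x)) * (k * x ^ 2 / 2) := by positivity
    rw [abs_le]
    constructor <;> linarith

/-- The odd part of the distribution function of the symmetric beta distribution with
parameters `k + 1`, `k + 1`, centred at `1 / 2`. -/
noncomputable def betaOdd (k : ℕ) (δ : ℝ) : ℝ :=
  (∫ s in (0 : ℝ)..δ, (1 - 4 * s ^ 2) ^ k) / (2 * ∫ s in (0 : ℝ)..(1 / 2), (1 - 4 * s ^ 2) ^ k)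

theorem ncdf_hasDerivAt (z : ℝ) : HasDerivAt ncdf (npdf z) z :=
  (continuous_npdf.integral_hasStrictDerivAt 0 z).hasDerivAt

theorem npdf_hasDerivAt (z : ℝ) : HasDerivAt npdf (-z * npdf z) z := by
  have h1 : HasDerivAt (fun t : ℝ => -(t ^ 2 / 2)) (-z) z := by
    refine ((hasDerivAt_pow 2 z).div_const 2).neg.congr_deriv ?_
    simp
  refine (h1.exp.const_mul (√(2 * Real.pi))⁻¹).congr_deriv ?_
  unfold npdf; ring

theorem npdf_pos (z : ℝ) : 0 < npdf z := by
  have := Real.pi_pos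
  unfold npdf; positivity

/-- Two integrations by parts of τ⁴φ(τ). The polynomial T³ + 3T of the Edgeworth term comes from
here. -/
theorem integral_npdf_quartic (T c : ℝ) :
    ∫ τ in (0 : ℝ)..T, npdf τ * (1 - c * τ ^ 4) =
      (1 - 3 * c) * ncdf T + c * ((T ^ 3 + 3 * T) * npdf T) := by
  rw [intervalIntegral.integral_eq_sub_of_hasDerivAt
    (f := fun T => (1 - 3 * c) * ncdf T + c * ((T ^ 3 + 3 * T) * npdf T))]
  · simp [ncdf]
  · intro x _
    have h1 : HasDerivAt (fun T : ℝ => T ^ 3 + 3 * T) (3 * x ^ 2 + 3) x := by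
      refine ((hasDerivAt_pow 3 x).add ((hasDerivAt_id x).const_mul 3)).congr_deriv ?_
      simp
    refine (((ncdf_hasDerivAt x).const_mul _).add
      ((h1.mul (npdf_hasDerivAt x)).const_mul c)).congr_deriv ?_
    ring
  · exact (continuous_npdf.mul (by fun_prop)).intervalIntegrable _ _

theorem half_sub_ncdf_le {z : ℝ} (hz : 0 ≤ z) :
    |ncdf z - 1 / 2| ≤ Real.exp (-(z ^ 2 / 2)) / 2 := by
  rw [ncdf_eq hz, sub_right_comm, sub_self, zero_sub, abs_neg]
  have hpi := Real.pi_pos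
  have hp : ∀ ω : ℝ, 0 ≤ Real.exp (-(z ^ 2 / 2 * (1 + ω ^ 2))) * (1 + ω ^ 2)⁻¹ := fun ω => by
    positivity
  rw [abs_of_nonneg (mul_nonneg (by positivity) (integral_nonneg hp))]
  have h : ∫ ω in Set.Ioi (0 : ℝ), Real.exp (-(z ^ 2 / 2 * (1 + ω ^ 2))) * (1 + ω ^ 2)⁻¹ ≤
      ∫ ω in Set.Ioi (0 : ℝ), Real.exp (-(z ^ 2 / 2)) * (1 + ω ^ 2)⁻¹ := by
    refine integral_mono_of_nonneg (ae_of_all _ hp)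
      (integrable_inv_one_add_sq.integrableOn.const_mul _) (ae_of_all _ fun ω => ?_)
    have : 0 ≤ z ^ 2 / 2 * ω ^ 2 := by positivity
    dsimp only
    gcongr
    linarith
  rw [integral_Ioi_const_mul_inv] at h
  calc _ ≤ Real.pi⁻¹ * (Real.exp (-(z ^ 2 / 2)) * (Real.pi / 2)) := by gcongr
    _ = _ := by field_simp

theorem abs_ncdf_le {z : ℝ} (hz : 0 ≤ z) : |ncdf z| ≤ 1 := by
  have h := half_sub_ncdf_le hz
  have h2 : Real.exp (-(z ^ 2 / 2)) ≤ 1 := Real.exp_le_one_iff.2 (by nlinarith [sq_nonneg z])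
  obtain ⟨a, b⟩ := abs_le.1 h
  rw [abs_le]; constructor <;> linarith

theorem npdf_le (z : ℝ) : npdf z ≤ Real.exp (-(z ^ 2 / 2)) := by
  have h : 1 ≤ √(2 * Real.pi) := by
    rw [Real.one_le_sqrt]; linarith [Real.pi_gt_three]
  unfold npdf
  have : (√(2 * Real.pi))⁻¹ ≤ 1 := inv_le_one_of_one_le₀ h
  nlinarith [Real.exp_pos (-(z ^ 2 / 2))]

theorem pow_mul_npdf_le (z : ℝ) (m : ℕ) :
    z ^ (2 * m) * npdf z ≤ 2 ^ m * m.factorial := by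
  have h := npdf_le z
  have h0 := (npdf_pos z).le
  have h1 := Real.pow_div_factorial_le_exp (z ^ 2 / 2) (by positivity) m
  have hf : (0 : ℝ) < m.factorial := by positivity
  rw [div_le_iff₀ hf, div_pow, div_le_iff₀ (by positivity), ← pow_mul] at h1
  calc z ^ (2 * m) * npdf z ≤ (Real.exp (z ^ 2 / 2) * m.factorial * 2 ^ m) *
        Real.exp (-(z ^ 2 / 2)) := by gcongr
    _ = (Real.exp (z ^ 2 / 2) * Real.exp (-(z ^ 2 / 2))) * (2 ^ m * m.factorial) := by ring
    _ = _ := by rw [← Real.exp_add]; simp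

theorem cubic_mul_npdf_le (z : ℝ) : (z ^ 3 + 3 * z) * npdf z ≤ 20 := by
  have h0 := pow_mul_npdf_le z 0
  have h1 := pow_mul_npdf_le z 1
  have h2 := pow_mul_npdf_le z 2
  norm_num [Nat.factorial] at h0 h1 h2
  have h3 : z ^ 3 + 3 * z ≤ z ^ 4 + 3 * z ^ 2 + 4 := by
    nlinarith [sq_nonneg (z * (z - 1 / 2)), sq_nonneg (z - 1), sq_nonneg z]
  have : (z ^ 3 + 3 * z) * npdf z ≤ (z ^ 4 + 3 * z ^ 2 + 4) * npdf z :=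
    mul_le_mul_of_nonneg_right h3 (npdf_pos z).le
  nlinarith

theorem integral_one_sub_sq_pow {k : ℕ} (hk : 1 ≤ k) {T : ℝ} (hT : 0 ≤ T) (hT1 : T ^ 2 ≤ 2 * k) :
    |(√(2 * Real.pi))⁻¹ * (∫ τ in (0 : ℝ)..T, (1 - τ ^ 2 / (2 * k)) ^ k) -
      ((1 - 3 / (8 * k)) * ncdf T + (T ^ 3 + 3 * T) * npdf T / (8 * k))| ≤ 3024 / (k : ℝ) ^ 2 := by
  have hk1 : (1 : ℝ) ≤ k := by exact_mod_cast hk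
  have hk0 : (0 : ℝ) < k := by linarith
  have h1 := integral_npdf_quartic T (1 / (8 * k))
  have e : (1 - 3 / (8 * k)) * ncdf T + (T ^ 3 + 3 * T) * npdf T / (8 * k) =
      ∫ τ in (0 : ℝ)..T, npdf τ * (1 - 1 / (8 * k) * τ ^ 4) := by rw [h1]; ring
  have i1 : IntervalIntegrable (fun τ : ℝ => (√(2 * Real.pi))⁻¹ * (1 - τ ^ 2 / (2 * k)) ^ k)
      volume 0 T := Continuous.intervalIntegrable (by fun_prop) _ _
  have i2 : IntervalIntegrable (fun τ : ℝ => npdf τ * (1 - 1 / (8 * k) * τ ^ 4)) volume 0 T :=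
    (continuous_npdf.mul (by fun_prop)).intervalIntegrable _ _
  rw [e, ← intervalIntegral.integral_const_mul, ← intervalIntegral.integral_sub i1 i2,
    ← Real.norm_eq_abs]
  have h2 : ∀ τ ∈ Set.Ioc (0 : ℝ) T, ‖(√(2 * Real.pi))⁻¹ * (1 - τ ^ 2 / (2 * k)) ^ k -
      npdf τ * (1 - 1 / (8 * k) * τ ^ 4)‖ ≤ 1512 / k ^ 2 * (1 + τ ^ 2)⁻¹ := by
    intro τ hτ
    have hx0 : 0 ≤ τ ^ 2 / (2 * k) := by positivity
    have hx1 : τ ^ 2 / (2 * k) ≤ 1 := by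
      rw [div_le_one (by positivity)]
      exact le_trans (pow_le_pow_left₀ hτ.1.le hτ.2 2) hT1
    have h3 := one_sub_pow_sub_le hk hx0 hx1
    have e1 : (k : ℝ) * (τ ^ 2 / (2 * k)) = τ ^ 2 / 2 := by field_simp
    have e2 : (k : ℝ) * (τ ^ 2 / (2 * k)) ^ 2 / 2 = 1 / (8 * k) * τ ^ 4 := by
      field_simp; ring
    have e3 : 17 * ((k : ℝ) * (τ ^ 2 / (2 * k)) ^ 3) + 9 / 4 * (k * (τ ^ 2 / (2 * k)) ^ 2) ^ 2 =
        (17 / 8 * τ ^ 6 + 9 / 64 * τ ^ 8) / k ^ 2 := by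
      field_simp; ring
    rw [e1, e2, e3] at h3
    have h6 := pow_mul_npdf_le τ 3
    have h8 := pow_mul_npdf_le τ 4
    have h10 := pow_mul_npdf_le τ 5
    norm_num [Nat.factorial] at h6 h8 h10
    have hp := one_add_sq_pos τ
    have hpi : 0 < (√(2 * Real.pi))⁻¹ := by have := Real.pi_pos; positivity
    rw [Real.norm_eq_abs, npdf, mul_assoc, ← mul_sub, abs_mul, abs_of_pos hpi]
    calc _ ≤ (√(2 * Real.pi))⁻¹ * (Real.exp (-(τ ^ 2 / 2)) *
          ((17 / 8 * τ ^ 6 + 9 / 64 * τ ^ 8) / k ^ 2)) := by gcongr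
      _ = (17 / 8 * (τ ^ 6 * npdf τ) + 9 / 64 * (τ ^ 8 * npdf τ)) / k ^ 2 := by
          unfold npdf; ring
      -- 1512 = (17/8)(48 + 384) + (9/64)(384 + 3840), from the bounds on τ⁶φ, τ⁸φ and τ¹⁰φ. The
      -- spare factor 1/(1+τ²) makes the integral bounded uniformly in T.
      _ ≤ 1512 / k ^ 2 * (1 + τ ^ 2)⁻¹ := by
          rw [← div_eq_mul_inv, div_right_comm]
          gcongr
          rw [le_div_iff₀ hp]
          nlinarith
  have h4 : IntervalIntegrable (fun τ : ℝ => 1512 / (k : ℝ) ^ 2 * (1 + τ ^ 2)⁻¹) volume 0 T := by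
    refine Continuous.intervalIntegrable ?_ _ _
    exact continuous_const.mul (Continuous.inv₀ (by fun_prop) fun τ => (one_add_sq_pos τ).ne')
  refine (intervalIntegral.norm_integral_le_of_norm_le hT (ae_of_all _ h2) h4).trans ?_
  rw [intervalIntegral.integral_const_mul, integral_inv_one_add_sq, Real.arctan_zero, sub_zero]
  have h5 : Real.arctan T ≤ 2 := by linarith [Real.arctan_lt_pi_div_two T, Real.pi_lt_four]
  calc 1512 / (k : ℝ) ^ 2 * Real.arctan T ≤ 1512 / (k : ℝ) ^ 2 * 2 := by gcongr
    _ = _ := by ring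

theorem integral_one_sub_four_sq {k : ℕ} (hk : 1 ≤ k) (δ : ℝ) :
    ∫ s in (0 : ℝ)..δ, (1 - 4 * s ^ 2) ^ k =
      (2 * √(2 * k))⁻¹ * ∫ τ in (0 : ℝ)..2 * √(2 * k) * δ, (1 - τ ^ 2 / (2 * k)) ^ k := by
  have hk0 : (0 : ℝ) < k := by exact_mod_cast hk
  have hc : 2 * √(2 * (k : ℝ)) ≠ 0 := by positivity
  have h := intervalIntegral.integral_comp_mul_left (a := 0) (b := δ)
    (fun τ : ℝ => (1 - τ ^ 2 / (2 * k)) ^ k) hc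
  rw [mul_zero, smul_eq_mul] at h
  rw [← h]
  refine intervalIntegral.integral_congr fun s _ => ?_
  have : (2 * √(2 * (k : ℝ)) * s) ^ 2 / (2 * k) = 4 * s ^ 2 := by
    rw [mul_pow, mul_pow, Real.sq_sqrt (by positivity)]
    field_simp; ring
  simp only [this]

theorem integral_one_sub_sq_pow_lower {k : ℕ} (hk : 1 ≤ k) :
    1 / 2 ≤ ∫ τ in (0 : ℝ)..√(2 * k), (1 - τ ^ 2 / (2 * k)) ^ k := by
  have hk1 : (1 : ℝ) ≤ k := by exact_mod_cast hk
  have h1 : 1 ≤ √(2 * (k : ℝ)) := by rw [Real.one_le_sqrt]; linarith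
  have hint : ∀ a b : ℝ, IntervalIntegrable (fun τ : ℝ => (1 - τ ^ 2 / (2 * k)) ^ k) volume a b :=
    fun a b => Continuous.intervalIntegrable (by fun_prop) _ _
  rw [← intervalIntegral.integral_add_adjacent_intervals (hint 0 1) (hint 1 _)]
  have h2 : 0 ≤ ∫ τ in (1 : ℝ)..√(2 * k), (1 - τ ^ 2 / (2 * k)) ^ k := by
    refine intervalIntegral.integral_nonneg h1 fun τ hτ => pow_nonneg ?_ k
    rw [sub_nonneg, div_le_one (by positivity)]
    have := pow_le_pow_left₀ (by linarith [hτ.1]) hτ.2 2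
    rwa [Real.sq_sqrt (by positivity)] at this
  have h3 : ∫ _ in (0 : ℝ)..1, (1 / 2 : ℝ) ≤ ∫ τ in (0 : ℝ)..1, (1 - τ ^ 2 / (2 * k)) ^ k := by
    refine intervalIntegral.integral_mono_on zero_le_one (by simp) (hint 0 1) fun τ hτ => ?_
    have hτ2 : τ ^ 2 ≤ 1 := by nlinarith [hτ.1, hτ.2]
    have hx : τ ^ 2 / (2 * k) ≤ 1 := by
      rw [div_le_one (by positivity)]; linarith
    have hb := one_add_mul_le_pow (a := -(τ ^ 2 / (2 * (k : ℝ)))) (by linarith) k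
    have e : (k : ℝ) * -(τ ^ 2 / (2 * k)) = -(τ ^ 2 / 2) := by field_simp
    rw [e, ← sub_eq_add_neg, ← sub_eq_add_neg] at hb
    linarith
  simp at h3
  linarith

/-- Numerator and normalising integral both carry the factor 1 - 3/(8k), the latter because its end
point √(2k) lies so far out that `ncdf` is 1/2 and the cubic term vanishes there up to O(k⁻²). The
factor cancels in the quotient. The constants are not optimised. -/
theorem betaOdd_expansion : ∃ C, 0 ≤ C ∧ ∀ k : ℕ, 1 ≤ k → ∀ δ : ℝ, 0 ≤ δ → δ ≤ 1 / 2 →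
    |betaOdd k δ - (ncdf (2 * √(2 * k) * δ) + ((2 * √(2 * k) * δ) ^ 3 + 3 * (2 * √(2 * k) * δ)) *
      npdf (2 * √(2 * k) * δ) / (8 * k))| ≤ C / (k : ℝ) ^ 2 := by
  refine ⟨100000, by positivity, fun k hk δ hδ hδ1 => ?_⟩
  have hk1 : (1 : ℝ) ≤ k := by exact_mod_cast hk
  have hk0 : (0 : ℝ) < k := by linarith
  set U := √(2 * (k : ℝ)) with hU
  have hU2 : U ^ 2 = 2 * k := Real.sq_sqrt (by positivity)
  have hU1 : 1 ≤ U := by rw [hU, Real.one_le_sqrt]; linarith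
  set t := 2 * U * δ with ht
  have ht0 : 0 ≤ t := by positivity
  have htU : t ≤ U := by rw [ht]; nlinarith
  have h1 := integral_one_sub_sq_pow hk ht0 (by rw [← hU2]; gcongr)
  have h2 := integral_one_sub_sq_pow hk (by linarith : 0 ≤ U) hU2.le
  have hlow := integral_one_sub_sq_pow_lower hk
  rw [← hU] at hlow
  have hbeta : betaOdd k δ = ((√(2 * Real.pi))⁻¹ * (∫ τ in (0 : ℝ)..t, (1 - τ ^ 2 / (2 * k)) ^ k)) /
      (2 * ((√(2 * Real.pi))⁻¹ * (∫ τ in (0 : ℝ)..U, (1 - τ ^ 2 / (2 * k)) ^ k))) := by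
    have e : 2 * U * (1 / 2) = U := by ring
    have hpi := Real.pi_pos
    have hs : 0 < √(2 * Real.pi) := by positivity
    rw [betaOdd, integral_one_sub_four_sq hk, integral_one_sub_four_sq hk, ← hU, ← ht, e]
    have : 0 < U := by linarith
    field_simp
  rw [hbeta]
  have hpi3 : 1 / 3 ≤ (√(2 * Real.pi))⁻¹ := by
    rw [one_div]
    refine inv_anti₀ (by have := Real.pi_pos; positivity) ?_
    rw [Real.sqrt_le_left (by norm_num)]
    linarith [Real.pi_lt_four]
  set A := (√(2 * Real.pi))⁻¹ * (∫ τ in (0 : ℝ)..t, (1 - τ ^ 2 / (2 * k)) ^ k)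
  have hB : 1 / 3 ≤ 2 * ((√(2 * Real.pi))⁻¹ * (∫ τ in (0 : ℝ)..U, (1 - τ ^ 2 / (2 * k)) ^ k)) := by
    have : 1 / 3 * (1 / 2) ≤ (√(2 * Real.pi))⁻¹ * (∫ τ in (0 : ℝ)..U, (1 - τ ^ 2 / (2 * k)) ^ k) := by
      gcongr
    linarith
  set B := (√(2 * Real.pi))⁻¹ * (∫ τ in (0 : ℝ)..U, (1 - τ ^ 2 / (2 * k)) ^ k)
  have hX := abs_ncdf_le ht0
  set X := ncdf t
  have hρ1 := cubic_mul_npdf_le t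
  have hρ0 : 0 ≤ (t ^ 3 + 3 * t) * npdf t := mul_nonneg (by positivity) (npdf_pos t).le
  set R := (t ^ 3 + 3 * t) * npdf t
  have hk2 : (0 : ℝ) < k ^ 2 := by positivity
  have hexp : Real.exp (-(U ^ 2 / 2)) / 2 ≤ 1 / k ^ 2 := by
    rw [hU2, show 2 * (k : ℝ) / 2 = k by ring, Real.exp_neg]
    have h := Real.pow_div_factorial_le_exp (k : ℝ) hk0.le 2
    norm_num [Nat.factorial] at h
    rw [div_le_div_iff₀ (by norm_num) hk2, inv_mul_le_iff₀ (Real.exp_pos _)]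
    linarith
  have hY := (half_sub_ncdf_le (by linarith : 0 ≤ U)).trans hexp
  have hZ : (U ^ 3 + 3 * U) * npdf U / (8 * k) ≤ 12 / k ^ 2 := by
    have h6 := pow_mul_npdf_le U 3
    norm_num [Nat.factorial] at h6
    have h7 : U ^ 3 + 3 * U ≤ 4 * U ^ 4 := by
      have := one_le_pow₀ hU1 (n := 3)
      have := one_le_pow₀ hU1 (n := 2)
      nlinarith [pow_pos (by linarith : 0 < U) 3]
    have h8 : (U ^ 3 + 3 * U) * npdf U ≤ 4 * U ^ 4 * npdf U :=
      mul_le_mul_of_nonneg_right h7 (npdf_pos U).le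
    have h9 : U ^ 6 = U ^ 4 * (2 * k) := by rw [← hU2]; ring
    rw [h9] at h6
    rw [div_le_div_iff₀ (by positivity) hk2]
    nlinarith
  have hZ0 : 0 ≤ (U ^ 3 + 3 * U) * npdf U / (8 * k) :=
    div_nonneg (mul_nonneg (by positivity) (npdf_pos U).le) (by positivity)
  set Z := (U ^ 3 + 3 * U) * npdf U / (8 * k)
  set Y := ncdf U
  set κ := 3 / (8 * (k : ℝ)) with hκ
  have hκ0 : 0 ≤ κ := by positivity
  have hκ1 : κ ≤ 1 := by rw [hκ, div_le_one (by positivity)]; linarith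
  have hs0 : (0 : ℝ) ≤ 1 / k ^ 2 := by positivity
  have hB2 : |2 * B - (1 - κ)| ≤ 7000 / k ^ 2 := by
    have e : 2 * B - (1 - κ) = 2 * (B - ((1 - κ) * Y + Z)) + 2 * ((1 - κ) * (Y - 1 / 2)) + 2 * Z := by
      ring
    have h5 : |(1 - κ) * (Y - 1 / 2)| ≤ 1 / k ^ 2 := by
      rw [abs_mul, abs_of_nonneg (by linarith : 0 ≤ 1 - κ)]
      nlinarith [abs_nonneg (Y - 1 / 2)]
    obtain ⟨a1, a2⟩ := abs_le.1 h2
    obtain ⟨b1, b2⟩ := abs_le.1 h5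
    rw [div_eq_mul_one_div] at a1 a2 hZ ⊢
    rw [e, abs_le]; constructor <;> linarith
  have hρ : R / (8 * k) * κ ≤ 1 / k ^ 2 := by
    rw [hκ, div_mul_div_comm, div_le_div_iff₀ (by positivity) hk2]
    nlinarith
  have hρ3 : R / (8 * k) ≤ 3 := by
    rw [div_le_iff₀ (by positivity)]; linarith
  have hρ4 : 0 ≤ R / (8 * k) := by positivity
  set ρ := R / (8 * (k : ℝ))
  have hBpos : 0 < 2 * B := by linarith
  have e : A / (2 * B) - (X + ρ) = (A - (X + ρ) * (2 * B)) / (2 * B) := by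
    rw [sub_div, mul_div_cancel_right₀ _ hBpos.ne']
  have hnum : |A - (X + ρ) * (2 * B)| ≤ 33333 / k ^ 2 := by
    -- The correction ρ is O(1/k) itself, so multiplying it by 1 - κ or not changes only O(k⁻²).
    have e2 : A - (X + ρ) * (2 * B) = (A - ((1 - κ) * X + ρ)) - (X + ρ) * (2 * B - (1 - κ)) + ρ * κ := by
      ring
    have h5 : |(X + ρ) * (2 * B - (1 - κ))| ≤ 4 * (7000 / k ^ 2) := by
      rw [abs_mul]
      gcongr
      obtain ⟨a1, a2⟩ := abs_le.1 hX
      rw [abs_le]; constructor <;> linarith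
    obtain ⟨a1, a2⟩ := abs_le.1 h1
    obtain ⟨b1, b2⟩ := abs_le.1 h5
    have h6 : 0 ≤ ρ * κ := by positivity
    rw [div_eq_mul_one_div] at a1 a2 b1 b2 ⊢
    rw [e2, abs_le]; constructor <;> linarith
  rw [e, abs_div, abs_of_pos hBpos, div_le_iff₀ hBpos]
  calc _ ≤ 33333 / (k : ℝ) ^ 2 := hnum
    _ ≤ 100000 / (k : ℝ) ^ 2 * (1 / 3) := by
      rw [div_mul_eq_mul_div]
      gcongr
      norm_num
    _ ≤ _ := by gcongr

/-! ### The parent density near its centre -/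

/-- One integration from 0+, using only the right limit of f and not its value at 0; the factor
1/(m+1) is given away. -/
theorem abs_le_of_deriv_le_pow {f f' : ℝ → ℝ} {x₁ C : ℝ} {m : ℕ} (hC : 0 ≤ C)
    (hf : ∀ x ∈ Set.Ioo 0 x₁, HasDerivAt f (f' x) x)
    (hb : ∀ x ∈ Set.Ioo 0 x₁, |f' x| ≤ C * x ^ m)
    (h0 : Tendsto f (𝓝[>] 0) (𝓝 0)) : ∀ x ∈ Set.Ioo 0 x₁, |f x| ≤ C * x ^ (m + 1) := by
  intro x hx
  have h1 : Tendsto (fun s => |f x - f s|) (𝓝[>] 0) (𝓝 |f x - 0|) :=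
    (tendsto_const_nhds.sub h0).abs
  rw [sub_zero] at h1
  refine le_of_tendsto h1 ?_
  filter_upwards [Ioo_mem_nhdsGT hx.1] with s hs
  have h2 := abs_sub_le_of_hasDerivAt (f := f) (f' := f') (a := s) (b := x) (M := C * x ^ m)
    (fun z hz => by
      rw [Set.uIcc_of_le hs.2.le] at hz
      exact hf z ⟨hs.1.trans_le hz.1, hz.2.trans_lt hx.2⟩)
    (fun z hz => by
      rw [Set.uIcc_of_le hs.2.le] at hz
      have hz0 : 0 < z := hs.1.trans_le hz.1
      refine (hb z ⟨hz0, hz.2.trans_lt hx.2⟩).trans ?_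
      have := hz.2
      gcongr)
  refine h2.trans ?_
  rw [abs_of_pos (sub_pos.2 hs.2), pow_succ, ← mul_assoc]
  have := hs.1
  have h3 : 0 ≤ C * x ^ m := mul_nonneg hC (pow_nonneg hx.1.le m)
  gcongr
  linarith

/-- The odd part of the distribution function of the density `p`. -/
noncomputable def oddCDF (p : ℝ → ℝ) (y : ℝ) : ℝ := ∫ t in (0 : ℝ)..y, p t

section
variable {p : ℝ → ℝ}

theorem RegularDensity.hasDerivAt_iteratedDeriv (hp : RegularDensity p) : ∃ x₀ > 0, ∃ K, 0 ≤ K ∧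
    (∀ k < 3, ∀ x ∈ Set.Ioo 0 x₀,
      HasDerivAt (iteratedDeriv k p) (iteratedDeriv (k + 1) p x) x) ∧
    ∀ k ∈ Finset.Icc 1 3, ∀ x ∈ Set.Ioo 0 x₀, |iteratedDeriv k p x| ≤ K := by
  obtain ⟨x₀, hx₀, hsm, K, hK⟩ := hp.smooth
  refine ⟨x₀, hx₀, K, ?_, ?_, hK⟩
  · exact (abs_nonneg _).trans (hK 1 (by simp) (x₀ / 2) ⟨by linarith, by linarith⟩)
  · intro k hk x hx
    rw [iteratedDeriv_succ]
    refine DifferentiableAt.hasDerivAt ?_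
    have h := (hsm.differentiableOn_iteratedDerivWithin (m := k) (by exact_mod_cast hk)
      isOpen_Ioo.uniqueDiffOn).differentiableAt (Ioo_mem_nhds hx.1 hx.2)
    refine h.congr_of_eventuallyEq ?_
    filter_upwards [Ioo_mem_nhds hx.1 hx.2] with z hz
    exact (iteratedDerivWithin_of_isOpen isOpen_Ioo hz).symm

theorem RegularDensity.continuousAt_right (hp : RegularDensity p) :
    Tendsto p (𝓝[>] 0) (𝓝 (p 0)) :=
  hp.continuousAt_zero.tendsto.mono_left nhdsWithin_le_nhds

theorem RegularDensity.abs_eq (hp : RegularDensity p) (x : ℝ) : p |x| = p x := by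
  rcases abs_choice x with h | h <;> rw [h]
  exact hp.symm x

/-- Near zero, `p` is Lipschitz and bounded away from zero. -/
theorem RegularDensity.local_lipschitz (hp : RegularDensity p) : ∃ x₁ > 0, ∃ L, 0 ≤ L ∧
    (∀ a b, |a| < x₁ → |b| < x₁ → |p a - p b| ≤ L * |a - b|) ∧
    (∀ a, |a| < x₁ → p 0 / 2 ≤ p a ∧ p a ≤ 2 * p 0) := by
  obtain ⟨x₀, hx₀, K, hK, hd, hb⟩ := hp.hasDerivAt_iteratedDeriv
  have hpos : ∀ a ∈ Set.Ioo 0 x₀, ∀ b ∈ Set.Ioo 0 x₀, |p b - p a| ≤ K * |b - a| := by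
    intro a ha b hb'
    refine abs_sub_le_of_hasDerivAt (f' := iteratedDeriv 1 p) (fun x hx => ?_) (fun x hx => ?_)
    · have := hd 0 (by norm_num) x (Set.ordConnected_Ioo.uIcc_subset ha hb' hx)
      simpa using this
    · exact hb 1 (by simp) x (Set.ordConnected_Ioo.uIcc_subset ha hb' hx)
  -- The density may have a kink at 0, so the Lipschitz bound passes to 0 by continuity and to
  -- negative arguments by symmetry.
  have hzero : ∀ b ∈ Set.Ioo 0 x₀, |p b - p 0| ≤ K * |b - 0| := by
    intro b hb'
    have h1 : Tendsto (fun a => |p b - p a|) (𝓝[>] 0) (𝓝 |p b - p 0|) :=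
      (tendsto_const_nhds.sub hp.continuousAt_right).abs
    have h2 : Tendsto (fun a : ℝ => K * |b - a|) (𝓝[>] 0) (𝓝 (K * |b - 0|)) :=
      ((by fun_prop : Continuous fun a : ℝ => K * |b - a|).tendsto 0).mono_left nhdsWithin_le_nhds
    refine le_of_tendsto_of_tendsto h1 h2 ?_
    filter_upwards [Ioo_mem_nhdsGT hx₀] with a ha using hpos a ha b hb'
  have hnn : ∀ a b, 0 ≤ a → a < x₀ → 0 ≤ b → b < x₀ → |p a - p b| ≤ K * |a - b| := by
    intro a b ha ha' hb0 hb'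
    rcases ha.eq_or_lt with rfl | ha
    · rcases hb0.eq_or_lt with rfl | hb0
      · simp
      · rw [abs_sub_comm, abs_sub_comm (0 : ℝ)]; exact hzero b ⟨hb0, hb'⟩
    · rcases hb0.eq_or_lt with rfl | hb0
      · exact hzero a ⟨ha, ha'⟩
      · exact hpos b ⟨hb0, hb'⟩ a ⟨ha, ha'⟩
  have hp0 := hp.pos_zero
  have hlip : ∀ a b, |a| < x₀ → |b| < x₀ → |p a - p b| ≤ K * |a - b| := by
    intro a b ha hb'
    rw [← hp.abs_eq a, ← hp.abs_eq b]
    refine (hnn _ _ (abs_nonneg a) ha (abs_nonneg b) hb').trans ?_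
    exact mul_le_mul_of_nonneg_left (abs_abs_sub_abs_le_abs_sub a b) hK
  -- On this radius the oscillation K|a| is at most p(0)/2; K + 1 avoids division by zero.
  refine ⟨min x₀ (p 0 / (2 * (K + 1))), lt_min hx₀ (by positivity), K, hK, ?_, ?_⟩
  · intro a b ha hb'
    exact hlip a b (ha.trans_le (min_le_left _ _)) (hb'.trans_le (min_le_left _ _))
  · intro a ha
    have h1 := hlip a 0 (ha.trans_le (min_le_left _ _)) (by simpa using hx₀)
    have h2 : |a| ≤ p 0 / (2 * (K + 1)) := (ha.trans_le (min_le_right _ _)).le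
    rw [sub_zero] at h1
    have h3 : K * |a| ≤ p 0 / 2 := by
      rw [le_div_iff₀ (by positivity)] at h2
      nlinarith [abs_nonneg a]
    obtain ⟨u, v⟩ := abs_le.1 (h1.trans h3)
    constructor <;> linarith

theorem RegularDensity.hasDerivAt_oddCDF (hp : RegularDensity p) (hint : Integrable p)
    {x₁ L : ℝ} (hL : ∀ a b, |a| < x₁ → |b| < x₁ → |p a - p b| ≤ L * |a - b|) {y : ℝ}
    (hy : |y| < x₁) : HasDerivAt (oddCDF p) (p y) y := by
  refine intervalIntegral.integral_hasDerivAt_right hint.intervalIntegrable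
    ⟨Set.univ, univ_mem, hp.measurable.aestronglyMeasurable⟩ ?_
  rw [Metric.continuousAt_iff']
  intro ε hε
  have hopen : {b : ℝ | |b| < x₁} ∈ 𝓝 y :=
    (isOpen_lt continuous_abs continuous_const).mem_nhds hy
  have h2 : ∀ᶠ b in 𝓝 y, L * |b - y| < ε := by
    have : Tendsto (fun b : ℝ => L * |b - y|) (𝓝 y) (𝓝 (L * |y - y|)) :=
      (by fun_prop : Continuous fun b : ℝ => L * |b - y|).tendsto y
    rw [sub_self, abs_zero, mul_zero] at this
    exact this.eventually_lt_const hε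
  filter_upwards [hopen, h2] with b hb hb2
  rw [Real.dist_eq]
  exact (hL b y hb hy).trans_lt hb2

theorem RegularDensity.oddCDF_neg (hp : RegularDensity p) (y : ℝ) :
    oddCDF p (-y) = -oddCDF p y := by
  unfold oddCDF
  have := intervalIntegral.integral_comp_neg (a := 0) (b := y) p
  simp only [hp.symm, neg_zero] at this
  rw [this, intervalIntegral.integral_symm]

/-- Taylor expansion of the distribution function on the right of the median. -/
theorem RegularDensity.oddCDF_taylor (hp : RegularDensity p) (hint : Integrable p) {p₁ p₂ : ℝ}
    (hp₁ : Tendsto (deriv p) (𝓝[>] 0) (𝓝 p₁))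
    (hp₂ : Tendsto (iteratedDeriv 2 p) (𝓝[>] 0) (𝓝 p₂)) :
    ∃ x₁ > 0, ∃ K, 0 ≤ K ∧ ∀ y, 0 ≤ y → y < x₁ →
      |oddCDF p y - (p 0 * y + p₁ * y ^ 2 / 2 + p₂ * y ^ 3 / 6)| ≤ K * y ^ 4 := by
  obtain ⟨x₀, hx₀, K, hK, hd, hb⟩ := hp.hasDerivAt_iteratedDeriv
  obtain ⟨x₁, hx₁, L, -, hL, -⟩ := hp.local_lipschitz
  have hpol : ∀ {f : ℝ → ℝ} {a : ℝ} {q : ℝ → ℝ}, Tendsto f (𝓝[>] 0) (𝓝 a) → Continuous q →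
      q 0 = a → Tendsto (fun t => f t - q t) (𝓝[>] 0) (𝓝 0) := by
    intro f a q hf hq h0
    have := hf.sub ((hq.tendsto 0).mono_left nhdsWithin_le_nhds)
    rwa [h0, sub_self] at this
  -- Four successive integrations from the bounded third derivative up to the distribution function,
  -- each adding one power of y.
  have h2 := abs_le_of_deriv_le_pow (f := fun t => iteratedDeriv 2 p t - p₂)
    (f' := iteratedDeriv 3 p) (x₁ := x₀) (m := 0) hK
    (fun x hx => by simpa using (hd 2 (by norm_num) x hx).sub_const p₂)
    (fun x hx => by simpa using hb 3 (by simp) x hx)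
    (hpol hp₂ (q := fun _ => p₂) continuous_const rfl)
  have h1 := abs_le_of_deriv_le_pow (f := fun t => iteratedDeriv 1 p t - (p₁ + p₂ * t))
    (f' := fun t => iteratedDeriv 2 p t - p₂) (x₁ := x₀) (m := 1) hK
    (fun x hx => by
      have h3 : HasDerivAt (fun t : ℝ => p₁ + p₂ * t) p₂ x := by
        simpa using ((hasDerivAt_id x).const_mul p₂).const_add p₁
      exact (hd 1 (by norm_num) x hx).sub h3) h2
    (hpol (by simpa [iteratedDeriv_one] using hp₁) (by fun_prop) (by simp))
  have h0 := abs_le_of_deriv_le_pow (f := fun t => p t - (p 0 + p₁ * t + p₂ * t ^ 2 / 2))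
    (f' := fun t => iteratedDeriv 1 p t - (p₁ + p₂ * t)) (x₁ := x₀) (m := 2) hK
    (fun x hx => by
      have h3 : HasDerivAt (fun t : ℝ => p 0 + p₁ * t + p₂ * t ^ 2 / 2) (p₁ + p₂ * x) x := by
        refine ((((hasDerivAt_id x).const_mul p₁).const_add (p 0)).add
          (((hasDerivAt_pow 2 x).const_mul p₂).div_const 2)).congr_deriv ?_
        simp; ring
      have := hd 0 (by norm_num) x hx
      simp only [iteratedDeriv_zero] at this
      exact this.sub h3) h1
    (hpol hp.continuousAt_right (by fun_prop) (by simp))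
  have hF0 : oddCDF p 0 = 0 := by simp [oddCDF]
  have hI := abs_le_of_deriv_le_pow
    (f := fun t => oddCDF p t - (p 0 * t + p₁ * t ^ 2 / 2 + p₂ * t ^ 3 / 6))
    (f' := fun t => p t - (p 0 + p₁ * t + p₂ * t ^ 2 / 2)) (x₁ := min x₀ x₁) (m := 3) hK
    (fun x hx => by
      have h3 : HasDerivAt (fun t : ℝ => p 0 * t + p₁ * t ^ 2 / 2 + p₂ * t ^ 3 / 6)
          (p 0 + p₁ * x + p₂ * x ^ 2 / 2) x := by
        refine ((((hasDerivAt_id x).const_mul (p 0)).add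
          (((hasDerivAt_pow 2 x).const_mul p₁).div_const 2)).add
          (((hasDerivAt_pow 3 x).const_mul p₂).div_const 6)).congr_deriv ?_
        simp; ring
      refine (hp.hasDerivAt_oddCDF hint hL ?_).sub h3
      rw [abs_of_pos hx.1]
      exact hx.2.trans_le (min_le_right _ _))
    (fun x hx => h0 x ⟨hx.1, hx.2.trans_le (min_le_left _ _)⟩)
    (hpol (((hp.hasDerivAt_oddCDF hint hL (y := 0) (by simpa using hx₁)).continuousAt.tendsto).mono_left
      nhdsWithin_le_nhds) (by fun_prop) (by simp [hF0]))
  refine ⟨min x₀ x₁, lt_min hx₀ hx₁, K, hK, fun y hy hy1 => ?_⟩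
  rcases hy.eq_or_lt with rfl | hy
  · simp [hF0]
  · exact hI y ⟨hy, hy1⟩

end

/-! ### Order statistics -/

/-- The number of the first `m` observations that are at most `y`. -/
noncomputable def countLE (x : ℕ → ℝ) (m : ℕ) (y : ℝ) : ℕ :=
  ((Finset.range m).filter (fun i => x i ≤ y)).card

/-- The bridge from sorting to counting: later arguments use order statistics only through these
counts. -/
theorem orderStat_le_iff {x : ℕ → ℝ} {m k : ℕ} (hk : 1 ≤ k) (hkm : k ≤ m) (y : ℝ) :
    orderStat x m k ≤ y ↔ k ≤ countLE x m y := by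
  have h : k - 1 < m := by omega
  set f : Fin m → ℝ := fun i => x i with hf
  have h1 := Tuple.lt_card_le_iff_apply_le_of_monotone (f := f ∘ Tuple.sort f) (a := y)
    (j := ⟨k - 1, h⟩) (Tuple.monotone_sort f)
  have h2 : (Finset.univ.filter fun i => (f ∘ Tuple.sort f) i ≤ y).card = countLE x m y := by
    rw [countLE, Finset.card_filter, Finset.card_filter,
      ← Fin.sum_univ_eq_sum_range (fun i => if x i ≤ y then 1 else 0) m]
    exact Equiv.sum_comp (Tuple.sort f) (fun i : Fin m => if f i ≤ y then 1 else 0)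
  rw [h2] at h1
  rw [orderStat, dif_pos h]
  simp only [Function.comp_apply] at h1
  rw [← h1]
  omega

theorem measurable_countLE (m : ℕ) (y : ℝ) : Measurable fun x : ℕ → ℝ => countLE x m y := by
  simp only [countLE, Finset.card_filter]
  refine Finset.measurable_sum _ fun i _ => ?_
  exact Measurable.ite (measurableSet_le (measurable_pi_apply i) measurable_const)
    measurable_const measurable_const

theorem measurable_orderStat {m k : ℕ} (hk : 1 ≤ k) (hkm : k ≤ m) :
    Measurable fun x : ℕ → ℝ => orderStat x m k := by
  refine measurable_of_Iic fun y => ?_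
  have : (fun x : ℕ → ℝ => orderStat x m k) ⁻¹' Set.Iic y =
      (fun x : ℕ → ℝ => countLE x m y) ⁻¹' Set.Ici k := by
    ext x; exact orderStat_le_iff hk hkm y
  rw [this]
  exact measurable_countLE m y measurableSet_Ici

theorem measurable_sampleMedian {m : ℕ} (hm : 1 ≤ m) :
    Measurable fun x : ℕ → ℝ => sampleMedian x m := by
  unfold sampleMedian
  by_cases h : Odd m
  · simp only [if_pos h]
    exact measurable_orderStat (by omega) (by omega)
  · simp only [if_neg h]
    rw [Nat.not_odd_iff_even] at h
    obtain ⟨k, rfl⟩ := h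
    exact ((measurable_orderStat (by omega) (by omega)).add
      (measurable_orderStat (by omega) (by omega))).div_const 2

theorem sampleMedian_odd_le_iff (x : ℕ → ℝ) (k : ℕ) (y : ℝ) :
    sampleMedian x (2 * k + 1) ≤ y ↔ k + 1 ≤ countLE x (2 * k + 1) y := by
  rw [sampleMedian, if_pos ⟨k, rfl⟩, orderStat_le_iff (by omega) (by omega)]
  have : (2 * k + 1 + 1) / 2 = k + 1 := by omega
  rw [this]

theorem sampleMedian_even (x : ℕ → ℝ) (k : ℕ) :
    sampleMedian x (2 * k) = (orderStat x (2 * k) k + orderStat x (2 * k) (k + 1)) / 2 := by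
  rw [sampleMedian, if_neg (by rw [Nat.not_odd_iff_even]; exact even_two_mul k)]
  have : 2 * k / 2 = k := by omega
  rw [this]

theorem sampleMedian_even_le {x : ℕ → ℝ} {k : ℕ} (hk : 1 ≤ k) {y : ℝ}
    (h : k + 1 ≤ countLE x (2 * k) y) : sampleMedian x (2 * k) ≤ y := by
  rw [sampleMedian_even]
  have h1 := (orderStat_le_iff (x := x) hk (by omega : k ≤ 2 * k) y).2 (by omega)
  have h2 := (orderStat_le_iff (x := x) (by omega) (by omega : k + 1 ≤ 2 * k) y).2 h
  linarith

theorem lt_sampleMedian_even {x : ℕ → ℝ} {k : ℕ} (hk : 1 ≤ k) {y : ℝ}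
    (h : countLE x (2 * k) y < k) : y < sampleMedian x (2 * k) := by
  rw [sampleMedian_even]
  have h1 := (orderStat_le_iff (x := x) hk (by omega : k ≤ 2 * k) y).not.2 (by omega)
  have h2 := (orderStat_le_iff (x := x) (by omega) (by omega : k + 1 ≤ 2 * k) y).not.2 (by omega)
  push Not at h1 h2
  linarith

/-- If exactly the observations in `S` are at most `y`, the two middle order statistics are
the largest observation in `S` and the smallest one outside. -/
theorem sampleMedian_even_eq {x : ℕ → ℝ} {k : ℕ} (hk : 1 ≤ k) {y : ℝ} {S : Finset ℕ}
    (hS : S ⊆ Finset.range (2 * k)) (hSc : S.card = k) (hS0 : S.Nonempty)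
    (hT0 : (Finset.range (2 * k) \ S).Nonempty) (h1 : ∀ i ∈ S, x i ≤ y)
    (h2 : ∀ i ∈ Finset.range (2 * k) \ S, y < x i) :
    sampleMedian x (2 * k) = (S.sup' hS0 x + (Finset.range (2 * k) \ S).inf' hT0 x) / 2 := by
  have hmem : ∀ i ∈ Finset.range (2 * k), x i ≤ y → i ∈ S := by
    intro i hi hiy
    by_contra hiS
    exact absurd (h2 i (Finset.mem_sdiff.2 ⟨hi, hiS⟩)) (not_lt.2 hiy)
  have hAy : S.sup' hS0 x ≤ y := Finset.sup'_le hS0 x h1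
  have e1 : orderStat x (2 * k) k = S.sup' hS0 x := by
    refine le_antisymm ?_ ?_
    · rw [orderStat_le_iff hk (by omega), countLE]
      refine hSc.symm.le.trans (Finset.card_le_card fun i hi => ?_)
      exact Finset.mem_filter.2 ⟨hS hi, Finset.le_sup' x hi⟩
    · by_contra hlt
      push Not at hlt
      have hc := (orderStat_le_iff (x := x) hk (by omega : k ≤ 2 * k) _).1 le_rfl
      set z := orderStat x (2 * k) k
      obtain ⟨i₀, hi₀, hmax⟩ := Finset.exists_mem_eq_sup' hS0 x
      -- All observations at most z lie in S, but the maximiser over S is not among them, so fewer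
      -- than k are counted.
      have : ((Finset.range (2 * k)).filter (fun i => x i ≤ z)).card < S.card := by
        refine Finset.card_lt_card (Finset.ssubset_iff_of_subset ?_ |>.2 ⟨i₀, hi₀, ?_⟩)
        · intro i hi
          rw [Finset.mem_filter] at hi
          exact hmem i hi.1 (hi.2.trans (hlt.le.trans hAy))
        · rw [Finset.mem_filter, not_and, not_le, ← hmax]
          exact fun _ => hlt
      rw [countLE] at hc
      omega
  have e2 : orderStat x (2 * k) (k + 1) = (Finset.range (2 * k) \ S).inf' hT0 x := by
    obtain ⟨i₀, hi₀, hmin⟩ := Finset.exists_mem_eq_inf' hT0 x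
    have hi₀' := Finset.mem_sdiff.1 hi₀
    refine le_antisymm ?_ ?_
    · rw [orderStat_le_iff (by omega) (by omega), countLE]
      have hcard : k + 1 = (insert i₀ S).card := by
        rw [Finset.card_insert_of_notMem hi₀'.2, hSc]
      refine hcard.le.trans (Finset.card_le_card fun i hi => ?_)
      rw [Finset.mem_insert] at hi
      rw [Finset.mem_filter]
      rcases hi with rfl | hi
      · exact ⟨hi₀'.1, hmin.ge⟩
      · exact ⟨hS hi, (h1 i hi).trans ((h2 i₀ hi₀).le.trans hmin.ge)⟩
    · by_contra hlt
      push Not at hlt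
      have hc := (orderStat_le_iff (x := x) (by omega : 1 ≤ k + 1) (by omega : k + 1 ≤ 2 * k) _).1 le_rfl
      set z := orderStat x (2 * k) (k + 1)
      have : ((Finset.range (2 * k)).filter (fun i => x i ≤ z)).card ≤ S.card := by
        refine Finset.card_le_card fun i hi => ?_
        rw [Finset.mem_filter] at hi
        by_contra hiS
        have := Finset.inf'_le x (Finset.mem_sdiff.2 ⟨hi.1, hiS⟩)
        exact absurd (hi.2.trans_lt hlt) (not_lt.2 this)
      rw [countLE] at hc
      omega
  rw [sampleMedian_even, e1, e2]

/-! ### Counting observations below a level -/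

section
variable {Ω : Type*} {Y : ℕ → Ω → ℝ}

/-- Exactly the observations with index in `S`, among the first `m`, are at most `y`. -/
def belowSet (Y : ℕ → Ω → ℝ) (m : ℕ) (y : ℝ) (S : Finset ℕ) : Set Ω :=
  {ω | (Finset.range m).filter (fun i => Y i ω ≤ y) = S}

theorem belowSet_eq (m : ℕ) (y : ℝ) {S : Finset ℕ} (hS : S ⊆ Finset.range m) :
    belowSet Y m y S =
      ⋂ i ∈ Finset.range m, Y i ⁻¹' (if i ∈ S then Set.Iic y else Set.Ioi y) := by
  ext ω
  simp only [belowSet, Set.mem_ofPred_eq, Set.mem_iInter, Set.mem_preimage, Finset.ext_iff,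
    Finset.mem_filter]
  constructor
  · intro h i hi
    split_ifs with hiS
    · exact ((h i).2 hiS).2
    · exact not_le.1 fun hle => hiS ((h i).1 ⟨hi, hle⟩)
  · intro h i
    constructor
    · rintro ⟨hi, hle⟩
      by_contra hiS
      have := h i hi
      rw [if_neg hiS] at this
      exact absurd hle (not_le.2 this)
    · intro hiS
      have := h i (hS hiS)
      rw [if_pos hiS] at this
      exact ⟨hS hiS, this⟩

theorem belowSet_disjoint (m : ℕ) (y : ℝ) {S T : Finset ℕ} (h : S ≠ T) :
    Disjoint (belowSet Y m y S) (belowSet Y m y T) := by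
  rw [Set.disjoint_left]
  intro ω h1 h2
  exact h (Eq.trans (Eq.symm h1) h2)

variable [MeasurableSpace Ω] {P : Measure Ω} {μ : Measure ℝ} [IsProbabilityMeasure μ]

theorem measurableSet_belowSet (hY : ∀ i, Measurable (Y i)) (m : ℕ) (y : ℝ) {S : Finset ℕ}
    (hS : S ⊆ Finset.range m) : MeasurableSet (belowSet Y m y S) := by
  rw [belowSet_eq m y hS]
  refine Finset.measurableSet_biInter _ fun i _ => hY i ?_
  split_ifs
  · exact measurableSet_Iic
  · exact measurableSet_Ioi

theorem prob_belowSet (hY : ∀ i, Measurable (Y i)) (hlaw : ∀ i, P.map (Y i) = μ)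
    (hind : iIndepFun Y P) (m : ℕ) (y : ℝ) {S : Finset ℕ} (hS : S ⊆ Finset.range m) :
    P.real (belowSet Y m y S) =
      μ.real (Set.Iic y) ^ S.card * (1 - μ.real (Set.Iic y)) ^ (m - S.card) := by
  have hms : ∀ i, MeasurableSet (if i ∈ S then Set.Iic y else Set.Ioi y) := fun i => by
    split_ifs
    · exact measurableSet_Iic
    · exact measurableSet_Ioi
  rw [belowSet_eq m y hS, Measure.real, hind.measure_inter_preimage_eq_mul (Finset.range m)
    (fun i _ => hms i), ENNReal.toReal_prod]
  have h1 : ∀ i ∈ Finset.range m, (P (Y i ⁻¹' (if i ∈ S then Set.Iic y else Set.Ioi y))).toReal =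
      if i ∈ S then μ.real (Set.Iic y) else 1 - μ.real (Set.Iic y) := by
    intro i _
    rw [← Measure.map_apply (hY i) (hms i), hlaw i]
    split_ifs
    · rfl
    · rw [← probReal_compl_eq_one_sub measurableSet_Iic, Set.compl_Iic]; rfl
  rw [Finset.prod_congr rfl h1, Finset.prod_ite, Finset.prod_const, Finset.prod_const,
    Finset.filter_mem_eq_inter, Finset.inter_eq_right.2 hS,
    Finset.filter_not, Finset.filter_mem_eq_inter, Finset.inter_eq_right.2 hS,
    Finset.card_sdiff_of_subset hS, Finset.card_range]

variable [IsProbabilityMeasure P]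

/-- Decomposition of the probability of an event according to the set of observations below `y`,
when that set has a prescribed cardinality. -/
theorem prob_inter_countLE (hY : ∀ i, Measurable (Y i)) (m : ℕ) (y : ℝ) (q : ℕ → Prop)
    [DecidablePred q] (A : Set Ω) (hA : MeasurableSet A) :
    P.real ({ω | q (countLE (fun i => Y i ω) m y)} ∩ A) =
      ∑ S ∈ (Finset.range m).powerset.filter (fun S => q S.card),
        P.real (belowSet Y m y S ∩ A) := by
  have hsub : ∀ S ∈ (Finset.range m).powerset.filter (fun S => q S.card), S ⊆ Finset.range m :=
    fun S hS => Finset.mem_powerset.1 (Finset.mem_filter.1 hS).1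
  rw [← measureReal_biUnion_finset]
  · congr 1
    ext ω
    simp only [Set.mem_inter_iff, Set.mem_ofPred_eq, Set.mem_iUnion, exists_prop, belowSet,
      Finset.mem_filter, Finset.mem_powerset]
    constructor
    · rintro ⟨h1, h2⟩
      exact ⟨_, ⟨Finset.filter_subset _ _, h1⟩, rfl, h2⟩
    · rintro ⟨S, ⟨_, h1⟩, h2, h3⟩
      refine ⟨?_, h3⟩
      rw [countLE, h2]; exact h1
  · intro S _ T _ hST
    exact (belowSet_disjoint m y hST).mono Set.inter_subset_left Set.inter_subset_left
  · intro S hS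
    exact (measurableSet_belowSet hY m y (hsub S hS)).inter hA

theorem prob_countLE_ge (hY : ∀ i, Measurable (Y i)) (hlaw : ∀ i, P.map (Y i) = μ)
    (hind : iIndepFun Y P) (m c : ℕ) (y : ℝ) :
    P.real {ω | c ≤ countLE (fun i => Y i ω) m y} =
      ∑ i ∈ Finset.range (m + 1), if c ≤ i then
        (m.choose i : ℝ) * (μ.real (Set.Iic y) ^ i * (1 - μ.real (Set.Iic y)) ^ (m - i)) else 0 := by
  have h := prob_inter_countLE (P := P) hY m y (fun i => c ≤ i) Set.univ MeasurableSet.univ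
  simp only [Set.inter_univ] at h
  rw [h, Finset.sum_filter, Finset.sum_congr rfl (g := fun S => if c ≤ S.card then
    μ.real (Set.Iic y) ^ S.card * (1 - μ.real (Set.Iic y)) ^ (m - S.card) else 0)]
  · rw [Finset.sum_powerset_apply_card (fun i => if c ≤ i then
      μ.real (Set.Iic y) ^ i * (1 - μ.real (Set.Iic y)) ^ (m - i) else 0), Finset.card_range]
    refine Finset.sum_congr rfl fun i _ => ?_
    split_ifs <;> simp
  · intro S hS
    rw [prob_belowSet hY hlaw hind m y (Finset.mem_powerset.1 hS)]

end

/-! ### The binomial tail as a beta integral -/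

/-- The probability of more than `k` successes among `2 k + 1` trials. -/
noncomputable def binomUpper (k : ℕ) : Polynomial ℝ :=
  ∑ i ∈ Finset.range (k + 1), bernsteinPolynomial ℝ (2 * k + 1) (k + 1 + i)

theorem eval_bernsteinPolynomial (m i : ℕ) (v : ℝ) :
    (bernsteinPolynomial ℝ m i).eval v = m.choose i * (v ^ i * (1 - v) ^ (m - i)) := by
  simp [bernsteinPolynomial, mul_assoc]

theorem hasDerivAt_binomUpper (k : ℕ) (s : ℝ) :
    HasDerivAt (fun s => (binomUpper k).eval (1 / 2 + s))
      ((2 * k + 1) * k.centralBinom / 4 ^ k * (1 - 4 * s ^ 2) ^ k) s := by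
  have h := ((binomUpper k).hasDerivAt (1 / 2 + s)).comp s ((hasDerivAt_id s).const_add (1 / 2))
  refine h.congr_deriv ?_
  -- The derivatives of consecutive Bernstein polynomials telescope, leaving a single term.
  have hd : Polynomial.derivative (binomUpper k) =
      ((2 * k + 1 : ℕ) : Polynomial ℝ) * bernsteinPolynomial ℝ (2 * k) k := by
    rw [binomUpper, Polynomial.derivative_sum]
    have : ∀ i ∈ Finset.range (k + 1),
        Polynomial.derivative (bernsteinPolynomial ℝ (2 * k + 1) (k + 1 + i)) =
        ((2 * k + 1 : ℕ) : Polynomial ℝ) * (bernsteinPolynomial ℝ (2 * k) (k + i) -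
          bernsteinPolynomial ℝ (2 * k) (k + (i + 1))) := by
      intro i _
      have := bernsteinPolynomial.derivative_succ ℝ (2 * k + 1) (k + i)
      rw [show k + 1 + i = k + i + 1 by ring, this, Nat.add_sub_cancel]
      rfl
    rw [Finset.sum_congr rfl this, ← Finset.mul_sum,
      Finset.sum_range_sub' (fun i => bernsteinPolynomial ℝ (2 * k) (k + i)),
      bernsteinPolynomial.eq_zero_of_lt ℝ (by omega : 2 * k < k + (k + 1)), sub_zero, add_zero]
  rw [hd, Polynomial.eval_mul, eval_bernsteinPolynomial, Polynomial.eval_natCast,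
    ← Nat.centralBinom_eq_two_mul_choose, show 2 * k - k = k by omega, ← mul_pow]
  have : (1 / 2 + s) * (1 - (1 / 2 + s)) = (1 - 4 * s ^ 2) / 4 := by ring
  rw [this, div_pow]
  push_cast
  ring

/-- The derivative is an even multiple of (1 - 4s²)^k about 1/2, and the values 0 and 1 at the end
points fix both the value 1/2 at the centre and the normalising constant. -/
theorem binomUpper_eval_eq (k : ℕ) (δ : ℝ) :
    (binomUpper k).eval (1 / 2 + δ) = 1 / 2 + betaOdd k δ := by
  set c : ℝ := (2 * k + 1) * k.centralBinom / 4 ^ k with hc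
  have hcont : Continuous fun s : ℝ => (1 - 4 * s ^ 2) ^ k := by fun_prop
  have hint : ∀ a b : ℝ, IntervalIntegrable (fun s : ℝ => (1 - 4 * s ^ 2) ^ k) volume a b :=
    fun a b => hcont.intervalIntegrable a b
  have ftc : ∀ a b : ℝ, c * ∫ s in a..b, (1 - 4 * s ^ 2) ^ k =
      (binomUpper k).eval (1 / 2 + b) - (binomUpper k).eval (1 / 2 + a) := by
    intro a b
    rw [← intervalIntegral.integral_const_mul]
    exact intervalIntegral.integral_eq_sub_of_hasDerivAt
      (fun s _ => hasDerivAt_binomUpper k s) ((hint a b).const_mul c)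
  have h1 : (binomUpper k).eval 1 = 1 := by
    rw [binomUpper, Polynomial.eval_finsetSum, Finset.sum_eq_single k]
    · rw [bernsteinPolynomial.eval_at_1, if_pos (by ring)]
    · intro i _ hi
      rw [bernsteinPolynomial.eval_at_1, if_neg (by omega)]
    · simp
  have h0 : (binomUpper k).eval 0 = 0 := by
    rw [binomUpper, Polynomial.eval_finsetSum]
    refine Finset.sum_eq_zero fun i _ => ?_
    rw [bernsteinPolynomial.eval_at_0, if_neg (by omega)]
  have hsym : ∫ s in (-(1 / 2) : ℝ)..0, (1 - 4 * s ^ 2) ^ k =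
      ∫ s in (0 : ℝ)..(1 / 2), (1 - 4 * s ^ 2) ^ k := by
    have := intervalIntegral.integral_comp_neg (a := (0 : ℝ)) (b := 1 / 2)
      (fun s : ℝ => (1 - 4 * s ^ 2) ^ k)
    rw [neg_zero] at this
    rw [← this]
    refine intervalIntegral.integral_congr fun s _ => ?_
    simp
  have e1 := ftc (-(1 / 2)) 0
  have e2 := ftc 0 (1 / 2)
  have e3 := ftc 0 δ
  rw [hsym] at e1
  norm_num [h0, h1] at e1 e2 e3
  rw [betaOdd]
  have hI : (∫ s in (0 : ℝ)..(1 / 2), (1 - 4 * s ^ 2) ^ k) ≠ 0 := by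
    intro h
    rw [h] at e1 e2
    linarith
  norm_num at hI ⊢
  generalize (∫ s in (0 : ℝ)..(1 / 2), (1 - 4 * s ^ 2) ^ k) = I at *
  generalize (∫ s in (0 : ℝ)..δ, (1 - 4 * s ^ 2) ^ k) = J at *
  have hcI : c * I = 1 / 2 := by linarith
  have h12 : (binomUpper k).eval (1 / 2) = 1 / 2 := by linarith
  have : J / (2 * I) = c * J := by
    rw [div_eq_iff (by positivity)]
    linear_combination (-2 * J) * hcI
  rw [this]
  linarith

section
variable {Ω : Type*} {Y : ℕ → Ω → ℝ} [MeasurableSpace Ω] {P : Measure Ω} {μ : Measure ℝ}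
  [IsProbabilityMeasure μ] [IsProbabilityMeasure P]

theorem prob_sampleMedian_odd_le (hY : ∀ i, Measurable (Y i)) (hlaw : ∀ i, P.map (Y i) = μ)
    (hind : iIndepFun Y P) (k : ℕ) (y : ℝ) :
    P.real {ω | sampleMedian (fun i => Y i ω) (2 * k + 1) ≤ y} =
      1 / 2 + betaOdd k (μ.real (Set.Iic y) - 1 / 2) := by
  simp only [sampleMedian_odd_le_iff]
  rw [prob_countLE_ge hY hlaw hind, ← binomUpper_eval_eq, binomUpper, Polynomial.eval_finsetSum,
    show 2 * k + 1 + 1 = (k + 1) + (k + 1) by ring, Finset.sum_range_add]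
  rw [Finset.sum_eq_zero, zero_add]
  · refine Finset.sum_congr rfl fun i _ => ?_
    rw [if_pos (by omega), eval_bernsteinPolynomial, add_sub_cancel]
  · intro i hi
    rw [Finset.mem_range] at hi
    rw [if_neg (by omega)]

end

/-! ### The joint law of the two middle order statistics -/

theorem integral_mul_exp_neg_le {c : ℝ} (hc : 0 < c) (y : ℝ) {h : ℝ} (hh : 0 ≤ h) :
    ∫ b in y..(y + h), (b - y) * Real.exp (-(c * (b - y))) ≤ 1 / c ^ 2 := by
  have hd : ∀ b : ℝ, HasDerivAt (fun b => -((b - y) / c + 1 / c ^ 2) * Real.exp (-(c * (b - y))))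
      ((b - y) * Real.exp (-(c * (b - y)))) b := by
    intro b
    have h1 : HasDerivAt (fun b : ℝ => b - y) 1 b := (hasDerivAt_id b).sub_const y
    refine (((h1.div_const c).add_const (1 / c ^ 2)).neg.mul
      (h1.const_mul c).neg.exp).congr_deriv ?_
    simp only [Pi.neg_apply]
    field_simp
    ring
  rw [intervalIntegral.integral_eq_sub_of_hasDerivAt (fun b _ => hd b)
    (Continuous.intervalIntegrable (by fun_prop) _ _)]
  simp only [add_sub_cancel_left, sub_self, zero_div, mul_zero, neg_zero, Real.exp_zero]
  have : 0 ≤ (h / c + 1 / c ^ 2) * Real.exp (-(c * h)) := by positivity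
  linarith

/-- A distribution function `F` with Lipschitz density `p`, bounded above and away from zero,
on the interval `(-x₁, x₁)`. -/
structure LocallyRegular (F p : ℝ → ℝ) (x₁ c M L : ℝ) : Prop where
  nonneg : ∀ t, 0 ≤ F t
  le_one : ∀ t, F t ≤ 1
  hasDerivAt : ∀ t, |t| < x₁ → HasDerivAt F (p t) t
  lipschitz : ∀ a b, |a| < x₁ → |b| < x₁ → |p a - p b| ≤ L * |a - b|
  lower : ∀ t, |t| < x₁ → c ≤ p t
  upper : ∀ t, |t| < x₁ → p t ≤ M
  radius_pos : 0 < x₁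
  lower_pos : 0 < c
  lipschitz_nonneg : 0 ≤ L

section
variable {F p : ℝ → ℝ} {x₁ c M L y : ℝ}

theorem LocallyRegular.abs_lt (hy : |y| < x₁ / 4) {b : ℝ}
    (hb : b ∈ Set.Icc y (y + x₁ / 4)) : |b| < x₁ ∧ |2 * y - b| < x₁ := by
  rw [_root_.abs_lt] at hy
  rw [_root_.abs_lt, _root_.abs_lt]
  refine ⟨⟨?_, ?_⟩, ?_, ?_⟩ <;> linarith [hb.1, hb.2, hy.1, hy.2]

theorem LocallyRegular.sub_bounds (h : LocallyRegular F p x₁ c M L) {a b : ℝ} (hab : a ≤ b)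
    (ha : |a| < x₁) (hb : |b| < x₁) : c * (b - a) ≤ F b - F a ∧ F b - F a ≤ M * (b - a) := by
  rcases hab.eq_or_lt with rfl | hab
  · simp
  have hsub : ∀ t ∈ Set.Icc a b, |t| < x₁ := by
    intro t ht
    rw [_root_.abs_lt] at *
    exact ⟨by linarith [ht.1], by linarith [ht.2]⟩
  obtain ⟨t, ht, hte⟩ := exists_hasDerivAt_eq_slope F p hab
    (fun t ht => (h.hasDerivAt t (hsub t ht)).continuousAt.continuousWithinAt)
    (fun t ht => h.hasDerivAt t (hsub t (Set.Ioo_subset_Icc_self ht)))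
  rw [eq_div_iff (by linarith)] at hte
  rw [← hte]
  have ht' := hsub t (Set.Ioo_subset_Icc_self ht)
  exact ⟨mul_le_mul_of_nonneg_right (h.lower t ht') (by linarith),
    mul_le_mul_of_nonneg_right (h.upper t ht') (by linarith)⟩

/-- By the arithmetic-geometric mean inequality the product is at most ((1 - (F b - F(2y - b)))/2)²,
and the increment is at least 2c(b - y). -/
theorem LocallyRegular.mul_le_exp (h : LocallyRegular F p x₁ c M L) (hy : |y| < x₁ / 4) {b : ℝ}
    (hb : b ∈ Set.Icc y (y + x₁ / 4)) :
    F (2 * y - b) * (1 - F b) ≤ 1 / 4 * Real.exp (-(4 * c * (b - y))) := by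
  have hb' := abs_lt hy hb
  have hy' : |y| < x₁ := hy.trans (by linarith [h.radius_pos])
  have h1 := (h.sub_bounds (by linarith [hb.1] : 2 * y - b ≤ y) hb'.2 hy').1
  have h2 := (h.sub_bounds hb.1 hy' hb'.1).1
  have h3 := h.nonneg (2 * y - b)
  have h4 := h.le_one b
  have h5 : F (2 * y - b) * (1 - F b) ≤ ((1 - 2 * (c * (b - y))) / 2) ^ 2 := by
    nlinarith [sq_nonneg (F (2 * y - b) - (1 - F b)), h.nonneg b]
  have h6 : 1 - 2 * (c * (b - y)) ≤ Real.exp (-(2 * (c * (b - y)))) := by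
    linarith [Real.add_one_le_exp (-(2 * (c * (b - y))))]
  have h7 : (1 - 2 * (c * (b - y))) ^ 2 ≤ Real.exp (-(2 * (c * (b - y)))) ^ 2 :=
    pow_le_pow_left₀ (by linarith) h6 2
  rw [← Real.exp_nat_mul] at h7
  have h8 : ((2 : ℕ) : ℝ) * -(2 * (c * (b - y))) = -(4 * c * (b - y)) := by push_cast; ring
  rw [h8] at h7
  linarith

/-- The expression vanishes at b = y, where it is Fp - F(p(1-F) + Fp); all its ingredients are
Lipschitz, so it grows at most linearly. -/
theorem LocallyRegular.bracket_le (h : LocallyRegular F p x₁ c M L) (hy : |y| < x₁ / 4) {b : ℝ}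
    (hb : b ∈ Set.Icc y (y + x₁ / 4)) :
    |F (2 * y - b) * p b - F y * (p (2 * y - b) * (1 - F b) + F (2 * y - b) * p b)| ≤
      (2 * L + 2 * M ^ 2) * (b - y) := by
  have hb' := abs_lt hy hb
  have hy' : |y| < x₁ := hy.trans (by linarith [h.radius_pos])
  obtain ⟨h1l, h1⟩ := h.sub_bounds (by linarith [hb.1] : 2 * y - b ≤ y) hb'.2 hy'
  obtain ⟨h2l, h2⟩ := h.sub_bounds hb.1 hy' hb'.1
  have hby : 0 ≤ b - y := by linarith [hb.1]
  have hcb : 0 ≤ c * (b - y) := mul_nonneg h.lower_pos.le hby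
  set A := F y - F (2 * y - b) with hA
  set B := F b - F y with hB
  have hA0 : 0 ≤ A := by linarith
  have hB0 : 0 ≤ B := by linarith
  have hA1 : A ≤ M * (b - y) := by linarith
  have e : F (2 * y - b) * p b - F y * (p (2 * y - b) * (1 - F b) + F (2 * y - b) * p b) =
      F y * (1 - F y) * (p b - p (2 * y - b)) - A * (1 - F y) * p b
        + B * F y * p (2 * y - b) := by
    rw [hA, hB]; ring
  have hL := h.lipschitz b (2 * y - b) hb'.1 hb'.2
  rw [show b - (2 * y - b) = 2 * (b - y) by ring, abs_of_nonneg (by linarith : 0 ≤ 2 * (b - y))]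
    at hL
  have hF0 := h.nonneg y
  have hF1 := h.le_one y
  have hp1 := h.upper b hb'.1
  have hp2 := h.upper _ hb'.2
  have hp1' := h.lower_pos.le.trans (h.lower b hb'.1)
  have hp2' := h.lower_pos.le.trans (h.lower _ hb'.2)
  have t1 : |F y * (1 - F y) * (p b - p (2 * y - b))| ≤ 2 * L * (b - y) := by
    rw [abs_mul, abs_of_nonneg (mul_nonneg hF0 (by linarith))]
    have : F y * (1 - F y) ≤ 1 := by nlinarith
    calc F y * (1 - F y) * |p b - p (2 * y - b)| ≤ 1 * (L * (2 * (b - y))) :=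
          mul_le_mul this hL (abs_nonneg _) zero_le_one
      _ = _ := by ring
  have hM : 0 ≤ M := hp1'.trans hp1
  have aux : ∀ {a f q : ℝ}, 0 ≤ a → a ≤ M * (b - y) → 0 ≤ f → f ≤ 1 → 0 ≤ q → q ≤ M →
      |a * f * q| ≤ M ^ 2 * (b - y) := by
    intro a f q ha ha' hf hf' hq hq'
    rw [abs_of_nonneg (by positivity)]
    calc a * f * q ≤ (M * (b - y)) * 1 * M := by gcongr
      _ = _ := by ring
  have t2 := aux hA0 hA1 (by linarith : 0 ≤ 1 - F y) (by linarith) hp1' hp1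
  have t3 := aux hB0 h2 hF0 hF1 hp2' hp2
  rw [e]
  calc _ ≤ |F y * (1 - F y) * (p b - p (2 * y - b))| + |A * (1 - F y) * p b|
        + |B * F y * p (2 * y - b)| := by
        refine (abs_add_le _ _).trans ?_
        gcongr
        exact abs_sub _ _
    _ ≤ _ := by linarith

theorem LocallyRegular.continuousOn (h : LocallyRegular F p x₁ c M L) (hy : |y| < x₁ / 4) :
    ContinuousOn F (Set.Icc y (y + x₁ / 4)) ∧ ContinuousOn p (Set.Icc y (y + x₁ / 4)) ∧
    ContinuousOn (fun b => F (2 * y - b)) (Set.Icc y (y + x₁ / 4)) ∧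
    ContinuousOn (fun b => p (2 * y - b)) (Set.Icc y (y + x₁ / 4)) := by
  have hpc : ContinuousOn p {t | |t| < x₁} := by
    refine LipschitzOnWith.continuousOn (K := ⟨L, h.lipschitz_nonneg⟩) ?_
    exact LipschitzOnWith.of_dist_le_mul fun a ha b hb => h.lipschitz a b ha hb
  have hFc : ContinuousOn F {t | |t| < x₁} := fun t ht =>
    (h.hasDerivAt t ht).continuousAt.continuousWithinAt
  have h1 : Set.MapsTo (fun b : ℝ => b) (Set.Icc y (y + x₁ / 4)) {t | |t| < x₁} :=
    fun b hb => (abs_lt hy hb).1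
  have h2 : Set.MapsTo (fun b : ℝ => 2 * y - b) (Set.Icc y (y + x₁ / 4)) {t | |t| < x₁} :=
    fun b hb => (abs_lt hy hb).2
  have h3 : ContinuousOn (fun b : ℝ => 2 * y - b) (Set.Icc y (y + x₁ / 4)) := by fun_prop
  exact ⟨hFc.mono h1, hpc.mono h1, hFc.comp h3 h2, hpc.comp h3 h2⟩

theorem LocallyRegular.pow_le (h : LocallyRegular F p x₁ c M L) (hy : |y| < x₁ / 4) {b : ℝ}
    (hb : b ∈ Set.Icc y (y + x₁ / 4)) (k : ℕ) :
    (F (2 * y - b) * (1 - F b)) ^ k ≤ (1 / 4) ^ k * Real.exp (-(4 * c * k * (b - y))) := by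
  refine (pow_le_pow_left₀ (mul_nonneg (h.nonneg _) (by linarith [h.le_one b]))
    (h.mul_le_exp hy hb) k).trans (le_of_eq ?_)
  rw [mul_pow, ← Real.exp_nat_mul]
  congr 2
  ring

theorem LocallyRegular.pow_endpoint_le (h : LocallyRegular F p x₁ c M L) (hy : |y| < x₁ / 4)
    {k : ℕ} (hk : 1 ≤ k) :
    (F (2 * y - (y + x₁ / 4)) * (1 - F (y + x₁ / 4))) ^ k ≤ 1 / (c * x₁) / (4 ^ k * k) := by
  have hx := h.radius_pos
  have hc := h.lower_pos
  have hk' : (0 : ℝ) < k := by exact_mod_cast hk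
  refine (h.pow_le hy (Set.right_mem_Icc.2 (by linarith)) k).trans ?_
  have e : 4 * c * k * (y + x₁ / 4 - y) = c * x₁ * k := by ring
  have h1 : Real.exp (-(c * x₁ * k)) ≤ 1 / (c * x₁ * k) := by
    rw [Real.exp_neg, ← one_div]
    exact one_div_le_one_div_of_le (by positivity)
      (by linarith [Real.add_one_le_exp (c * x₁ * k)])
  rw [e]
  calc (1 / 4 : ℝ) ^ k * Real.exp (-(c * x₁ * k)) ≤ (1 / 4) ^ k * (1 / (c * x₁ * k)) := by gcongr
    _ = _ := by rw [one_div_pow]; field_simp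

/-- The subtracted difference of powers is the integral of minus the derivative of
(F(2y-b)(1-F(b)))^{m+1}. The two integrands then differ by the bracket of `bracket_le`, of size b -
y, against a weight m 4^{-m} e^{-4cm(b-y)}: a gain of order 1/m over 4^{-m}. -/
theorem LocallyRegular.integral_approx (h : LocallyRegular F p x₁ c M L) (hy : |y| < x₁ / 4)
    {m : ℕ} (hm : 1 ≤ m) :
    |(∫ b in y..(y + x₁ / 4), (m + 1) * (F (2 * y - b) * (1 - F b)) ^ m * (F (2 * y - b) * p b)) -
      F y * ((F y * (1 - F y)) ^ (m + 1) -
        (F (2 * y - (y + x₁ / 4)) * (1 - F (y + x₁ / 4))) ^ (m + 1))| ≤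
      (2 * L + 2 * M ^ 2) / c ^ 2 / (4 ^ (m + 1) * (m + 1)) := by
  have hx := h.radius_pos
  have hc := h.lower_pos
  have hm' : (1 : ℝ) ≤ m := by exact_mod_cast hm
  have hle : y ≤ y + x₁ / 4 := by linarith
  obtain ⟨c1, c2, c3, c4⟩ := h.continuousOn hy
  rw [← Set.uIcc_of_le hle] at c1 c2 c3 c4
  set Ψ : ℝ → ℝ := fun b => (F (2 * y - b) * (1 - F b)) ^ (m + 1) with hΨ
  set Ψ' : ℝ → ℝ := fun b => (m + 1) * (F (2 * y - b) * (1 - F b)) ^ m *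
    -(p (2 * y - b) * (1 - F b) + F (2 * y - b) * p b) with hΨ'
  have hd : ∀ b ∈ Set.uIcc y (y + x₁ / 4), HasDerivAt Ψ (Ψ' b) b := by
    intro b hb
    rw [Set.uIcc_of_le hle] at hb
    obtain ⟨hb1, hb2⟩ := abs_lt hy hb
    have d1 : HasDerivAt (fun b => F (2 * y - b)) (-p (2 * y - b)) b := by
      have := (h.hasDerivAt _ hb2).comp b ((hasDerivAt_id b).const_sub (2 * y))
      exact this.congr_deriv (by simp)
    have d2 : HasDerivAt (fun b => 1 - F b) (-p b) b := (h.hasDerivAt _ hb1).const_sub 1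
    refine ((d1.mul d2).pow (m + 1)).congr_deriv ?_
    simp only [hΨ', Pi.mul_apply, Nat.add_sub_cancel]
    push_cast
    ring
  have c6 : ContinuousOn (fun b => 1 - F b) (Set.uIcc y (y + x₁ / 4)) := continuousOn_const.sub c1
  have c7 : ContinuousOn (fun b => ((m : ℝ) + 1) * (F (2 * y - b) * (1 - F b)) ^ m)
      (Set.uIcc y (y + x₁ / 4)) := continuousOn_const.mul ((c3.mul c6).pow m)
  have cΨ' : ContinuousOn Ψ' (Set.uIcc y (y + x₁ / 4)) :=
    c7.mul ((c4.mul c6).add (c3.mul c2)).neg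
  have ftc := intervalIntegral.integral_eq_sub_of_hasDerivAt hd cΨ'.intervalIntegrable
  have e1 : (F y * (1 - F y)) ^ (m + 1) -
        (F (2 * y - (y + x₁ / 4)) * (1 - F (y + x₁ / 4))) ^ (m + 1) =
      -∫ b in y..(y + x₁ / 4), Ψ' b := by
    rw [ftc]
    simp only [hΨ, show 2 * y - y = y by ring]
    ring
  have c5 : ContinuousOn (fun b => (m + 1) * (F (2 * y - b) * (1 - F b)) ^ m *
      (F (2 * y - b) * p b)) (Set.uIcc y (y + x₁ / 4)) := c7.mul (c3.mul c2)
  rw [e1, mul_neg, sub_neg_eq_add, ← intervalIntegral.integral_const_mul,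
    ← intervalIntegral.integral_add c5.intervalIntegrable (cΨ'.intervalIntegrable.const_mul _)]
  set D := 2 * L + 2 * M ^ 2 with hD
  have hD0 : 0 ≤ D := by
    have := h.lipschitz_nonneg
    positivity
  have hbd := intervalIntegral.norm_integral_le_of_norm_le (μ := volume) hle
    (f := fun b => (m + 1) * (F (2 * y - b) * (1 - F b)) ^ m * (F (2 * y - b) * p b)
      + F y * Ψ' b)
    (g := fun b => (m + 1) * (1 / 4) ^ m * D *
      ((b - y) * Real.exp (-(4 * c * m * (b - y)))))
    (Eventually.of_forall fun b hb => by
      have hb' := Set.Ioc_subset_Icc_self hb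
      have e2 : (m + 1) * (F (2 * y - b) * (1 - F b)) ^ m * (F (2 * y - b) * p b) + F y * Ψ' b =
        (m + 1) * (F (2 * y - b) * (1 - F b)) ^ m *
          (F (2 * y - b) * p b - F y * (p (2 * y - b) * (1 - F b) + F (2 * y - b) * p b)) := by
        simp only [hΨ']; ring
      have hq : 0 ≤ (F (2 * y - b) * (1 - F b)) ^ m :=
        pow_nonneg (mul_nonneg (h.nonneg _) (by linarith [h.le_one b])) m
      rw [Real.norm_eq_abs, e2, abs_mul, abs_of_nonneg (by positivity)]
      calc _ ≤ (m + 1) * ((1 / 4) ^ m * Real.exp (-(4 * c * m * (b - y)))) * (D * (b - y)) := by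
            refine mul_le_mul (mul_le_mul_of_nonneg_left (h.pow_le hy hb' m) (by positivity))
              (h.bracket_le hy hb') (abs_nonneg _) (by positivity)
        _ = _ := by ring)
    (Continuous.intervalIntegrable (by fun_prop) _ _)
  rw [Real.norm_eq_abs] at hbd
  refine hbd.trans ?_
  rw [intervalIntegral.integral_const_mul]
  have hexp := integral_mul_exp_neg_le (c := 4 * c * m) (by positivity) y
    (by linarith : 0 ≤ x₁ / 4)
  calc _ ≤ (m + 1) * (1 / 4) ^ m * D * (1 / (4 * c * m) ^ 2) :=
        mul_le_mul_of_nonneg_left hexp (by positivity)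
    _ = (D / c ^ 2 / 4 ^ (m + 1)) * ((m + 1) / (4 * (m : ℝ) ^ 2)) := by
        rw [one_div_pow]; field_simp; ring
    _ ≤ (D / c ^ 2 / 4 ^ (m + 1)) * (1 / (m + 1)) := by
        refine mul_le_mul_of_nonneg_left ?_ (by positivity)
        rw [div_le_div_iff₀ (by positivity) (by positivity)]
        nlinarith
    _ = _ := by field_simp

end

/-- A Wallis-type bound; the induction step is (2k+1)(2k+3) ≤ (2k+2)². -/
theorem mul_centralBinom_sq_le (k : ℕ) : (2 * k + 1) * (k.centralBinom : ℝ) ^ 2 ≤ 16 ^ k := by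
  induction k with
  | zero => simp
  | succ k ih =>
    have h1 : ((k : ℝ) + 1) * (k + 1).centralBinom = 2 * (2 * k + 1) * k.centralBinom := by
      exact_mod_cast Nat.succ_mul_centralBinom_succ k
    have h2 : ((k : ℝ) + 1) ^ 2 * ((2 * ((k + 1 : ℕ) : ℝ) + 1) * ((k + 1).centralBinom : ℝ) ^ 2) ≤
        ((k : ℝ) + 1) ^ 2 * 16 ^ (k + 1) := by
      calc _ = (2 * k + 3) * (((k : ℝ) + 1) * (k + 1).centralBinom) ^ 2 := by push_cast; ring
        _ = (2 * k + 3) * (4 * (2 * k + 1)) * ((2 * k + 1) * (k.centralBinom : ℝ) ^ 2) := by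
          rw [h1]; ring
        _ ≤ (16 * ((k : ℝ) + 1) ^ 2) * 16 ^ k :=
          mul_le_mul (by nlinarith) ih (by positivity) (by positivity)
        _ = _ := by ring
    exact le_of_mul_le_mul_left h2 (by positivity)

theorem centralBinom_le (k : ℕ) (hk : 1 ≤ k) :
    (k.centralBinom : ℝ) ≤ 4 ^ k * (k : ℝ) ^ (-(1 / 2) : ℝ) := by
  have hk' : (0 : ℝ) < k := by exact_mod_cast hk
  refine le_of_sq_le_sq ?_ (by positivity)
  rw [mul_pow, ← Real.rpow_natCast ((k : ℝ) ^ (-(1 / 2) : ℝ)) 2, ← Real.rpow_mul hk'.le, ← pow_mul,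
    mul_comm k 2, pow_mul]
  norm_num [Real.rpow_neg_one]
  rw [le_mul_inv_iff₀ hk']
  have := mul_centralBinom_sq_le k
  nlinarith [sq_nonneg (k.centralBinom : ℝ)]

/-- On an interval where the tail of `ν` is differentiable, `ν` has the corresponding density. -/
theorem restrict_Ioc_eq_withDensity {ν : Measure ℝ} [IsFiniteMeasure ν] {H q : ℝ → ℝ} {y c : ℝ}
    (hH : ∀ b ∈ Set.Icc y c, ν.real (Set.Ioi b) = H b)
    (hd : ∀ b ∈ Set.Icc y c, HasDerivAt H (-q b) b) (hq0 : ∀ b ∈ Set.Icc y c, 0 ≤ q b)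
    (hqc : ContinuousOn q (Set.Icc y c)) :
    ν.restrict (Set.Ioc y c) =
      (volume.restrict (Set.Ioc y c)).withDensity (fun b => ENNReal.ofReal (q b)) := by
  refine Measure.ext_of_Iic _ _ fun a => ?_
  rw [withDensity_apply _ measurableSet_Iic, Measure.restrict_apply measurableSet_Iic,
    Measure.restrict_restrict measurableSet_Iic, Set.inter_comm, Set.Ioc_inter_Iic]
  set d := c ⊓ a
  rcases le_or_gt d y with hdy | hyd
  · rw [Set.Ioc_eq_empty (not_lt.2 hdy)]; simp
  have hsub : Set.Icc y d ⊆ Set.Icc y c := Set.Icc_subset_Icc_right inf_le_left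
  have hqi : IntegrableOn q (Set.Ioc y d) :=
    ((hqc.mono hsub).integrableOn_Icc).mono_set Set.Ioc_subset_Icc_self
  rw [← ofReal_integral_eq_lintegral_ofReal hqi ((ae_restrict_iff' measurableSet_Ioc).2
    (Eventually.of_forall fun b hb => hq0 b (hsub (Set.Ioc_subset_Icc_self hb)))),
    ← intervalIntegral.integral_of_le hyd.le]
  have hftc : ∫ b in y..d, -q b = H d - H y := by
    refine intervalIntegral.integral_eq_sub_of_hasDerivAt (fun b hb => ?_) ?_
    · rw [Set.uIcc_of_le hyd.le] at hb
      exact hd b (hsub hb)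
    · refine ContinuousOn.intervalIntegrable ?_
      rw [Set.uIcc_of_le hyd.le]
      exact (hqc.mono hsub).neg
  rw [intervalIntegral.integral_neg] at hftc
  have hset : Set.Ioc y d = Set.Ioi y \ Set.Ioi d := by
    ext b; simp [Set.mem_Ioc]
  have hreal : ν.real (Set.Ioc y d) = ∫ b in y..d, q b := by
    rw [hset, measureReal_sdiff (Set.Ioi_subset_Ioi hyd.le) measurableSet_Ioi,
      hH y (hsub (Set.left_mem_Icc.2 hyd.le)), hH d (hsub (Set.right_mem_Icc.2 hyd.le))]
    linarith
  rw [← hreal, ofReal_measureReal]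

section
variable {Ω : Type*} [MeasurableSpace Ω] {Y : ℕ → Ω → ℝ}

theorem measurable_inf' {ι : Type*} {T : Finset ι} (hT : T.Nonempty) {f : ι → Ω → ℝ}
    (hf : ∀ i, Measurable (f i)) : Measurable fun ω => T.inf' hT (fun i => f i ω) := by
  refine measurable_of_Ioi fun a => ?_
  have : (fun ω => T.inf' hT (fun i => f i ω)) ⁻¹' Set.Ioi a = ⋂ i ∈ T, f i ⁻¹' Set.Ioi a := by
    ext ω; simp [Finset.lt_inf'_iff]
  rw [this]
  exact T.measurableSet_biInter fun i _ => hf i measurableSet_Ioi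

theorem measurable_sup' {ι : Type*} {T : Finset ι} (hT : T.Nonempty) {f : ι → Ω → ℝ}
    (hf : ∀ i, Measurable (f i)) : Measurable fun ω => T.sup' hT (fun i => f i ω) := by
  refine measurable_of_Iic fun a => ?_
  have : (fun ω => T.sup' hT (fun i => f i ω)) ⁻¹' Set.Iic a = ⋂ i ∈ T, f i ⁻¹' Set.Iic a := by
    ext ω; simp [Finset.sup'_le_iff]
  rw [this]
  exact T.measurableSet_biInter fun i _ => hf i measurableSet_Iic

variable {P : Measure Ω} {μ : Measure ℝ}

theorem indepFun_sup'_inf' (hY : ∀ i, Measurable (Y i)) (hind : iIndepFun Y P) {S T : Finset ℕ}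
    (hS : S.Nonempty) (hT : T.Nonempty) (hST : Disjoint S T) :
    IndepFun (fun ω => S.sup' hS (fun i => Y i ω)) (fun ω => T.inf' hT (fun i => Y i ω)) P := by
  have h := (hind.indepFun_finset S T hST hY).comp
    (φ := fun x => S.attach.sup' (S.attach_nonempty_iff.2 hS) (fun i => x i))
    (ψ := fun x => T.attach.inf' (T.attach_nonempty_iff.2 hT) (fun i => x i))
    (measurable_sup' _ fun i => measurable_pi_apply i)
    (measurable_inf' _ fun i => measurable_pi_apply i)
  convert h using 1
  · funext ω
    refine eq_of_forall_ge_iff fun a => ?_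
    simp [Finset.sup'_le_iff]
  · funext ω
    refine eq_of_forall_le_iff fun a => ?_
    simp [Finset.le_inf'_iff]

theorem prob_sup'_le (hY : ∀ i, Measurable (Y i)) (hlaw : ∀ i, P.map (Y i) = μ)
    (hind : iIndepFun Y P) {S : Finset ℕ} (hS : S.Nonempty) (a : ℝ) :
    (P.map fun ω => S.sup' hS (fun i => Y i ω)).real (Set.Iic a) =
      μ.real (Set.Iic a) ^ S.card := by
  rw [map_measureReal_apply (measurable_sup' hS hY) measurableSet_Iic]
  have : (fun ω => S.sup' hS (fun i => Y i ω)) ⁻¹' Set.Iic a = ⋂ i ∈ S, Y i ⁻¹' Set.Iic a := by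
    ext ω; simp [Finset.sup'_le_iff]
  rw [this, Measure.real, hind.measure_inter_preimage_eq_mul S (fun i _ => measurableSet_Iic),
    ENNReal.toReal_prod, ← Finset.prod_const]
  refine Finset.prod_congr rfl fun i _ => ?_
  rw [← Measure.map_apply (hY i) measurableSet_Iic, hlaw i, Measure.real]

variable [IsProbabilityMeasure μ]

theorem prob_lt_inf' (hY : ∀ i, Measurable (Y i)) (hlaw : ∀ i, P.map (Y i) = μ)
    (hind : iIndepFun Y P) {T : Finset ℕ} (hT : T.Nonempty) (a : ℝ) :
    (P.map fun ω => T.inf' hT (fun i => Y i ω)).real (Set.Ioi a) =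
      (1 - μ.real (Set.Iic a)) ^ T.card := by
  rw [map_measureReal_apply (measurable_inf' hT hY) measurableSet_Ioi]
  have : (fun ω => T.inf' hT (fun i => Y i ω)) ⁻¹' Set.Ioi a = ⋂ i ∈ T, Y i ⁻¹' Set.Ioi a := by
    ext ω; simp [Finset.lt_inf'_iff]
  rw [this, Measure.real, hind.measure_inter_preimage_eq_mul T (fun i _ => measurableSet_Ioi),
    ENNReal.toReal_prod, ← Finset.prod_const]
  refine Finset.prod_congr rfl fun i _ => ?_
  rw [← Measure.map_apply (hY i) measurableSet_Ioi, hlaw i,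
    ← probReal_compl_eq_one_sub measurableSet_Iic, Set.compl_Iic, Measure.real]

variable [IsProbabilityMeasure P]

/-- With A the largest observation in S and B the smallest outside, the event is B > y and A ≤ 2y -
B, which already forces A ≤ y. As A and B are independent, one conditions on B, whose law is ν. -/
theorem prob_belowSet_inter_sampleMedian (hY : ∀ i, Measurable (Y i))
    (hlaw : ∀ i, P.map (Y i) = μ) (hind : iIndepFun Y P) {k : ℕ} (hk : 1 ≤ k) (y : ℝ)
    {S : Finset ℕ} (hS : S ⊆ Finset.range (2 * k)) (hSc : S.card = k) :
    ∃ ν : Measure ℝ, IsProbabilityMeasure ν ∧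
      (∀ b, ν.real (Set.Ioi b) = (1 - μ.real (Set.Iic b)) ^ k) ∧
      P.real (belowSet Y (2 * k) y S ∩ {ω | sampleMedian (fun i => Y i ω) (2 * k) ≤ y}) =
        ∫ b in Set.Ioi y, μ.real (Set.Iic (2 * y - b)) ^ k ∂ν := by
  set T := Finset.range (2 * k) \ S with hT
  have hTc : T.card = k := by
    rw [hT, Finset.card_sdiff_of_subset hS, Finset.card_range, hSc]; omega
  have hS0 : S.Nonempty := Finset.card_pos.1 (by omega)
  have hT0 : T.Nonempty := Finset.card_pos.1 (by omega)
  set A : Ω → ℝ := fun ω => S.sup' hS0 (fun i => Y i ω) with hA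
  set B : Ω → ℝ := fun ω => T.inf' hT0 (fun i => Y i ω) with hB
  have hAm : Measurable A := measurable_sup' hS0 hY
  have hBm : Measurable B := measurable_inf' hT0 hY
  have : IsProbabilityMeasure (P.map A) := Measure.isProbabilityMeasure_map hAm.aemeasurable
  have : IsProbabilityMeasure (P.map B) := Measure.isProbabilityMeasure_map hBm.aemeasurable
  refine ⟨P.map B, this, fun b => ?_, ?_⟩
  · rw [prob_lt_inf' hY hlaw hind hT0, hTc]
  set E : Set (ℝ × ℝ) := {z | y < z.2 ∧ z.1 ≤ 2 * y - z.2} with hE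
  have hEm : MeasurableSet E :=
    (measurableSet_lt measurable_const measurable_snd).inter
      (measurableSet_le measurable_fst (measurable_const.sub measurable_snd))
  have hset : belowSet Y (2 * k) y S ∩ {ω | sampleMedian (fun i => Y i ω) (2 * k) ≤ y} =
      (fun ω => (A ω, B ω)) ⁻¹' E := by
    ext ω
    have hmem : ω ∈ belowSet Y (2 * k) y S ↔ A ω ≤ y ∧ y < B ω := by
      rw [belowSet_eq _ _ hS, hA, hB]
      simp only [Set.mem_iInter, Set.mem_preimage, Finset.sup'_le_iff, Finset.lt_inf'_iff]
      constructor
      · intro h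
        refine ⟨fun i hi => ?_, fun i hi => ?_⟩
        · have := h i (hS hi)
          rwa [if_pos hi] at this
        · have := h i (Finset.mem_sdiff.1 hi).1
          rwa [if_neg (Finset.mem_sdiff.1 hi).2] at this
      · rintro ⟨h1, h2⟩ i hi
        split_ifs with hiS
        · exact h1 i hiS
        · exact h2 i (Finset.mem_sdiff.2 ⟨hi, hiS⟩)
    have hmed : A ω ≤ y → y < B ω →
        sampleMedian (fun i => Y i ω) (2 * k) = (A ω + B ω) / 2 := by
      intro h1 h2
      exact sampleMedian_even_eq hk hS hSc hS0 hT0 ((Finset.sup'_le_iff _ _).1 h1)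
        ((Finset.lt_inf'_iff _).1 h2)
    simp only [Set.mem_inter_iff, hmem, Set.mem_preimage, hE, Set.mem_ofPred_eq]
    constructor
    · rintro ⟨⟨h1, h2⟩, h3⟩
      rw [hmed h1 h2] at h3
      exact ⟨h2, by linarith⟩
    · rintro ⟨h2, h3⟩
      have h1 : A ω ≤ y := by linarith
      refine ⟨⟨h1, h2⟩, ?_⟩
      rw [hmed h1 h2]; linarith
  have hindep := (indepFun_iff_map_prod_eq_prod_map_map hAm.aemeasurable hBm.aemeasurable).1
    (indepFun_sup'_inf' hY hind hS0 hT0 (Finset.disjoint_sdiff))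
  rw [hset, ← map_measureReal_apply (hAm.prodMk hBm) hEm, hindep, Measure.real,
    Measure.prod_apply_symm hEm, ← integral_toReal (measurable_measure_prodMk_right hEm).aemeasurable
      (Eventually.of_forall fun b => measure_lt_top _ _),
    ← integral_indicator measurableSet_Ioi]
  refine integral_congr_ae (Eventually.of_forall fun b => ?_)
  have hsec : (fun a => (a, b)) ⁻¹' E = if y < b then Set.Iic (2 * y - b) else ∅ := by
    ext a
    split_ifs with hb <;> simp [hE, hb]
  simp only [hsec, Set.indicator_apply, Set.mem_Ioi]
  split_ifs with hb
  · rw [← hSc]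
    exact prob_sup'_le hY hlaw hind hS0 _
  · simp

end

section
variable {μ : Measure ℝ} [IsProbabilityMeasure μ] {p : ℝ → ℝ} {x₁ c M L : ℝ}

/-- Near y the law ν has density k(1-F)^{k-1}p, so the integral is that of `integral_approx`; the
part beyond y + x₁/4 is exponentially small relative to 4^{-k}. -/
theorem LocallyRegular.crossing_integral_approx
    (h : LocallyRegular (fun t => μ.real (Set.Iic t)) p x₁ c M L) {k : ℕ} (hk : 2 ≤ k) {y : ℝ}
    (hy : |y| < x₁ / 4) {ν : Measure ℝ} [IsProbabilityMeasure ν]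
    (hν : ∀ b, ν.real (Set.Ioi b) = (1 - μ.real (Set.Iic b)) ^ k) :
    |(∫ b in Set.Ioi y, μ.real (Set.Iic (2 * y - b)) ^ k ∂ν) -
      μ.real (Set.Iic y) ^ (k + 1) * (1 - μ.real (Set.Iic y)) ^ k| ≤
      ((2 * L + 2 * M ^ 2) / c ^ 2 + 1 / (c * x₁)) / (4 ^ k * k) := by
  obtain ⟨m, rfl⟩ : ∃ m, k = m + 1 := ⟨k - 1, by omega⟩
  have hx := h.radius_pos
  set F : ℝ → ℝ := fun t => μ.real (Set.Iic t) with hF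
  have hFm : Measurable F :=
    Monotone.measurable fun a b hab => measureReal_mono (Set.Iic_subset_Iic.2 hab)
  have hle : y ≤ y + x₁ / 4 := by linarith
  set f : ℝ → ℝ := fun b => F (2 * y - b) ^ (m + 1) with hf
  have hfm : Measurable f := (hFm.comp (measurable_const.sub measurable_id)).pow_const _
  have hf0 : ∀ b, 0 ≤ f b := fun b => pow_nonneg (h.nonneg _) _
  have hfi : Integrable f ν := by
    refine Integrable.of_bound hfm.aestronglyMeasurable 1 (Eventually.of_forall fun b => ?_)
    rw [Real.norm_eq_abs, abs_of_nonneg (hf0 b)]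
    exact pow_le_one₀ (h.nonneg _) (h.le_one _)
  have hsplit : ∫ b in Set.Ioi y, f b ∂ν =
      (∫ b in Set.Ioc y (y + x₁ / 4), f b ∂ν) + ∫ b in Set.Ioi (y + x₁ / 4), f b ∂ν := by
    rw [← setIntegral_union (Set.Ioc_disjoint_Ioi le_rfl) measurableSet_Ioi hfi.integrableOn
      hfi.integrableOn, Set.Ioc_union_Ioi_eq_Ioi hle]
  set q : ℝ → ℝ := fun b => (m + 1) * (1 - F b) ^ m * p b with hq
  obtain ⟨c1, c2, -, -⟩ := h.continuousOn hy
  have hq0 : ∀ b ∈ Set.Icc y (y + x₁ / 4), 0 ≤ q b := fun b hb => by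
    have h1 := h.lower_pos.le.trans (h.lower b (LocallyRegular.abs_lt hy hb).1)
    have h2 : 0 ≤ 1 - F b := by linarith [h.le_one b]
    positivity
  have hqc : ContinuousOn q (Set.Icc y (y + x₁ / 4)) :=
    (continuousOn_const.mul ((continuousOn_const.sub c1).pow m)).mul c2
  have hdens := restrict_Ioc_eq_withDensity (ν := ν) (H := fun b => (1 - F b) ^ (m + 1))
    (q := q) (y := y) (c := y + x₁ / 4) (fun b _ => hν b) (fun b hb => by
      refine (((h.hasDerivAt b (LocallyRegular.abs_lt hy hb).1).const_sub 1).pow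
        (m + 1)).congr_deriv ?_
      simp only [hq, Nat.add_sub_cancel]
      push_cast
      ring) hq0 hqc
  have hmain : ∫ b in Set.Ioc y (y + x₁ / 4), f b ∂ν =
      ∫ b in y..(y + x₁ / 4), (m + 1) * (F (2 * y - b) * (1 - F b)) ^ m *
        (F (2 * y - b) * p b) := by
    have hqm : AEMeasurable (fun b => ENNReal.ofReal (q b))
        (volume.restrict (Set.Ioc y (y + x₁ / 4))) :=
      ((hqc.mono Set.Ioc_subset_Icc_self).aemeasurable measurableSet_Ioc).ennreal_ofReal
    rw [hdens, integral_withDensity_eq_integral_toReal_smul₀ hqm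
      (Eventually.of_forall fun _ => ENNReal.ofReal_lt_top), intervalIntegral.integral_of_le hle]
    refine setIntegral_congr_fun measurableSet_Ioc fun b hb => ?_
    have hb' := hq0 b (Set.Ioc_subset_Icc_self hb)
    change (ENNReal.ofReal (q b)).toReal • f b = _
    rw [ENNReal.toReal_ofReal hb', smul_eq_mul]
    simp only [hq, hf, mul_pow]
    ring
  have hrest0 : 0 ≤ ∫ b in Set.Ioi (y + x₁ / 4), f b ∂ν :=
    setIntegral_nonneg measurableSet_Ioi fun b _ => hf0 b
  have hrest1 : ∫ b in Set.Ioi (y + x₁ / 4), f b ∂ν ≤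
      (F (2 * y - (y + x₁ / 4)) * (1 - F (y + x₁ / 4))) ^ (m + 1) := by
    have h1 : ∫ b in Set.Ioi (y + x₁ / 4), f b ∂ν ≤
        ∫ _b in Set.Ioi (y + x₁ / 4), F (2 * y - (y + x₁ / 4)) ^ (m + 1) ∂ν := by
      refine setIntegral_mono_on hfi.integrableOn (integrable_const _) measurableSet_Ioi
        fun b hb => pow_le_pow_left₀ (h.nonneg _) (measureReal_mono (Set.Iic_subset_Iic.2 ?_)) _
      linarith [Set.mem_Ioi.1 hb]
    rw [setIntegral_const, hν, smul_eq_mul, mul_comm, ← mul_pow] at h1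
    exact h1
  have happ := h.integral_approx hy (m := m) (by omega)
  have hend := h.pow_endpoint_le hy (k := m + 1) (by omega)
  set R := (F (2 * y - (y + x₁ / 4)) * (1 - F (y + x₁ / 4))) ^ (m + 1)
  rw [hsplit, hmain]
  set I := ∫ b in y..(y + x₁ / 4), (m + 1) * (F (2 * y - b) * (1 - F b)) ^ m *
        (F (2 * y - b) * p b)
  set J := ∫ b in Set.Ioi (y + x₁ / 4), f b ∂ν
  have hR0 : 0 ≤ R := hrest0.trans hrest1
  have hFy0 := h.nonneg y
  have hFy1 := h.le_one y
  have hvR : 0 ≤ F y * R ∧ F y * R ≤ R :=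
    ⟨mul_nonneg hFy0 hR0, mul_le_of_le_one_left hR0 hFy1⟩
  -- The far part J and the boundary term F(y)R both lie in [0, R], so their difference costs R
  -- once.
  have e : I + J - F y ^ (m + 1 + 1) * (1 - F y) ^ (m + 1) =
      (I - F y * ((F y * (1 - F y)) ^ (m + 1) - R)) + (J - F y * R) := by
    rw [mul_pow]; ring
  change |I + J - F y ^ (m + 1 + 1) * (1 - F y) ^ (m + 1)| ≤ _
  rw [e]
  refine (abs_add_le _ _).trans ?_
  rw [add_div]
  push_cast at hend ⊢
  refine add_le_add happ ((abs_le.2 ⟨?_, ?_⟩ : |J - F y * R| ≤ R).trans hend) <;> linarith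

variable {Ω : Type*} [MeasurableSpace Ω] {Y : ℕ → Ω → ℝ} {P : Measure Ω} [IsProbabilityMeasure P]

theorem measurableSet_sampleMedian_le (hY : ∀ i, Measurable (Y i)) {m : ℕ} (hm : 1 ≤ m) (y : ℝ) :
    MeasurableSet {ω | sampleMedian (fun i => Y i ω) m ≤ y} :=
  measurableSet_le ((measurable_sampleMedian hm).comp (measurable_pi_lambda _ hY))
    measurable_const

theorem measurableSet_countLE (hY : ∀ i, Measurable (Y i)) (m : ℕ) (y : ℝ) (s : Set ℕ) :
    MeasurableSet {ω | countLE (fun i => Y i ω) m y ∈ s} :=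
  ((measurable_countLE m y).comp (measurable_pi_lambda _ hY)) (MeasurableSet.of_discrete (s := s))

/-- The last observation matters only when exactly k of the first 2k are at most y. This matches the
splitting in `prob_sampleMedian_even_eq_sum`, so that the common part cancels. -/
theorem prob_sampleMedian_odd_eq_sum (hY : ∀ i, Measurable (Y i)) (hlaw : ∀ i, P.map (Y i) = μ)
    (hind : iIndepFun Y P) (k : ℕ) (y : ℝ) :
    P.real {ω | sampleMedian (fun i => Y i ω) (2 * k + 1) ≤ y} =
      P.real {ω | k + 1 ≤ countLE (fun i => Y i ω) (2 * k) y} +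
      ∑ _S ∈ (Finset.range (2 * k)).powerset.filter (fun S => S.card = k),
        μ.real (Set.Iic y) ^ (k + 1) * (1 - μ.real (Set.Iic y)) ^ k := by
  have hset : {ω | sampleMedian (fun i => Y i ω) (2 * k + 1) ≤ y} =
      {ω | k + 1 ≤ countLE (fun i => Y i ω) (2 * k) y} ∪
        ({ω | countLE (fun i => Y i ω) (2 * k) y = k} ∩ {ω | Y (2 * k) ω ≤ y}) := by
    ext ω
    have : countLE (fun i => Y i ω) (2 * k + 1) y =
        countLE (fun i => Y i ω) (2 * k) y + if Y (2 * k) ω ≤ y then 1 else 0 := by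
      simp only [countLE, Finset.card_filter, Finset.sum_range_succ]
    simp only [Set.mem_ofPred_eq, sampleMedian_odd_le_iff, Set.mem_union, Set.mem_inter_iff, this]
    split_ifs with hle <;> simp only [hle, and_true, and_false, or_false] <;> omega
  have hYm : MeasurableSet {ω | Y (2 * k) ω ≤ y} := measurableSet_le (hY _) measurable_const
  rw [hset, measureReal_union, prob_inter_countLE hY (2 * k) y (fun i => i = k) _ hYm]
  · congr 1
    refine Finset.sum_congr rfl fun S hS => ?_
    rw [Finset.mem_filter, Finset.mem_powerset] at hS
    have h2k : 2 * k ∉ S := fun hmem => by simpa using hS.1 hmem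
    have hb : belowSet Y (2 * k) y S ∩ {ω | Y (2 * k) ω ≤ y} =
        belowSet Y (2 * k + 1) y (insert (2 * k) S) := by
      ext ω
      simp only [belowSet, Set.mem_inter_iff, Set.mem_ofPred_eq, Finset.range_add_one,
        Finset.filter_insert]
      split_ifs with hle
      · simp only [hle, and_true]
        constructor
        · intro h; rw [h]
        · intro h
          have := congrArg (fun U : Finset ℕ => U.erase (2 * k)) h
          simpa [Finset.erase_insert, h2k] using this
      · simp only [hle, and_false, false_iff]
        intro h
        have := h ▸ Finset.mem_insert_self (2 * k) S
        simp at this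
    rw [hb, prob_belowSet hY hlaw hind, Finset.card_insert_of_notMem h2k, hS.2]
    · congr 2; omega
    · rw [Finset.range_add_one]
      exact Finset.insert_subset_insert _ hS.1
  · rw [Set.disjoint_left]
    rintro ω h1 ⟨h2, -⟩
    simp only [Set.mem_ofPred_eq] at h1 h2
    omega
  · exact (measurableSet_countLE hY (2 * k) y {k}).inter hYm

theorem prob_sampleMedian_even_eq_sum (hY : ∀ i, Measurable (Y i)) {k : ℕ} (hk : 1 ≤ k) (y : ℝ) :
    P.real {ω | sampleMedian (fun i => Y i ω) (2 * k) ≤ y} =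
      P.real {ω | k + 1 ≤ countLE (fun i => Y i ω) (2 * k) y} +
      ∑ S ∈ (Finset.range (2 * k)).powerset.filter (fun S => S.card = k),
        P.real (belowSet Y (2 * k) y S ∩ {ω | sampleMedian (fun i => Y i ω) (2 * k) ≤ y}) := by
  have hm := measurableSet_sampleMedian_le hY (by omega : 1 ≤ 2 * k) y
  rw [← prob_inter_countLE hY (2 * k) y (fun i => i = k) _ hm, ← measureReal_union]
  · congr 1
    ext ω
    simp only [Set.mem_ofPred_eq, Set.mem_union, Set.mem_inter_iff]
    constructor
    · intro h
      rcases lt_trichotomy (countLE (fun i => Y i ω) (2 * k) y) k with h1 | h1 | h1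
      · exact absurd (lt_sampleMedian_even hk h1) (not_lt.2 h)
      · exact Or.inr ⟨h1, h⟩
      · exact Or.inl h1
    · rintro (h | h)
      · exact sampleMedian_even_le hk h
      · exact h.2
  · rw [Set.disjoint_left]
    rintro ω h1 ⟨h2, -⟩
    simp only [Set.mem_ofPred_eq] at h1 h2
    omega
  · exact (measurableSet_countLE hY (2 * k) y {k}).inter hm

/-- Each index set S of size k contributes an error of order 4^{-k}/k, and there are at most 4^k
k^{-1/2} of them. -/
theorem LocallyRegular.abs_prob_even_sub_odd_le
    (h : LocallyRegular (fun t => μ.real (Set.Iic t)) p x₁ c M L) :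
    ∃ C, 0 ≤ C ∧ ∀ (Y : ℕ → Ω → ℝ), (∀ i, Measurable (Y i)) → (∀ i, P.map (Y i) = μ) →
      iIndepFun Y P → ∀ k : ℕ, 1 ≤ k → ∀ y, |y| < x₁ / 4 →
      |P.real {ω | sampleMedian (fun i => Y i ω) (2 * k) ≤ y} -
        P.real {ω | sampleMedian (fun i => Y i ω) (2 * k + 1) ≤ y}| ≤
          C * (k : ℝ) ^ (-(3 / 2) : ℝ) := by
  set D := (2 * L + 2 * M ^ 2) / c ^ 2 + 1 / (c * x₁) with hD
  have hD0 : 0 ≤ D := by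
    have := h.lipschitz_nonneg
    have := h.lower_pos
    have := h.radius_pos
    positivity
  refine ⟨max D 1, le_max_of_le_left hD0, fun Y hY hlaw hind k hk y hy => ?_⟩
  -- For k = 1 the weight with exponent k - 1 has no decay; probabilities differ by at most 1,
  -- whence `max D 1`.
  rcases hk.eq_or_lt with rfl | hk2
  · simp only [Nat.cast_one, Real.one_rpow, mul_one]
    refine le_trans ?_ (le_max_right _ _)
    rw [abs_le]
    constructor <;>
    linarith [measureReal_nonneg (μ := P) (s := {ω | sampleMedian (fun i => Y i ω) (2 * 1) ≤ y}),
      measureReal_nonneg (μ := P) (s := {ω | sampleMedian (fun i => Y i ω) (2 * 1 + 1) ≤ y}),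
      measureReal_le_one (μ := P) (s := {ω | sampleMedian (fun i => Y i ω) (2 * 1) ≤ y}),
      measureReal_le_one (μ := P) (s := {ω | sampleMedian (fun i => Y i ω) (2 * 1 + 1) ≤ y})]
  have hk' : (0 : ℝ) < k := by exact_mod_cast (by omega : 0 < k)
  rw [prob_sampleMedian_even_eq_sum hY hk y, prob_sampleMedian_odd_eq_sum hY hlaw hind k y,
    add_sub_add_left_eq_sub, ← Finset.sum_sub_distrib]
  refine (Finset.abs_sum_le_sum_abs _ _).trans ?_
  refine (Finset.sum_le_card_nsmul _ _ (D / (4 ^ k * k)) fun S hS => ?_).trans ?_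
  · rw [Finset.mem_filter, Finset.mem_powerset] at hS
    obtain ⟨ν, _, hν, hS'⟩ :=
      prob_belowSet_inter_sampleMedian hY hlaw hind hk y hS.1 hS.2
    rw [hS']
    exact h.crossing_integral_approx hk2 hy hν
  · rw [← Finset.powersetCard_eq_filter, Finset.card_powersetCard, Finset.card_range,
      ← Nat.centralBinom_eq_two_mul_choose, nsmul_eq_mul]
    calc (k.centralBinom : ℝ) * (D / (4 ^ k * k))
        ≤ (4 ^ k * (k : ℝ) ^ (-(1 / 2) : ℝ)) * (D / (4 ^ k * k)) :=
          mul_le_mul_of_nonneg_right (centralBinom_le k hk) (by positivity)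
      _ = D * (k : ℝ) ^ (-(3 / 2) : ℝ) := by
          rw [show (-(3 / 2) : ℝ) = -(1 / 2) + (-1) by norm_num, Real.rpow_add hk',
            Real.rpow_neg_one]
          field_simp
      _ ≤ _ := mul_le_mul_of_nonneg_right (le_max_left _ _) (by positivity)

end

/-! ### Reduction to centred observations -/

theorem orderStat_sub_const (x : ℕ → ℝ) (θ : ℝ) {m k : ℕ} (hk : 1 ≤ k) (hkm : k ≤ m) :
    orderStat (fun i => x i - θ) m k = orderStat x m k - θ := by
  refine eq_of_forall_ge_iff fun y => ?_
  rw [orderStat_le_iff hk hkm, sub_le_iff_le_add, orderStat_le_iff hk hkm]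
  simp only [countLE, sub_le_iff_le_add]

theorem sampleMedian_sub_const (x : ℕ → ℝ) (θ : ℝ) {m : ℕ} (hm : 1 ≤ m) :
    sampleMedian (fun i => x i - θ) m = sampleMedian x m - θ := by
  unfold sampleMedian
  by_cases h : Odd m
  · rw [if_pos h, if_pos h, orderStat_sub_const x θ (by omega) (by omega)]
  · rw [if_neg h, if_neg h]
    rw [Nat.not_odd_iff_even] at h
    obtain ⟨k, rfl⟩ := h
    rw [orderStat_sub_const x θ (by omega) (by omega), orderStat_sub_const x θ (by omega) (by omega)]
    ring

section
variable {p : ℝ → ℝ}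

theorem map_sub_const_eq_withDensity {Ω : Type*} [MeasurableSpace Ω]
    {P : Measure Ω} {X : Ω → ℝ} (hX : Measurable X) {θ : ℝ}
    (hlaw : P.map X = volume.withDensity (fun t => ENNReal.ofReal (p (t - θ)))) :
    P.map (fun ω => X ω - θ) = volume.withDensity (fun t => ENNReal.ofReal (p t)) := by
  have hsub : Measurable fun t : ℝ => t - θ := measurable_id.sub_const θ
  have : P.map (fun ω => X ω - θ) = (P.map X).map (fun t => t - θ) := by
    rw [Measure.map_map hsub hX]; rfl
  rw [this, hlaw]
  ext s hs
  rw [Measure.map_apply hsub hs, withDensity_apply _ (hsub hs), withDensity_apply _ hs,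
    ← lintegral_indicator (hsub hs), ← lintegral_indicator hs,
    ← lintegral_sub_right_eq_self (s.indicator fun t => ENNReal.ofReal (p t)) θ]
  rfl

theorem integrable_of_withDensity (hp : Measurable p) (h0 : ∀ t, 0 ≤ p t)
    [IsProbabilityMeasure (volume.withDensity fun t => ENNReal.ofReal (p t))] :
    Integrable p ∧ ∫ t, p t = 1 := by
  have h1 : ∫⁻ t, ENNReal.ofReal (p t) = 1 := by
    have := measure_univ (μ := volume.withDensity fun t => ENNReal.ofReal (p t))
    rwa [withDensity_apply _ MeasurableSet.univ, Measure.restrict_univ] at this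
  have hi : Integrable p := by
    refine ⟨hp.aestronglyMeasurable, ?_⟩
    rw [hasFiniteIntegral_iff_ofReal (Eventually.of_forall h0), h1]
    exact ENNReal.one_lt_top
  refine ⟨hi, ?_⟩
  rw [integral_eq_lintegral_of_nonneg_ae (Eventually.of_forall h0) hp.aestronglyMeasurable, h1]
  rfl

theorem RegularDensity.real_Iic (hp : RegularDensity p)
    [IsProbabilityMeasure (volume.withDensity fun t => ENNReal.ofReal (p t))] (y : ℝ) :
    (volume.withDensity fun t => ENNReal.ofReal (p t)).real (Set.Iic y) = 1 / 2 + oddCDF p y := by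
  obtain ⟨hi, h1⟩ := integrable_of_withDensity hp.measurable hp.nonneg
  have e1 : (volume.withDensity fun t => ENNReal.ofReal (p t)).real (Set.Iic y) =
      ∫ t in Set.Iic y, p t := by
    rw [Measure.real, withDensity_apply _ measurableSet_Iic,
      integral_eq_lintegral_of_nonneg_ae (Eventually.of_forall hp.nonneg)
        hp.measurable.aestronglyMeasurable]
  have e2 := intervalIntegral.integral_Iic_sub_Iic (μ := volume) (f := p) (a := 0) (b := y)
    hi.integrableOn hi.integrableOn
  have e3 : ∫ t in Set.Iic (0 : ℝ), p t = ∫ t in Set.Ioi (0 : ℝ), p t := by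
    have := integral_comp_neg_Iic (0 : ℝ) p
    simpa [hp.symm] using this
  have e4 := intervalIntegral.integral_Iic_add_Ioi (b := (0 : ℝ)) hi.integrableOn hi.integrableOn
  rw [e1, oddCDF]
  linarith

theorem RegularDensity.locallyRegular (hp : RegularDensity p)
    [IsProbabilityMeasure (volume.withDensity fun t => ENNReal.ofReal (p t))] :
    ∃ x₁ c M L, LocallyRegular
      (fun t => (volume.withDensity fun t => ENNReal.ofReal (p t)).real (Set.Iic t))
      p x₁ c M L := by
  obtain ⟨hi, -⟩ := integrable_of_withDensity hp.measurable hp.nonneg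
  obtain ⟨x₁, hx₁, L, hL0, hL, hb⟩ := hp.local_lipschitz
  refine ⟨x₁, p 0 / 2, 2 * p 0, L, fun t => measureReal_nonneg, fun t => measureReal_le_one,
    fun t ht => ?_, hL, fun t ht => (hb t ht).1, fun t ht => (hb t ht).2, hx₁,
    half_pos hp.pos_zero, hL0⟩
  simp only [hp.real_Iic]
  exact (hp.hasDerivAt_oddCDF hi hL ht).const_add _

end

/-! ### Comparison of the distribution of a median with its approximation -/

/-- The bounds are uniform in z because z ≤ z(1+s), so powers of z are absorbed by the Gaussian
decay at z(1+s). -/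
theorem ncdf_dilation {z η : ℝ} (hz : 0 ≤ z) (hη : 0 ≤ η) :
    |ncdf (z * (1 + η)) - ncdf z - η * (z * npdf z)| ≤ 20 * η ^ 2 ∧
    |z * (1 + η) * npdf (z * (1 + η)) - z * npdf z| ≤ 20 * η := by
  have hZ : ∀ s : ℝ, HasDerivAt (fun s => z * (1 + s)) z s := fun s =>
    (((hasDerivAt_id s).const_add 1).const_mul z).congr_deriv (by simp)
  have h1 : ∀ s : ℝ, HasDerivAt (fun s => ncdf (z * (1 + s))) (z * npdf (z * (1 + s))) s :=
    fun s => ((ncdf_hasDerivAt _).comp s (hZ s)).congr_deriv (by ring)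
  have hp : ∀ s : ℝ, HasDerivAt (fun s => npdf (z * (1 + s)))
      (-(z * (1 + s)) * npdf (z * (1 + s)) * z) s := fun s => (npdf_hasDerivAt _).comp s (hZ s)
  have h2 : ∀ s : ℝ, HasDerivAt (fun s => z * npdf (z * (1 + s)))
      (z * (-(z * (1 + s)) * npdf (z * (1 + s)) * z)) s := fun s => (hp s).const_mul z
  have h3 : ∀ s : ℝ, HasDerivAt (fun s => z * (1 + s) * npdf (z * (1 + s)))
      (z * npdf (z * (1 + s)) + z * (1 + s) * (-(z * (1 + s)) * npdf (z * (1 + s)) * z)) s :=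
    fun s => (hZ s).mul (hp s)
  have key : ∀ s ∈ Set.uIcc 0 η, 0 ≤ z * npdf (z * (1 + s)) ∧
      z * npdf (z * (1 + s)) ≤ 6 ∧ z * ((z * (1 + s)) ^ 2 * npdf (z * (1 + s))) ≤ 20 ∧
      z * (z * (1 + s) * npdf (z * (1 + s)) * z) ≤ 20 ∧
      0 ≤ z * ((z * (1 + s)) ^ 2 * npdf (z * (1 + s))) ∧
      0 ≤ z * (z * (1 + s) * npdf (z * (1 + s)) * z) := by
    intro s hs
    rw [Set.uIcc_of_le hη] at hs
    have hs0 := hs.1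
    have hle : z ≤ z * (1 + s) := le_mul_of_one_le_right hz (by linarith)
    have hZ0 : 0 ≤ z * (1 + s) := hz.trans hle
    have hc := cubic_mul_npdf_le (z * (1 + s))
    have hφ := (npdf_pos (z * (1 + s))).le
    set Z := z * (1 + s)
    have a0 : 0 ≤ Z ^ 3 * npdf Z := by positivity
    have a1 : 0 ≤ Z * npdf Z := by positivity
    have b1 : z * npdf Z ≤ Z * npdf Z := mul_le_mul_of_nonneg_right hle hφ
    have b0 : Z * npdf Z ≤ 6 := by
      have h0 := pow_mul_npdf_le Z 0
      have h1 := pow_mul_npdf_le Z 1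
      norm_num at h0 h1
      nlinarith [mul_nonneg (sq_nonneg (Z - 1)) hφ]
    have b2 : z * (Z ^ 2 * npdf Z) ≤ Z * (Z ^ 2 * npdf Z) :=
      mul_le_mul_of_nonneg_right hle (by positivity)
    have b3 : z * (Z * npdf Z * z) ≤ Z * (Z * npdf Z * Z) := by gcongr
    refine ⟨by positivity, by linarith, ?_, ?_, by positivity, by positivity⟩ <;> nlinarith
  refine ⟨?_, ?_⟩
  · have := abs_sub_sub_le_of_hasDerivAt (a := 0) (b := η) (M := 20) (fun s _ => h1 s)
      (fun s _ => h2 s) (fun s hs => by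
        obtain ⟨-, -, -, k4, -, k6⟩ := key s hs
        rw [abs_le]; constructor <;> linarith)
    simpa [mul_comm] using this
  · have := abs_sub_le_of_hasDerivAt (a := 0) (b := η) (M := 20) (fun s _ => h3 s)
      (fun s hs => by
        obtain ⟨k1, k2, k3, -, k5, -⟩ := key s hs
        rw [abs_le]; constructor <;> linarith)
    simpa [abs_of_nonneg hη] using this

theorem abs_cubic_mul_npdf_sub_le {s t : ℝ} (hs : 0 ≤ s) (ht : 0 ≤ t) :
    |(t ^ 3 + 3 * t) * npdf t - (s ^ 3 + 3 * s) * npdf s| ≤ 11 * |t - s| := by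
  refine abs_sub_le_of_hasDerivAt (f := fun t => (t ^ 3 + 3 * t) * npdf t)
    (f' := fun t => (3 - t ^ 4) * npdf t) (fun x _ => ?_) (fun x hx => ?_)
  · refine (((hasDerivAt_pow 3 x).add ((hasDerivAt_id x).const_mul 3)).mul
      (npdf_hasDerivAt x)).congr_deriv ?_
    simp only [Pi.add_apply, id]
    push_cast
    ring
  · have hx0 : 0 ≤ x := (le_min hs ht).trans hx.1
    have h0 := pow_mul_npdf_le x 0
    have h2 := pow_mul_npdf_le x 2
    norm_num [Nat.factorial] at h0 h2
    have := (npdf_pos x).le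
    have : 0 ≤ x ^ 4 * npdf x := by positivity
    rw [abs_le]; constructor <;> nlinarith

theorem abs_ncdf_sub_le (s t : ℝ) : |ncdf t - ncdf s| ≤ |t - s| := by
  have := abs_sub_le_of_hasDerivAt (a := s) (b := t) (M := 1) (fun x _ => ncdf_hasDerivAt x)
    (fun x _ => by
      rw [abs_of_pos (npdf_pos x)]
      exact (npdf_le x).trans (Real.exp_le_one_iff.2 (by nlinarith [sq_nonneg x])))
  simpa using this

section
variable {p : ℝ → ℝ} {x₁ L : ℝ}

/-- The derivative in the dilation s is y p(ys) - F(y), the integral of p(ys) - p(t) over t in [0,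
y], hence O(Ly²) by the Lipschitz bound. -/
theorem RegularDensity.abs_oddCDF_dilation_le (hp : RegularDensity p) (hint : Integrable p)
    (hL0 : 0 ≤ L) (hL : ∀ a b, |a| < x₁ → |b| < x₁ → |p a - p b| ≤ L * |a - b|) {y l : ℝ}
    (hy : 0 ≤ y) (hl : 1 ≤ l) (hl2 : l ≤ 2) (hyx : 2 * y < x₁) :
    |oddCDF p (y * l) - oddCDF p y * l| ≤ 2 * L * y ^ 2 * (l - 1) := by
  have hab : ∀ s, 0 ≤ s → s ≤ 2 → |y * s| < x₁ := fun s hs hs2 => by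
    rw [abs_of_nonneg (by positivity)]; nlinarith
  have h1 : ∀ s ∈ Set.uIcc 1 l, HasDerivAt (fun s => oddCDF p (y * s) - oddCDF p y * s)
      (p (y * s) * y - oddCDF p y) s := by
    intro s hs
    rw [Set.uIcc_of_le hl] at hs
    have hd := hp.hasDerivAt_oddCDF hint hL (hab s (by linarith [hs.1]) (hs.2.trans hl2))
    have h2 : HasDerivAt (fun s => y * s) y s := by simpa using (hasDerivAt_id s).const_mul y
    have h3 : HasDerivAt (fun s => oddCDF p y * s) (oddCDF p y) s := by
      simpa using (hasDerivAt_id s).const_mul (oddCDF p y)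
    exact (hd.comp s h2).sub h3
  have h2 := abs_sub_le_of_hasDerivAt (M := 2 * L * y ^ 2) h1 (fun s hs => by
    rw [Set.uIcc_of_le hl] at hs
    have hs2 := hs.2.trans hl2
    have hs0 : 0 ≤ s := by linarith [hs.1]
    have h4 : ∀ t ∈ Set.uIcc 0 y, HasDerivAt (fun t => p (y * s) * t - oddCDF p t)
        (p (y * s) - p t) t := by
      intro t ht
      rw [Set.uIcc_of_le hy] at ht
      have h5 : HasDerivAt (fun t => p (y * s) * t) (p (y * s)) t := by
        simpa using (hasDerivAt_id t).const_mul (p (y * s))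
      refine h5.sub (hp.hasDerivAt_oddCDF hint hL ?_)
      rw [abs_of_nonneg ht.1]; linarith [ht.2]
    have h6 := abs_sub_le_of_hasDerivAt (M := 2 * L * y) h4 (fun t ht => by
      rw [Set.uIcc_of_le hy] at ht
      refine (hL _ _ (hab s hs0 hs2) ?_).trans ?_
      · rw [abs_of_nonneg ht.1]; linarith [ht.2]
      · have : |y * s - t| ≤ 2 * y := by
          rw [abs_le]; constructor <;> nlinarith [ht.1, ht.2]
        calc _ ≤ L * (2 * y) := mul_le_mul_of_nonneg_left this hL0
          _ = _ := by ring)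
    simp only [mul_zero, oddCDF, intervalIntegral.integral_same, sub_zero, abs_of_nonneg hy] at h6
    rw [oddCDF]
    linarith)
  simp only [mul_one, sub_self, sub_zero, abs_of_nonneg (by linarith : 0 ≤ l - 1)] at h2
  exact h2

end

/-- The smaller of G and J decides which term on the right dominates. -/
theorem one_div_mul_sqrt_le {G J : ℝ} (hG : 1 ≤ G) (hJ : 1 ≤ J) :
    1 / (G * √J) ≤ J ^ (-(3 / 2) : ℝ) + G ^ (-(3 / 2) : ℝ) := by
  have hG0 : 0 < G := by linarith
  have hJ0 : 0 < J := by linarith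
  have hpow : ∀ a : ℝ, 0 < a → a ^ (-(3 / 2) : ℝ) = 1 / (a * √a) := fun a ha => by
    rw [Real.sqrt_eq_rpow, ← Real.rpow_one_add' ha.le (by norm_num), Real.rpow_neg ha.le, one_div]
    norm_num
  have hG1 : 0 ≤ G ^ (-(3 / 2) : ℝ) := by positivity
  have hJ1 : 0 ≤ J ^ (-(3 / 2) : ℝ) := by positivity
  rcases le_total J G with h | h
  · have : 1 / (G * √J) ≤ 1 / (J * √J) :=
      one_div_le_one_div_of_le (by positivity) (mul_le_mul_of_nonneg_right h (Real.sqrt_nonneg _))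
    rw [← hpow J hJ0] at this
    linarith
  · have : 1 / (G * √J) ≤ 1 / (G * √G) :=
      one_div_le_one_div_of_le (by positivity)
        (mul_le_mul_of_nonneg_left (Real.sqrt_le_sqrt h) hG0.le)
    rw [← hpow G hG0] at this
    linarith

theorem one_div_sq_le_rpow {a : ℝ} (ha : 1 ≤ a) : 1 / a ^ 2 ≤ a ^ (-(3 / 2) : ℝ) := by
  have : 1 / a ^ 2 = a ^ (-2 : ℝ) := by
    rw [Real.rpow_neg (by linarith), one_div]; norm_num
  rw [this]
  exact Real.rpow_le_rpow_of_exponent_le ha (by norm_num)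

section
variable {p : ℝ → ℝ}

/-- Twice the square root of `G` times the centred distribution function at `y`. -/
noncomputable def scaledCDF (p : ℝ → ℝ) (G y : ℝ) : ℝ := 2 * √G * oddCDF p y

/-- The argument of the limiting distribution in terms of the scaled distribution function. -/
noncomputable def inflate (G w : ℝ) : ℝ := w * (1 + w ^ 2 / (4 * G))

/-- Passing from t to z costs 1 + 11 Lipschitz constants, and from 8K to 4J a further O(J⁻²). Since
z²/J = 4η, the term z³φ(z)/(4J) equals η zφ(z), the first-order effect of dilating z by 1 + η. -/
theorem abs_edgeworth_sub_medianApprox_le {K J t z η : ℝ} (hK1 : 1 ≤ K) (hKJ : 2 * K ≤ J)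
    (hJK : J ≤ 2 * K + 1) (ht0 : 0 ≤ t) (hz0 : 0 ≤ z) (hη0 : 0 ≤ η) (hz2 : z ^ 2 / J = 4 * η) :
    |ncdf t + (t ^ 3 + 3 * t) * npdf t / (8 * K) - medianApprox (z * (1 + η)) J| ≤
      12 * |t - z| + 8 * (1 / J ^ 2) + (20 * η ^ 2 + 15 * (η / J)) := by
  have hK0 : 0 < K := by linarith
  have hJ0 : 0 < J := by linarith
  have e2 := abs_ncdf_sub_le z t
  have e3 : |(t ^ 3 + 3 * t) * npdf t / (8 * K) - (z ^ 3 + 3 * z) * npdf z / (8 * K)| ≤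
      11 * |t - z| := by
    rw [← sub_div, abs_div, abs_of_pos (by positivity : 0 < 8 * K)]
    exact (div_le_self (abs_nonneg _) (by linarith)).trans (abs_cubic_mul_npdf_sub_le hz0 ht0)
  have e4 : |(z ^ 3 + 3 * z) * npdf z / (8 * K) - (z ^ 3 + 3 * z) * npdf z / (4 * J)| ≤
      8 * (1 / J ^ 2) := by
    have hq := cubic_mul_npdf_le z
    have hq0 : 0 ≤ (z ^ 3 + 3 * z) * npdf z := mul_nonneg (by positivity) (npdf_pos z).le
    generalize (z ^ 3 + 3 * z) * npdf z = q at *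
    have h1 : q / (8 * K) - q / (4 * J) = q * ((J - 2 * K) / (8 * K * J)) := by
      field_simp; ring
    have h2 : 0 ≤ (J - 2 * K) / (8 * K * J) := div_nonneg (by linarith) (by positivity)
    rw [h1, abs_of_nonneg (mul_nonneg hq0 h2)]
    calc q * ((J - 2 * K) / (8 * K * J)) ≤ 20 * (2 / 5 * (1 / J ^ 2)) := by
          refine mul_le_mul hq ?_ h2 (by norm_num)
          rw [mul_one_div, div_le_div_iff₀ (by positivity) (by positivity)]
          nlinarith [mul_pos hK0 hJ0, mul_pos hJ0 hJ0]
      _ = 8 * (1 / J ^ 2) := by ring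
  have e5 : |ncdf z + (z ^ 3 + 3 * z) * npdf z / (4 * J) - medianApprox (z * (1 + η)) J| ≤
      20 * η ^ 2 + 15 * (η / J) := by
    obtain ⟨d1, d2⟩ := ncdf_dilation hz0 hη0
    have h1 : ncdf z + (z ^ 3 + 3 * z) * npdf z / (4 * J) - medianApprox (z * (1 + η)) J =
        -(ncdf (z * (1 + η)) - ncdf z - η * (z * npdf z)) -
          3 / 4 / J * (z * (1 + η) * npdf (z * (1 + η)) - z * npdf z) := by
      rw [medianApprox]
      have : (z ^ 3 + 3 * z) * npdf z / (4 * J) =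
          z ^ 2 / J * (z * npdf z) / 4 + 3 / 4 / J * (z * npdf z) := by field_simp
      rw [this, hz2]
      ring
    rw [h1]
    refine (abs_sub _ _).trans (add_le_add ?_ ?_)
    · rw [abs_neg]
      exact d1
    · rw [abs_mul, abs_of_nonneg (by positivity)]
      calc _ ≤ 3 / 4 / J * (20 * η) := mul_le_mul_of_nonneg_left d2 (by positivity)
        _ = 15 * (η / J) := by ring
  have e6 : ncdf t + (t ^ 3 + 3 * t) * npdf t / (8 * K) - medianApprox (z * (1 + η)) J =
      (ncdf t - ncdf z) +
      ((t ^ 3 + 3 * t) * npdf t / (8 * K) - (z ^ 3 + 3 * z) * npdf z / (8 * K)) +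
      ((z ^ 3 + 3 * z) * npdf z / (8 * K) - (z ^ 3 + 3 * z) * npdf z / (4 * J)) +
      (ncdf z + (z ^ 3 + 3 * z) * npdf z / (4 * J) - medianApprox (z * (1 + η)) J) := by ring
  rw [e6]
  refine (abs_add_le _ _).trans (add_le_add ?_ e5)
  refine (abs_add_le _ _).trans (add_le_add ?_ e4)
  refine (abs_add_le _ _).trans ?_
  linarith

theorem sqrt_ratio_bounds {K J : ℝ} (hK1 : 1 ≤ K) (hKJ : 2 * K ≤ J) (hJK : J ≤ 2 * K + 1) :
    1 ≤ √(J / (2 * K)) ∧ √(J / (2 * K)) ≤ 2 ∧ √(J / (2 * K)) - 1 ≤ 1 / (2 * K) ∧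
      √J = √(2 * K) * √(J / (2 * K)) := by
  have hK0 : 0 < K := by linarith
  have hJ0 : 0 < J := by linarith
  have hl2 : √(J / (2 * K)) ^ 2 = J / (2 * K) := Real.sq_sqrt (by positivity)
  have hl1 : 1 ≤ √(J / (2 * K)) := by
    rw [Real.one_le_sqrt, le_div_iff₀ (by positivity)]; linarith
  have hlsub : √(J / (2 * K)) - 1 ≤ 1 / (2 * K) := by
    have h1 : √(J / (2 * K)) ^ 2 - 1 ≤ 1 / (2 * K) := by
      rw [hl2, sub_le_iff_le_add, div_add_one (by positivity), div_le_div_iff_of_pos_right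
        (by positivity)]
      linarith
    nlinarith
  have : 1 / (2 * K) ≤ 1 := by rw [div_le_one (by positivity)]; linarith
  refine ⟨hl1, by linarith, hlsub, ?_⟩
  rw [← Real.sqrt_mul (by positivity)]
  congr 1; field_simp

/-- Since √J = √(2K) √(J/(2K)), the dilation of y and the change of normalisation cancel to first
order. This is the purpose of N* in the standardisation. -/
theorem RegularDensity.abs_sqrt_mul_oddCDF_sub_le (hp : RegularDensity p) (hint : Integrable p)
    {x₁ L : ℝ} (hL0 : 0 ≤ L) (hL : ∀ a b, |a| < x₁ → |b| < x₁ → |p a - p b| ≤ L * |a - b|)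
    {K J G y B : ℝ} (hK1 : 1 ≤ K) (hKJ : 2 * K ≤ J) (hJK : J ≤ 2 * K + 1) (hG0 : 0 < G)
    (hy : 0 ≤ y) (hyx : 2 * y < x₁) (hGy : G * y ^ 2 ≤ B) :
    |2 * √(2 * K) * oddCDF p (y * √(J / (2 * K))) - 2 * √J * oddCDF p y| ≤
      8 * L * B * (1 / (G * √J)) := by
  obtain ⟨hl1, hl3, hlsub, hJl⟩ := sqrt_ratio_bounds hK1 hKJ hJK
  have h1 := hp.abs_oddCDF_dilation_le hint hL0 hL hy hl1 hl3 hyx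
  rw [hJl]
  have hsJ : 0 < √J := Real.sqrt_pos.2 (by linarith)
  rw [← hJl]
  have hB : 0 ≤ B := le_trans (by positivity) hGy
  have h2 : 2 * √(2 * K) * oddCDF p (y * √(J / (2 * K))) - 2 * √J * oddCDF p y =
      2 * √(2 * K) * (oddCDF p (y * √(J / (2 * K))) - oddCDF p y * √(J / (2 * K))) := by
    rw [hJl]; ring
  have hs : 0 < √(2 * K) := Real.sqrt_pos.2 (by linarith)
  have h3 : √(2 * K) ^ 2 = 2 * K := Real.sq_sqrt (by linarith)
  have h4 : √J ≤ 2 * √(2 * K) := by rw [hJl]; nlinarith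
  have hy2 : y ^ 2 ≤ B / G := by rw [le_div_iff₀ hG0]; linarith
  rw [h2, abs_mul, abs_of_nonneg (by positivity)]
  have h5 : 0 ≤ √(J / (2 * K)) - 1 := by linarith
  generalize √(J / (2 * K)) = l at *
  generalize √(2 * K) = s at *
  calc 2 * s * |oddCDF p (y * l) - oddCDF p y * l|
      ≤ 2 * s * (2 * L * (B / G) * (1 / (2 * K))) := by
        refine mul_le_mul_of_nonneg_left (h1.trans ?_) (by positivity)
        refine mul_le_mul (mul_le_mul_of_nonneg_left hy2 (by positivity)) hlsub h5 (by positivity)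
    _ = 4 * L * B / G * (1 / s) := by
        rw [← h3]; field_simp; ring
    _ ≤ 4 * L * B / G * (2 / √J) := by
        refine mul_le_mul_of_nonneg_left ?_ (by positivity)
        rw [div_le_div_iff₀ hs hsJ]; linarith
    _ = 8 * L * B * (1 / (G * √J)) := by field_simp; ring

theorem RegularDensity.oddCDF_nonneg (hp : RegularDensity p) {y : ℝ} (hy : 0 ≤ y) :
    0 ≤ oddCDF p y :=
  intervalIntegral.integral_nonneg hy fun t _ => hp.nonneg t

theorem RegularDensity.oddCDF_le (hp : RegularDensity p) (hint : Integrable p) {x₁ L : ℝ}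
    (hL : ∀ a b, |a| < x₁ → |b| < x₁ → |p a - p b| ≤ L * |a - b|)
    (hb : ∀ a, |a| < x₁ → p a ≤ 2 * p 0) {y : ℝ} (hy : 0 ≤ y) (hyx : y < x₁) :
    oddCDF p y ≤ 2 * p 0 * y := by
  have := abs_sub_le_of_hasDerivAt (f := oddCDF p) (f' := p) (a := 0) (b := y) (M := 2 * p 0)
    (fun t ht => hp.hasDerivAt_oddCDF hint hL (by
      rw [Set.uIcc_of_le hy] at ht
      rw [abs_of_nonneg ht.1]; linarith [ht.2])) (fun t ht => by
      rw [Set.uIcc_of_le hy] at ht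
      rw [abs_of_nonneg (hp.nonneg t)]
      exact hb t (by rw [abs_of_nonneg ht.1]; linarith [ht.2]))
  have h0 : oddCDF p 0 = 0 := by simp [oddCDF]
  rw [h0, sub_zero, sub_zero, abs_of_nonneg (hp.oddCDF_nonneg hy), abs_of_nonneg hy] at this
  exact this

theorem RegularDensity.betaOdd_sub_medianApprox_le (hp : RegularDensity p) (hint : Integrable p)
    (hhalf : ∀ y, oddCDF p y ≤ 1 / 2) : ∃ x₁ > 0, ∀ B, 0 ≤ B → ∃ C, 0 ≤ C ∧
    ∀ G y : ℝ, 1 ≤ G → 0 ≤ y → 2 * y < x₁ → G * y ^ 2 ≤ B → ∀ j : ℕ, 2 ≤ j →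
      |betaOdd (j / 2) (oddCDF p (y * √((j : ℝ) / (2 * (j / 2) : ℕ)))) -
        medianApprox (inflate G (scaledCDF p G y) * √((j : ℝ) / G)) j| ≤
      C * ((j : ℝ) ^ (-(3 / 2) : ℝ) + G ^ (-(3 / 2) : ℝ)) := by
  obtain ⟨x₁, hx₁, L, hL0, hL, hb⟩ := hp.local_lipschitz
  obtain ⟨C₀, hC₀, hbeta⟩ := betaOdd_expansion
  refine ⟨x₁, hx₁, fun B hB => ?_⟩
  have hp0 := hp.pos_zero
  obtain ⟨H, hH⟩ : ∃ H, H = 4 * p 0 ^ 2 * B := ⟨_, rfl⟩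
  have hH0 : 0 ≤ H := by rw [hH]; positivity
  refine ⟨9 * C₀ + 12 * (8 * L * B) + 8 + 20 * H ^ 2 + 15 * H, by positivity, ?_⟩
  intro G y hG hy hyx hGy j hj
  have hG0 : 0 < G := by linarith
  obtain ⟨k, hk⟩ : ∃ k, k = j / 2 := ⟨_, rfl⟩
  rw [← hk]
  have hk1 : 1 ≤ k := by omega
  have hkj : 2 * k ≤ j := by omega
  have hjk : j ≤ 2 * k + 1 := by omega
  have hK1 : (1 : ℝ) ≤ k := by exact_mod_cast hk1
  have hKJ : 2 * (k : ℝ) ≤ j := by exact_mod_cast hkj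
  have hJK : (j : ℝ) ≤ 2 * k + 1 := by exact_mod_cast hjk
  push_cast
  have e0 := hp.abs_sqrt_mul_oddCDF_sub_le hint hL0 hL hK1 hKJ hJK hG0 hy hyx hGy
  obtain ⟨hl1, hl3, -, -⟩ := sqrt_ratio_bounds hK1 hKJ hJK
  generalize (j : ℝ) = J at *
  have hδ0 : 0 ≤ oddCDF p (y * √(J / (2 * k))) := hp.oddCDF_nonneg (by positivity)
  have e1 := hbeta k hk1 _ hδ0 (hhalf (y * √(J / (2 * k))))
  generalize oddCDF p (y * √(J / (2 * k))) = δ at *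
  have hf0 := hp.oddCDF_nonneg hy
  have hf1 := hp.oddCDF_le hint hL (fun a ha => (hb a ha).2) hy (by linarith)
  have hJ0 : 0 < J := by linarith
  have hJ1 : 1 ≤ J := by linarith
  -- The inflation factor 1 + w²/(4G) is 1 + F(y)², free of j, so it can be applied before mixing.
  have hz : inflate G (scaledCDF p G y) * √(J / G) =
      2 * √J * oddCDF p y * (1 + oddCDF p y ^ 2) := by
    rw [inflate, scaledCDF, mul_pow, mul_pow, Real.sq_sqrt hG0.le, Real.sqrt_div hJ0.le]
    have : √G ≠ 0 := (Real.sqrt_pos.2 hG0).ne'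
    field_simp
    ring
  have hz2 : (2 * √J * oddCDF p y) ^ 2 / J = 4 * oddCDF p y ^ 2 := by
    rw [mul_pow, mul_pow, Real.sq_sqrt hJ0.le]; field_simp; ring
  rw [hz]
  generalize oddCDF p y = f at *
  have hη1 : f ^ 2 ≤ H / G := by
    rw [le_div_iff₀ hG0]
    calc f ^ 2 * G ≤ (2 * p 0 * y) ^ 2 * G := by gcongr
      _ = 4 * p 0 ^ 2 * (G * y ^ 2) := by ring
      _ ≤ _ := by rw [hH]; gcongr
  have e2 := abs_edgeworth_sub_medianApprox_le hK1 hKJ hJK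
    (by positivity : 0 ≤ 2 * √(2 * k) * δ) (by positivity : 0 ≤ 2 * √J * f) (sq_nonneg f) hz2
  obtain ⟨E, hE⟩ : ∃ E, E = J ^ (-(3 / 2) : ℝ) + G ^ (-(3 / 2) : ℝ) := ⟨_, rfl⟩
  have hJE : J ^ (-(3 / 2) : ℝ) ≤ E := by rw [hE]; exact le_add_of_nonneg_right (by positivity)
  have hGE : G ^ (-(3 / 2) : ℝ) ≤ E := by rw [hE]; exact le_add_of_nonneg_left (by positivity)
  have hJ2E : 1 / J ^ 2 ≤ E := (one_div_sq_le_rpow hJ1).trans hJE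
  have hG2E : 1 / G ^ 2 ≤ E := (one_div_sq_le_rpow hG).trans hGE
  have hGJE : 1 / (G * √J) ≤ E := hE ▸ one_div_mul_sqrt_le hG hJ1
  have hGJE' : 1 / (G * J) ≤ E := by
    refine le_trans (one_div_le_one_div_of_le ?_ ?_) hGJE
    · have := Real.sqrt_pos.2 hJ0
      positivity
    · refine mul_le_mul_of_nonneg_left ?_ hG0.le
      rw [Real.sqrt_le_left hJ0.le]; nlinarith
  rw [← hE]
  have f0 : 8 * L * B * (1 / (G * √J)) ≤ 8 * L * B * E :=
    mul_le_mul_of_nonneg_left hGJE (by positivity)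
  have f1 : C₀ / (k : ℝ) ^ 2 ≤ 9 * C₀ * E := by
    calc C₀ / (k : ℝ) ^ 2 ≤ C₀ * (9 * (1 / J ^ 2)) := by
          rw [div_eq_mul_one_div]
          refine mul_le_mul_of_nonneg_left ?_ hC₀
          rw [mul_one_div, div_le_div_iff₀ (by positivity) (by positivity)]
          nlinarith
      _ ≤ C₀ * (9 * E) := mul_le_mul_of_nonneg_left (by linarith) hC₀
      _ = _ := by ring
  have f2 : (f ^ 2) ^ 2 ≤ H ^ 2 * E := by
    calc (f ^ 2) ^ 2 ≤ (H / G) ^ 2 := pow_le_pow_left₀ (sq_nonneg _) hη1 2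
      _ = H ^ 2 * (1 / G ^ 2) := by ring
      _ ≤ _ := mul_le_mul_of_nonneg_left hG2E (by positivity)
  have f3 : f ^ 2 / J ≤ H * E := by
    calc f ^ 2 / J ≤ H / G / J := by gcongr
      _ = H * (1 / (G * J)) := by field_simp
      _ ≤ _ := mul_le_mul_of_nonneg_left hGJE' hH0
  refine (abs_sub_le _ _ _).trans ((add_le_add e1 e2).trans ?_)
  linarith

theorem ncdf_neg (z : ℝ) : ncdf (-z) = -ncdf z := by
  have := intervalIntegral.integral_comp_neg (a := 0) (b := z) npdf
  have hn : ∀ t, npdf (-t) = npdf t := fun t => by simp [npdf]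
  simp only [hn, neg_zero] at this
  rw [ncdf, ncdf, this, intervalIntegral.integral_symm]

theorem medianApprox_neg (z j : ℝ) : medianApprox (-z) j = -medianApprox z j := by
  have hn : npdf (-z) = npdf z := by simp [npdf]
  rw [medianApprox, medianApprox, ncdf_neg, hn]
  ring

theorem betaOdd_neg (k : ℕ) (δ : ℝ) : betaOdd k (-δ) = -betaOdd k δ := by
  have := intervalIntegral.integral_comp_neg (a := 0) (b := δ)
    (fun s : ℝ => (1 - 4 * s ^ 2) ^ k)
  simp only [neg_sq, neg_zero] at this
  rw [betaOdd, betaOdd, this, intervalIntegral.integral_symm, neg_div]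

theorem RegularDensity.scaledCDF_neg (hp : RegularDensity p) (G y : ℝ) :
    scaledCDF p G (-y) = -scaledCDF p G y := by
  rw [scaledCDF, hp.oddCDF_neg, scaledCDF, mul_neg]

theorem inflate_neg (G w : ℝ) : inflate G (-w) = -inflate G w := by
  rw [inflate, inflate, neg_sq, neg_mul]

theorem abs_medianApprox_le (z : ℝ) {j : ℝ} (hj : 1 ≤ j) : |medianApprox z j| ≤ 6 := by
  wlog hz : 0 ≤ z generalizing z
  · rw [← abs_neg, ← medianApprox_neg]
    exact this (-z) (by linarith)
  have h1 := abs_ncdf_le hz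
  have h2 : 0 ≤ z * npdf z := mul_nonneg hz (npdf_pos z).le
  have h3 : z * npdf z ≤ 6 := by
    have h0 := pow_mul_npdf_le z 0
    have h1 := pow_mul_npdf_le z 1
    norm_num at h0 h1
    nlinarith [mul_nonneg (sq_nonneg (z - 1)) (npdf_pos z).le]
  have h4 : 3 / 4 * (z * npdf z) / j ≤ 3 / 4 * (z * npdf z) := div_le_self (by positivity) hj
  have h5 : 0 ≤ 3 / 4 * (z * npdf z) / j := by positivity
  rw [medianApprox, abs_le]
  rw [abs_le] at h1
  constructor <;> linarith

end

section
variable {p : ℝ → ℝ}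

theorem RegularDensity.betaOdd_sub_medianApprox_le_of_abs (hp : RegularDensity p)
    (hint : Integrable p) (hhalf : ∀ y, oddCDF p y ≤ 1 / 2) : ∃ x₁ > 0, ∀ B, 0 ≤ B → ∃ C, 0 ≤ C ∧
    ∀ G y : ℝ, 1 ≤ G → 2 * |y| < x₁ → G * y ^ 2 ≤ B → ∀ j : ℕ, 2 ≤ j →
      |betaOdd (j / 2) (oddCDF p (y * √((j : ℝ) / (2 * (j / 2) : ℕ)))) -
        medianApprox (inflate G (scaledCDF p G y) * √((j : ℝ) / G)) j| ≤
      C * ((j : ℝ) ^ (-(3 / 2) : ℝ) + G ^ (-(3 / 2) : ℝ)) := by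
  obtain ⟨x₁, hx₁, h⟩ := hp.betaOdd_sub_medianApprox_le hint hhalf
  refine ⟨x₁, hx₁, fun B hB => ?_⟩
  obtain ⟨C, hC, h⟩ := h B hB
  refine ⟨C, hC, fun G y hG hy hGy j hj => ?_⟩
  rcases le_total 0 y with h0 | h0
  · rw [abs_of_nonneg h0] at hy
    exact h G y hG h0 hy hGy j hj
  · rw [abs_of_nonpos h0] at hy
    have := h G (-y) hG (by linarith) hy (by rw [neg_sq]; exact hGy) j hj
    rw [neg_mul, hp.oddCDF_neg, betaOdd_neg, hp.scaledCDF_neg, inflate_neg, neg_mul,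
      medianApprox_neg, ← abs_neg] at this
    convert this using 2
    ring

theorem standardizedMedian_le_iff {p₀ G θ x : ℝ} (hp₀ : 0 < p₀) (hG : 0 < G) (X : ℕ → ℝ) {j : ℕ}
    (hj : 2 ≤ j) : standardizedMedian p₀ G θ X j ≤ x ↔
      sampleMedian (fun i => X i - θ) j ≤
        x / (2 * p₀ * √G) * √((j : ℝ) / (2 * (j / 2) : ℕ)) := by
  rw [standardizedMedian, sampleMedian_sub_const _ _ (by omega)]
  have hJ : (0 : ℝ) < j := by exact_mod_cast (by omega : 0 < j)
  have hK : (0 : ℝ) < (2 * (j / 2) : ℕ) := by exact_mod_cast (by omega : 0 < 2 * (j / 2))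
  generalize ((2 * (j / 2) : ℕ) : ℝ) = K at *
  generalize (j : ℝ) = J at *
  have hs : √(G * K / J) * √(J / K) = √G := by
    rw [← Real.sqrt_mul (by positivity)]
    congr 1; field_simp
  have hG' : 0 < √G := Real.sqrt_pos.2 hG
  have hc : 0 < 2 * p₀ * √(G * K / J) := by
    have := Real.sqrt_pos.2 (by positivity : 0 < G * K / J)
    positivity
  have e : x = 2 * p₀ * √(G * K / J) * (x / (2 * p₀ * √G) * √(J / K)) := by
    rw [← hs]
    have h1 := Real.sqrt_pos.2 (by positivity : 0 < G * K / J)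
    have h2 := Real.sqrt_pos.2 (by positivity : 0 < J / K)
    field_simp
  conv_lhs => rw [e]
  exact mul_le_mul_iff_right₀ hc

variable {Ω : Type*} [MeasurableSpace Ω] {P : Measure Ω} [IsProbabilityMeasure P]

theorem RegularDensity.prob_standardizedMedian_approx (hp : RegularDensity p) {θ : ℝ}
    {X : ℕ → Ω → ℝ} (hX_meas : ∀ i, Measurable (X i))
    (hX_law : ∀ i, P.map (X i) = volume.withDensity (fun t => ENNReal.ofReal (p (t - θ))))
    (hX_indep : iIndepFun X P) {K : ℝ} (hK : 0 ≤ K) :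
    ∃ C, 0 ≤ C ∧ ∃ G₀, 1 ≤ G₀ ∧ ∀ G, G₀ ≤ G → ∀ x, |x| ≤ K → ∀ j : ℕ, 1 ≤ j →
      |P.real {ω | standardizedMedian (p 0) G θ (fun i => X i ω) j ≤ x} - 1 / 2 -
        medianApprox (inflate G (scaledCDF p G (x / (2 * p 0 * √G))) * √((j : ℝ) / G)) j| ≤
      C * ((j : ℝ) ^ (-(3 / 2) : ℝ) + G ^ (-(3 / 2) : ℝ)) := by
  set μ := volume.withDensity fun t => ENNReal.ofReal (p t) with hμ
  set Y : ℕ → Ω → ℝ := fun i ω => X i ω - θ with hYdef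
  have hY : ∀ i, Measurable (Y i) := fun i => (hX_meas i).sub_const θ
  have hlaw : ∀ i, P.map (Y i) = μ := fun i => map_sub_const_eq_withDensity (hX_meas i) (hX_law i)
  have hind : iIndepFun Y P :=
    hX_indep.comp (fun _ t => t - θ) fun _ => measurable_id.sub_const θ
  have hprob : IsProbabilityMeasure μ := by
    rw [← hlaw 0]; exact Measure.isProbabilityMeasure_map (hY 0).aemeasurable
  obtain ⟨hint, -⟩ := integrable_of_withDensity hp.measurable hp.nonneg
  have hhalf : ∀ y, oddCDF p y ≤ 1 / 2 := fun y => by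
    have h1 := hp.real_Iic y
    have h2 : μ.real (Set.Iic y) ≤ 1 := measureReal_le_one
    linarith
  obtain ⟨x₂, c, M, L, hreg⟩ := hp.locallyRegular
  obtain ⟨C₁, hC₁, hev⟩ := hreg.abs_prob_even_sub_odd_le (Ω := Ω) (P := P)
  obtain ⟨x₁, hx₁, hmain⟩ := hp.betaOdd_sub_medianApprox_le_of_abs hint hhalf
  have hp0 := hp.pos_zero
  obtain ⟨C₂, hC₂, hmain⟩ := hmain (K ^ 2 / (4 * p 0 ^ 2)) (by positivity)
  have hx₂ := hreg.radius_pos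
  set x₃ := min x₁ (x₂ / 4) with hx₃
  have hx₃0 : 0 < x₃ := lt_min hx₁ (by linarith)
  -- Converts k^{-3/2} into j^{-3/2} through k ≥ j/3.
  set c₃ := (1 / 3 : ℝ) ^ (-(3 / 2) : ℝ) with hc₃
  have hc₃0 : 0 ≤ c₃ := by positivity
  refine ⟨7 + C₁ * c₃ + C₂, by positivity, 1 + (K / (p 0 * x₃)) ^ 2,
    le_add_of_nonneg_right (by positivity), fun G hG x hx j hj => ?_⟩
  have hG1 : 1 ≤ G := (le_add_of_nonneg_right (by positivity)).trans hG
  have hG0 : 0 < G := by linarith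
  have hGp : 0 ≤ G ^ (-(3 / 2) : ℝ) := by positivity
  have hj0 : (0 : ℝ) < j := by exact_mod_cast hj
  have hJp : 0 ≤ (j : ℝ) ^ (-(3 / 2) : ℝ) := by positivity
  -- For j = 1 one has N* = 0 and the statistic degenerates to 0; the trivial bound 7 suffices, as
  -- j^{-3/2} = 1.
  rcases hj.eq_or_lt with rfl | hj2
  · have h1 := abs_medianApprox_le
      (inflate G (scaledCDF p G (x / (2 * p 0 * √G))) * √(((1 : ℕ) : ℝ) / G))
      (j := ((1 : ℕ) : ℝ)) (by simp)
    have h2 : (7 : ℝ) ≤ (7 + C₁ * c₃ + C₂) *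
        (((1 : ℕ) : ℝ) ^ (-(3 / 2) : ℝ) + G ^ (-(3 / 2) : ℝ)) := by
      rw [Nat.cast_one, Real.one_rpow]
      have : 0 ≤ C₁ * c₃ := by positivity
      nlinarith
    refine le_trans ?_ h2
    have h3 : 0 ≤ P.real {ω | standardizedMedian (p 0) G θ (fun i => X i ω) 1 ≤ x} :=
      measureReal_nonneg
    have h4 : P.real {ω | standardizedMedian (p 0) G θ (fun i => X i ω) 1 ≤ x} ≤ 1 :=
      measureReal_le_one
    rw [abs_le] at h1 ⊢
    constructor <;> linarith
  simp only [standardizedMedian_le_iff hp0 hG0 _ hj2]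
  set y := x / (2 * p 0 * √G) with hy
  have hsG : 0 < √G := Real.sqrt_pos.2 hG0
  have hyK : 2 * |y| < x₃ := by
    have h1 : K / (p 0 * x₃) < √G := by
      rw [Real.lt_sqrt (by positivity)]; linarith
    rw [div_lt_iff₀ (by positivity)] at h1
    rw [hy, abs_div, abs_of_pos (by positivity : 0 < 2 * p 0 * √G), mul_div_assoc',
      div_lt_iff₀ (by positivity)]
    nlinarith
  have hGy : G * y ^ 2 ≤ K ^ 2 / (4 * p 0 ^ 2) := by
    have h1 : G * y ^ 2 = x ^ 2 / (4 * p 0 ^ 2) := by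
      rw [hy, div_pow, mul_pow, mul_pow, Real.sq_sqrt hG0.le]; field_simp; ring
    rw [h1]
    have : x ^ 2 ≤ K ^ 2 := sq_le_sq' (by linarith [(abs_le.1 hx).1]) (abs_le.1 hx).2
    gcongr
  have hA := hmain G y hG1 (hyK.trans_le (min_le_left _ _)) hGy j hj2
  obtain ⟨k, hk⟩ : ∃ k, k = j / 2 := ⟨_, rfl⟩
  rw [← hk] at hA ⊢
  have hk1 : 1 ≤ k := by omega
  have hK1 : (1 : ℝ) ≤ k := by exact_mod_cast hk1
  have hl : √((j : ℝ) / (2 * k : ℕ)) ≤ 2 := by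
    have := (sqrt_ratio_bounds (K := k) (J := j) hK1 (by exact_mod_cast (by omega : 2 * k ≤ j))
      (by exact_mod_cast (by omega : j ≤ 2 * k + 1))).2.1
    push_cast
    exact this
  set Y' := y * √((j : ℝ) / (2 * k : ℕ)) with hY'
  have hY'x : |Y'| < x₂ / 4 := by
    rw [hY', abs_mul, abs_of_nonneg (Real.sqrt_nonneg _)]
    have := min_le_right x₁ (x₂ / 4)
    nlinarith [abs_nonneg y]
  have hodd := prob_sampleMedian_odd_le hY hlaw hind k Y'
  rw [hp.real_Iic, add_sub_cancel_left] at hodd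
  have hB : |P.real {ω | sampleMedian (fun i => Y i ω) j ≤ Y'} - 1 / 2 -
      betaOdd k (oddCDF p Y')| ≤ C₁ * c₃ * (j : ℝ) ^ (-(3 / 2) : ℝ) := by
    rcases Nat.even_or_odd' j with ⟨k', hk' | hk'⟩
    · have : k' = k := by omega
      subst this
      rw [hk', sub_sub, ← hodd]
      refine (hev Y hY hlaw hind k' hk1 Y' hY'x).trans ?_
      rw [mul_assoc, hc₃, ← Real.mul_rpow (by norm_num) (by positivity)]
      refine mul_le_mul_of_nonneg_left (Real.rpow_le_rpow_of_nonpos ?_ ?_ (by norm_num)) hC₁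
      · push_cast; linarith
      · push_cast; linarith
    · have : k' = k := by omega
      subst this
      rw [hk', hodd, add_sub_cancel_left, sub_self, abs_zero]
      positivity
  have e : P.real {ω | sampleMedian (fun i => Y i ω) j ≤ Y'} - 1 / 2 -
        medianApprox (inflate G (scaledCDF p G y) * √((j : ℝ) / G)) j =
      (P.real {ω | sampleMedian (fun i => Y i ω) j ≤ Y'} - 1 / 2 - betaOdd k (oddCDF p Y')) +
      (betaOdd k (oddCDF p Y') -
        medianApprox (inflate G (scaledCDF p G y) * √((j : ℝ) / G)) j) := by ring
  rw [e]
  refine (abs_add_le _ _).trans ((add_le_add hB hA).trans ?_)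
  have h7 : 0 ≤ C₁ * c₃ * G ^ (-(3 / 2) : ℝ) := by positivity
  nlinarith

end

/-! ### Mixing over the random sample size -/

section
variable {Ω : Type*} [MeasurableSpace Ω] {P : Measure Ω} [IsProbabilityMeasure P]

theorem hasSum_measureReal_inter_eq {N : Ω → ℕ} {E : Set Ω}
    (hE : ∀ j, MeasurableSet (E ∩ {ω | N ω = j})) :
    HasSum (fun j => P.real (E ∩ {ω | N ω = j})) (P.real E) := by
  have hU : E = ⋃ j, E ∩ {ω | N ω = j} := by
    ext ω; simp
  have hd : Pairwise (Function.onFun Disjoint fun j => E ∩ {ω | N ω = j}) := by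
    intro i j hij
    rw [Function.onFun, Set.disjoint_left]
    rintro ω ⟨-, h1⟩ ⟨-, h2⟩
    exact hij (Eq.trans (Eq.symm h1) h2)
  have h1 := measure_iUnion (μ := P) hd hE
  rw [← hU] at h1
  have hne : ∑' j, P (E ∩ {ω | N ω = j}) ≠ ⊤ := h1 ▸ measure_ne_top P E
  have h2 := (ENNReal.summable_toReal hne).hasSum
  rw [← ENNReal.tsum_toReal_eq fun j => measure_ne_top _ _, ← h1] at h2
  exact h2

theorem measurableSet_standardizedMedian_le (p₀ G θ x : ℝ) {j : ℕ} (hj : 1 ≤ j) :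
    MeasurableSet {X : ℕ → ℝ | standardizedMedian p₀ G θ X j ≤ x} :=
  measurableSet_le (measurable_const.mul ((measurable_sampleMedian hj).sub_const θ))
    measurable_const

theorem hasSum_prob_standardizedMedian {p₀ G θ r : ℝ} (hr : 0 < r) {n : ℕ} (hn : 1 ≤ n)
    {X : ℕ → Ω → ℝ} (hX : ∀ i, Measurable (X i)) {N : Ω → ℕ} (hN : Measurable N)
    (hN_law : ∀ j, 1 ≤ j → P.real {ω | N ω = j} = negBinMass r n j)
    (hind : IndepFun N (fun ω i => X i ω) P) (x : ℝ) :
    HasSum (fun i : ℕ => negBinMass r n (i + 1) *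
      P.real {ω | standardizedMedian p₀ G θ (fun i => X i ω) (i + 1) ≤ x})
      (P.real {ω | standardizedMedian p₀ G θ (fun i => X i ω) (N ω) ≤ x}) := by
  set E : Set Ω := {ω | standardizedMedian p₀ G θ (fun i => X i ω) (N ω) ≤ x} with hE
  have hXm : Measurable fun ω i => X i ω := measurable_pi_lambda _ hX
  have hNj : ∀ j, MeasurableSet {ω | N ω = j} := fun j => hN (measurableSet_singleton j)
  set B : ℕ → Set (ℕ → ℝ) := fun j => {X | standardizedMedian p₀ G θ X j ≤ x} with hB
  have hset : ∀ j, E ∩ {ω | N ω = j} = N ⁻¹' {j} ∩ (fun ω i => X i ω) ⁻¹' B j := by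
    intro j
    ext ω
    simp only [hE, hB, Set.mem_inter_iff, Set.mem_ofPred_eq, Set.mem_preimage,
      Set.mem_singleton_iff]
    constructor
    · rintro ⟨h1, h2⟩; rw [h2] at h1; exact ⟨h2, h1⟩
    · rintro ⟨h2, h1⟩; rw [h2]; exact ⟨h1, rfl⟩
  have hBm : ∀ j, 1 ≤ j → MeasurableSet (B j) := fun j hj =>
    measurableSet_standardizedMedian_le p₀ G θ x hj
  have hB0 : MeasurableSet (B 0) := by
    simp [hB, standardizedMedian]
  have hBm' : ∀ j, MeasurableSet (B j) := fun j => by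
    rcases Nat.eq_zero_or_pos j with rfl | hj
    exacts [hB0, hBm j hj]
  have h := hasSum_measureReal_inter_eq (P := P) (N := N) (E := E) fun j => by
    rw [hset]
    exact (hN (measurableSet_singleton j)).inter (hXm (hBm' j))
  have htot := hasSum_measureReal_inter_eq (P := P) (N := N) (E := Set.univ) fun j => by
    rw [Set.univ_inter]; exact hNj j
  simp only [Set.univ_inter, probReal_univ] at htot
  rw [← hasSum_nat_add_iff' 1] at htot h
  simp only [Finset.range_one, Finset.sum_singleton] at htot h
  -- The law of N is prescribed only from 1 on; the masses there already sum to 1.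
  have h0 : P.real {ω | N ω = 0} = 0 := by
    have h1 : HasSum (fun i : ℕ => negBinMass r n (i + 1)) (1 - P.real {ω | N ω = 0}) := by
      refine htot.congr_fun fun i => ?_
      exact (hN_law (i + 1) (by omega)).symm
    have := h1.unique (hasSum_negBinMass hr hn)
    linarith
  have h0' : P.real (E ∩ {ω | N ω = 0}) = 0 :=
    le_antisymm (h0 ▸ measureReal_mono Set.inter_subset_right) measureReal_nonneg
  rw [h0', sub_zero] at h
  refine h.congr_fun fun i => ?_
  have he := congrArg ENNReal.toReal (hind.measure_inter_preimage_eq_mul {i + 1} (B (i + 1))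
    (measurableSet_singleton _) (hBm' _))
  rw [ENNReal.toReal_mul] at he
  rw [← hN_law (i + 1) (by omega), hset]
  exact he.symm

end

theorem min_mul_le_g {r : ℝ} {n : ℕ} (hn : 1 ≤ n) : min r 1 * n ≤ g r n := by
  have h1 : (1 : ℝ) ≤ n := by exact_mod_cast hn
  rw [g]
  nlinarith [min_le_left r 1, min_le_right r 1]

theorem g_rpow_neg_le_rate {r a : ℝ} (hr : 0 < r) (ha : min r (3 / 2) ≤ a) :
    ∃ C, 0 ≤ C ∧ ∀ n : ℕ, 3 ≤ n → g r n ^ (-a) ≤ C * rate r n := by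
  have hm : 0 < min r 1 := lt_min hr one_pos
  have ha0 : 0 < a := (lt_min hr (by norm_num)).trans_le ha
  refine ⟨min r 1 ^ (-a), by positivity, fun n hn => ?_⟩
  have hn0 : (0 : ℝ) < n := by exact_mod_cast (by omega : 0 < n)
  have hn1 : (1 : ℝ) ≤ n := by exact_mod_cast (by omega : 1 ≤ n)
  calc g r n ^ (-a) ≤ (min r 1 * n) ^ (-a) :=
        Real.rpow_le_rpow_of_nonpos (by positivity) (min_mul_le_g (by omega)) (by linarith)
    _ = min r 1 ^ (-a) * (n : ℝ) ^ (-a) := Real.mul_rpow hm.le hn0.le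
    _ ≤ min r 1 ^ (-a) * (n : ℝ) ^ (-min r (3 / 2)) := by
        refine mul_le_mul_of_nonneg_left ?_ (by positivity)
        exact Real.rpow_le_rpow_of_exponent_le hn1 (by linarith)
    _ ≤ _ := mul_le_mul_of_nonneg_left (rpow_neg_min_le_rate hn) (by positivity)

theorem tendsto_g {r : ℝ} (hr : 0 < r) : Tendsto (g r) atTop atTop := by
  have h1 : Tendsto (fun n : ℕ => r * ((n : ℝ) - 1) + 1) atTop atTop := by
    refine tendsto_atTop_add_const_right _ _ (Tendsto.const_mul_atTop hr ?_)
    exact tendsto_atTop_add_const_right _ _ tendsto_natCast_atTop_atTop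
  exact h1

/-- The second-order approximation to the centred distribution function of the mixture. -/
noncomputable def mixApprox (r G w : ℝ) : ℝ :=
  (∫ t in (0 : ℝ)..w, studentDensity (2 * r) t) +
    if 1 < r then studentDensity (2 * r) w * mixPoly r w / G else 0

theorem mixApprox_neg (r G w : ℝ) : mixApprox r G (-w) = -mixApprox r G w := by
  have h1 := intervalIntegral.integral_comp_neg (a := 0) (b := w) (studentDensity (2 * r))
  simp only [studentDensity_neg, neg_zero] at h1
  have h2 : mixPoly r (-w) = -mixPoly r w := by rw [mixPoly, mixPoly]; ring
  rw [mixApprox, mixApprox, h1, intervalIntegral.integral_symm, studentDensity_neg, h2]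
  split_ifs <;> ring

theorem tsum_medianApprox_sub_mixApprox_le {r : ℝ} (hr : 0 < r) : ∃ C, 0 ≤ C ∧ ∀ n : ℕ, 3 ≤ n →
    2 ≤ g r n → ∀ w,
      |∑' i : ℕ, negBinMass r n (i + 1) * medianApprox (w * √(((i : ℝ) + 1) / g r n)) (i + 1) -
        mixApprox r (g r n) w| ≤ C * rate r n := by
  obtain ⟨C, hC, h⟩ : ∃ C, 0 ≤ C ∧ ∀ n : ℕ, 1 ≤ n → 2 ≤ g r n → ∀ w, 0 ≤ w →
      |∑' i : ℕ, negBinMass r n (i + 1) * medianApprox (w * √(((i : ℝ) + 1) / g r n)) (i + 1) -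
        mixApprox r (g r n) w| ≤ C * g r n ^ (-min r (3 / 2)) := by
    rcases le_or_gt r 1 with hr1 | hr1
    · obtain ⟨C, hC, h⟩ := tsum_medianApprox_of_le_one hr hr1
      refine ⟨C, hC, fun n hn hg w hw => ?_⟩
      rw [mixApprox, if_neg (not_lt.2 hr1), add_zero, min_eq_left (by linarith)]
      exact h n hn hg w hw
    · obtain ⟨C, hC, h⟩ := tsum_medianApprox_of_one_lt hr1
      refine ⟨C, hC, fun n hn hg w hw => ?_⟩
      rw [mixApprox, if_pos hr1]
      exact h n hn hg w hw
  obtain ⟨C', hC', h'⟩ := g_rpow_neg_le_rate hr (le_refl (min r (3 / 2)))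
  refine ⟨C * C', by positivity, fun n hn hg w => ?_⟩
  have hbd : C * g r n ^ (-min r (3 / 2)) ≤ C * C' * rate r n := by
    rw [mul_assoc]; exact mul_le_mul_of_nonneg_left (h' n hn) hC
  rcases le_total 0 w with hw | hw
  · exact (h n (by omega) hg w hw).trans hbd
  · have := (h n (by omega) hg (-w) (by linarith)).trans hbd
    rw [mixApprox_neg] at this
    simp only [neg_mul, medianApprox_neg, mul_neg, tsum_neg] at this
    rwa [← neg_sub', abs_neg] at this

theorem summable_negBinMass_mul_medianApprox {r : ℝ} (hr : 0 < r) {n : ℕ} (hn : 1 ≤ n)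
    (f : ℕ → ℝ) :
    Summable fun i : ℕ => negBinMass r n (i + 1) * medianApprox (f i) ((i : ℝ) + 1) := by
  refine Summable.of_norm_bounded ((hasSum_negBinMass hr hn).summable.mul_right 6) fun i => ?_
  rw [norm_mul, Real.norm_eq_abs, Real.norm_eq_abs, abs_of_nonneg (negBinMass_nonneg hr hn i)]
  exact mul_le_mul_of_nonneg_left (abs_medianApprox_le _ (by linarith [(Nat.cast_nonneg i : (0:ℝ) ≤ i)]))
    (negBinMass_nonneg hr hn i)

section
variable {Ω : Type*} [MeasurableSpace Ω] {P : Measure Ω} [IsProbabilityMeasure P] {p : ℝ → ℝ}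

/-- Independence turns the probability into a sum over sample sizes; the termwise errors add up to E
N^{-3/2} + g^{-3/2}, both within the rate. -/
theorem RegularDensity.prob_mixture_approx (hp : RegularDensity p) {θ : ℝ}
    {X : ℕ → Ω → ℝ} (hX_meas : ∀ i, Measurable (X i))
    (hX_law : ∀ i, P.map (X i) = volume.withDensity (fun t => ENNReal.ofReal (p (t - θ))))
    (hX_indep : iIndepFun X P) {r : ℝ} (hr : 0 < r) {N : ℕ → Ω → ℕ}
    (hN_meas : ∀ n, 1 ≤ n → Measurable (N n))
    (hN_law : ∀ n, 1 ≤ n → ∀ j, 1 ≤ j → P.real {ω | N n ω = j} = negBinMass r n j)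
    (hN_indep : ∀ n, 1 ≤ n → IndepFun (N n) (fun ω i => X i ω) P) {K : ℝ} (hK : 0 ≤ K) :
    ∃ C, 0 ≤ C ∧ ∀ᶠ n : ℕ in atTop, ∀ x, |x| ≤ K →
      |P.real {ω | standardizedMedian (p 0) (g r n) θ (fun i => X i ω) (N n ω) ≤ x} - 1 / 2 -
        mixApprox r (g r n) (inflate (g r n) (scaledCDF p (g r n) (x / (2 * p 0 * √(g r n)))))| ≤
      C * rate r n := by
  obtain ⟨C₁, hC₁, G₀, hG₀, h₁⟩ := hp.prob_standardizedMedian_approx hX_meas hX_law hX_indep hK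
  obtain ⟨C₂, hC₂, h₂⟩ := tsum_negBinMass_mul_rpow_le hr
  obtain ⟨C₃, hC₃, h₃⟩ := g_rpow_neg_le_rate hr (min_le_right r (3 / 2))
  obtain ⟨C₄, hC₄, h₄⟩ := tsum_medianApprox_sub_mixApprox_le hr
  refine ⟨C₁ * (C₂ + C₃) + C₄, by positivity, ?_⟩
  filter_upwards [eventually_ge_atTop 3, (tendsto_g hr).eventually_ge_atTop G₀,
    (tendsto_g hr).eventually_ge_atTop 2] with n hn hG hG2 x hx
  have hn1 : 1 ≤ n := by omega
  set G := g r n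
  set w := inflate G (scaledCDF p G (x / (2 * p 0 * √G)))
  have hs := hasSum_prob_standardizedMedian (p₀ := p 0) (G := G) (θ := θ) hr hn1 hX_meas
    (hN_meas n hn1) (hN_law n hn1) (hN_indep n hn1) x
  have hm := hasSum_negBinMass hr hn1
  have ha := (summable_negBinMass_mul_medianApprox hr hn1
    fun i => w * √(((i : ℝ) + 1) / G)).hasSum
  obtain ⟨hsum, hle⟩ := h₂ n hn
  have hdiff := (hs.sub (hm.mul_right (1 / 2))).sub ha
  have hbound := (hsum.hasSum.add (hm.mul_right (G ^ (-(3 / 2) : ℝ)))).mul_left C₁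
  have hkey : |P.real {ω | standardizedMedian (p 0) G θ (fun i => X i ω) (N n ω) ≤ x} -
      1 * (1 / 2) - ∑' i : ℕ, negBinMass r n (i + 1) *
        medianApprox (w * √(((i : ℝ) + 1) / G)) (i + 1)| ≤
      C₁ * ((∑' i : ℕ, negBinMass r n (i + 1) * ((i : ℝ) + 1) ^ (-(3 / 2) : ℝ)) +
        1 * G ^ (-(3 / 2) : ℝ)) := by
    rw [← Real.norm_eq_abs]
    refine hdiff.norm_le_of_bounded hbound fun i => ?_
    have h := h₁ G hG x hx (i + 1) (by omega)
    have hi := negBinMass_nonneg hr hn1 i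
    push_cast at h
    rw [← mul_sub, ← mul_sub, Real.norm_eq_abs, abs_mul, abs_of_nonneg hi]
    refine (mul_le_mul_of_nonneg_left h hi).trans (le_of_eq ?_)
    ring
  rw [one_mul, one_mul] at hkey
  have h4 := h₄ n hn hG2 w
  have h5 := h₃ n hn
  have e6 : C₁ * ((∑' i : ℕ, negBinMass r n (i + 1) * ((i : ℝ) + 1) ^ (-(3 / 2) : ℝ)) +
        G ^ (-(3 / 2) : ℝ)) ≤ C₁ * ((C₂ + C₃) * rate r n) :=
    mul_le_mul_of_nonneg_left (by linarith) hC₁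
  refine (abs_sub_le _ _ _).trans ((add_le_add (hkey.trans e6) h4).trans (le_of_eq ?_))
  ring

end

/-! ### Inversion of the expansion -/

theorem exists_lipschitz_of_contDiff {f : ℝ → ℝ} (hf : ContDiff ℝ 1 f) (W : ℝ) :
    ∃ M, 0 ≤ M ∧ ∀ a b, |a| ≤ W → |b| ≤ W → |f b - f a| ≤ M * |b - a| := by
  obtain ⟨M, hM⟩ := (isCompact_Icc (a := -W) (b := W)).exists_bound_of_continuousOn
    (hf.continuous_deriv le_rfl).continuousOn
  refine ⟨max M 0, le_max_right _ _, fun a b ha hb => ?_⟩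
  refine abs_sub_le_of_hasDerivAt (f' := deriv f)
    (fun x _ => (hf.differentiable one_ne_zero).differentiableAt.hasDerivAt) fun x hx => ?_
  exact (hM x (Set.ordConnected_Icc.uIcc_subset (abs_le.1 ha) (abs_le.1 hb) hx)).trans
    (le_max_left _ _)

theorem mul_abs_sub_le_of_le_deriv {f f' : ℝ → ℝ} {a b m : ℝ}
    (hf : ∀ x ∈ Set.uIcc a b, HasDerivAt f (f' x) x) (hm : ∀ x ∈ Set.uIcc a b, m ≤ f' x) : m * |b - a| ≤ |f b - f a| := by
  wlog hab : a ≤ b generalizing a b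
  · rw [abs_sub_comm b, abs_sub_comm (f b)]
    exact this (by rwa [Set.uIcc_comm]) (by rwa [Set.uIcc_comm]) (by linarith)
  rcases hab.eq_or_lt with rfl | hlt
  · simp
  rw [Set.uIcc_of_le hab] at hf hm
  obtain ⟨t, ht, hte⟩ := exists_hasDerivAt_eq_slope f f' hlt
    (fun x hx => (hf x hx).continuousAt.continuousWithinAt)
    (fun x hx => hf x (Set.Ioo_subset_Icc_self hx))
  rw [eq_div_iff (by linarith)] at hte
  rw [← hte, abs_mul]
  exact mul_le_mul_of_nonneg_right ((hm t (Set.Ioo_subset_Icc_self ht)).trans (le_abs_self _))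
    (abs_nonneg _)

theorem contDiff_studentDensity {ν : ℝ} (hν : 0 < ν) : ContDiff ℝ 1 (studentDensity ν) := by
  unfold studentDensity
  refine contDiff_const.mul (ContDiff.rpow_const_of_ne (by fun_prop) fun x => ?_)
  positivity

theorem integral_studentDensity_hasDerivAt {ν : ℝ} (hν : 0 < ν) (w : ℝ) :
    HasDerivAt (fun w => ∫ t in (0 : ℝ)..w, studentDensity ν t) (studentDensity ν w) w :=
  ((continuous_studentDensity hν).integral_hasStrictDerivAt 0 w).hasDerivAt

theorem contDiff_mixPoly (r : ℝ) : ContDiff ℝ 1 (mixPoly r) := by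
  unfold mixPoly
  fun_prop

theorem continuous_mixApprox {r : ℝ} (hr : 0 < r) (G : ℝ) : Continuous (mixApprox r G) := by
  have h1 : Continuous fun w => ∫ t in (0 : ℝ)..w, studentDensity (2 * r) t :=
    continuous_iff_continuousAt.2 fun w =>
      (integral_studentDensity_hasDerivAt (by positivity) w).continuousAt
  unfold mixApprox
  split_ifs
  · exact h1.add (((continuous_studentDensity (by positivity)).mul
      (contDiff_mixPoly r).continuous).div_const G)
  · simpa using h1

/-- Needed for the preliminary bound v - u = O(1/g) in the inversion. -/
theorem rate_le_inv_g {r : ℝ} (hr : 1 < r) : ∃ C, 0 ≤ C ∧ ∀ n : ℕ, 1 ≤ n →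
    rate r n ≤ C * (1 / g r n) := by
  refine ⟨2 * r, by linarith, fun n hn => ?_⟩
  have hn1 : (1 : ℝ) ≤ n := by exact_mod_cast hn
  have hn0 : (0 : ℝ) < n := by linarith
  have hg : 0 < g r n := by
    have := min_mul_le_g (r := r) hn
    rw [min_eq_right hr.le] at this
    linarith
  have hgn : g r n ≤ r * n := by rw [g]; linarith
  have h1 : rate r n ≤ 2 * (1 / n) := by
    rw [rate]
    split_ifs
    · have h2 := Real.log_le_rpow_div hn0.le (by norm_num : (0 : ℝ) < 1 / 2)
      calc Real.log n * (n : ℝ) ^ (-(3 / 2) : ℝ)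
          ≤ ((n : ℝ) ^ (1 / 2 : ℝ) / (1 / 2)) * (n : ℝ) ^ (-(3 / 2) : ℝ) :=
            mul_le_mul_of_nonneg_right h2 (by positivity)
        _ = 2 * ((n : ℝ) ^ (1 / 2 : ℝ) * (n : ℝ) ^ (-(3 / 2) : ℝ)) := by ring
        _ = 2 * (1 / n) := by
            rw [← Real.rpow_add hn0, show (1 / 2 : ℝ) + -(3 / 2) = -1 by norm_num,
              Real.rpow_neg_one, one_div]
    · have h2 : (n : ℝ) ^ (-min r (3 / 2)) ≤ (n : ℝ) ^ (-1 : ℝ) := by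
        refine Real.rpow_le_rpow_of_exponent_le hn1 (neg_le_neg (le_min hr.le (by norm_num)))
      rw [Real.rpow_neg_one, ← one_div] at h2
      have : 0 ≤ 1 / (n : ℝ) := by positivity
      linarith
  refine h1.trans ?_
  rw [mul_one_div, mul_one_div, div_le_div_iff₀ hn0 hg]
  linarith

theorem rate_nonneg {r : ℝ} {n : ℕ} (hn : 3 ≤ n) : 0 ≤ rate r n :=
  (Real.rpow_nonneg (Nat.cast_nonneg n) _).trans (rpow_neg_min_le_rate hn)

/-- Inversion of the second-order approximation to the distribution function. -/
theorem mixApprox_inversion {r : ℝ} (hr : 0 < r) (u W : ℝ) {C : ℝ} (hC : 0 ≤ C) :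
    ∃ C', 0 ≤ C' ∧ ∀ n : ℕ, 3 ≤ n → 1 ≤ g r n → ∀ v, |v| ≤ W →
      |mixApprox r (g r n) v - ∫ t in (0 : ℝ)..u, studentDensity (2 * r) t| ≤ C * rate r n →
      |v - u + if 1 < r then mixPoly r u / g r n else 0| ≤ C' * rate r n ∧
      |v - u| ≤ C' * (rate r n + if 1 < r then 1 / g r n else 0) := by
  have hν : 0 < 2 * r := by positivity
  set s := studentDensity (2 * r) with hs
  set S : ℝ → ℝ := fun w => ∫ t in (0 : ℝ)..w, s t with hS
  obtain ⟨Z, hZ⟩ : ∃ Z, Z = max W |u| := ⟨_, rfl⟩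
  have huZ : |u| ≤ Z := hZ ▸ le_max_right _ _
  have hWZ : W ≤ Z := hZ ▸ le_max_left _ _
  have hZ0 : 0 ≤ Z := (abs_nonneg u).trans huZ
  obtain ⟨x₀, -, hmin⟩ := (isCompact_Icc (a := -Z) (b := Z)).exists_isMinOn
    ⟨0, by linarith, hZ0⟩ (continuous_studentDensity hν).continuousOn
  have hm0 : 0 < s x₀ := studentDensity_pos hν x₀
  set m := s x₀ with hm
  have hmle : ∀ x ∈ Set.Icc (-Z) Z, m ≤ s x := fun x hx => hmin hx
  have hlow : ∀ v, |v| ≤ W → m * |v - u| ≤ |S v - S u| := fun v hv => by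
    refine mul_abs_sub_le_of_le_deriv (f := S)
      (fun x _ => integral_studentDensity_hasDerivAt hν x) fun x hx => hmle x ?_
    exact Set.ordConnected_Icc.uIcc_subset (abs_le.1 huZ) (abs_le.1 (hv.trans hWZ)) hx
  rcases le_or_gt r 1 with hr1 | hr1
  · refine ⟨C / m, by positivity, fun n hn hg v hv h => ?_⟩
    have := hlow v hv
    simp only [mixApprox, if_neg (not_lt.2 hr1), add_zero] at h ⊢
    have h2 : |v - u| ≤ C / m * rate r n := by
      rw [div_mul_eq_mul_div, le_div_iff₀ hm0, mul_comm]
      exact this.trans h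
    exact ⟨h2, h2⟩
  · simp only [mixApprox, if_pos hr1]
    set h : ℝ → ℝ := fun w => s w * mixPoly r w with hh
    have hcd : ContDiff ℝ 1 h := (contDiff_studentDensity hν).mul (contDiff_mixPoly r)
    obtain ⟨M₁, hM₁, hs1⟩ := exists_lipschitz_of_contDiff (contDiff_studentDensity hν) Z
    obtain ⟨M₂, hM₂, hh1⟩ := exists_lipschitz_of_contDiff hcd Z
    obtain ⟨H, hH⟩ := (isCompact_Icc (a := -Z) (b := Z)).exists_bound_of_continuousOn
      hcd.continuous.continuousOn
    have hH0 : 0 ≤ H := (norm_nonneg _).trans (hH 0 ⟨by linarith, hZ0⟩)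
    obtain ⟨C₁, hC₁, hrate⟩ := rate_le_inv_g hr1
    obtain ⟨C₂, hC₂, hg2⟩ := g_rpow_neg_le_rate (a := 2) hr ((min_le_right _ _).trans (by norm_num))
    set D := (C * C₁ + H) / m with hD
    have hD0 : 0 ≤ D := by positivity
    set A := (C + (M₁ * D ^ 2 + M₂ * D) * C₂) / s u with hA
    have hsu : 0 < s u := studentDensity_pos hν u
    have hA0 : 0 ≤ A := by positivity
    refine ⟨A + D, by positivity, fun n hn hg v hv hE => ?_⟩
    have hg0 : 0 < g r n := by linarith
    have hrt := rate_nonneg (r := r) hn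
    have hrn := hrate n (by omega)
    have hg2n : 1 / g r n ^ 2 ≤ C₂ * rate r n := by
      have := hg2 n hn
      rw [Real.rpow_neg hg0.le, ← one_div] at this
      norm_num at this ⊢
      exact this
    generalize g r n = G at *
    generalize rate r n = ρ at *
    have hvZ : |v| ≤ Z := hv.trans hWZ
    have hS2 : |S v + h v / G - S u| ≤ C * ρ := hE
    -- A crude bound from the positive minimum m of the density on [-Z, Z]; it makes the quadratic
    -- Taylor term and the shift of h both O(G⁻²).
    have hvu : |v - u| ≤ D * (1 / G) := by
      have h1 := hlow v hv
      have h2 : |h v / G| ≤ H * (1 / G) := by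
        rw [abs_div, abs_of_pos hg0, mul_one_div]
        have := hH v (abs_le.1 hvZ)
        rw [Real.norm_eq_abs] at this
        gcongr
      have h3 : |S v - S u| ≤ C * ρ + H * (1 / G) := by
        have : S v - S u = (S v + h v / G - S u) - h v / G := by ring
        rw [this]
        exact (abs_sub _ _).trans (add_le_add hS2 h2)
      have h4 : C * ρ ≤ C * (C₁ * (1 / G)) := mul_le_mul_of_nonneg_left hrn hC
      rw [hD, div_mul_eq_mul_div, le_div_iff₀ hm0, mul_comm]
      nlinarith
    refine ⟨?_, ?_⟩
    · have h1 : |S v - S u - s u * (v - u)| ≤ M₁ * (v - u) ^ 2 := by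
        have := abs_sub_le_of_hasDerivAt (f := fun x => S x - s u * x)
          (f' := fun x => s x - s u) (a := u) (b := v) (M := M₁ * |v - u|) (fun x _ =>
            (integral_studentDensity_hasDerivAt hν x).sub
              (((hasDerivAt_id x).const_mul (s u)).congr_deriv (mul_one _))) (fun x hx => by
            have hxZ : |x| ≤ Z := abs_le.2
              (Set.ordConnected_Icc.uIcc_subset (abs_le.1 huZ) (abs_le.1 hvZ) hx)
            refine (hs1 u x huZ hxZ).trans (mul_le_mul_of_nonneg_left ?_ hM₁)
            exact Set.abs_sub_left_of_mem_uIcc hx)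
        rw [mul_assoc, abs_mul_abs_self, ← pow_two] at this
        convert this using 2
        ring
      have h2 := hh1 u v huZ hvZ
      -- One Newton step at u: h(u) = s(u) `mixPoly r u`, so division by the density s(u) isolates
      -- the correction.
      have h3 : s u * (v - u + mixPoly r u / G) = (S v + h v / G - S u) -
          (S v - S u - s u * (v - u)) - (h v - h u) / G := by
        simp only [hh]; ring
      have h4 : |(h v - h u) / G| ≤ M₂ * D * (1 / G ^ 2) := by
        rw [abs_div, abs_of_pos hg0, div_le_iff₀ hg0]
        calc |h v - h u| ≤ M₂ * (D * (1 / G)) := h2.trans (mul_le_mul_of_nonneg_left hvu hM₂)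
          _ = _ := by field_simp
      have h5 : M₁ * (v - u) ^ 2 ≤ M₁ * D ^ 2 * (1 / G ^ 2) := by
        have : (v - u) ^ 2 ≤ (D * (1 / G)) ^ 2 := by
          rw [← sq_abs]; exact pow_le_pow_left₀ (abs_nonneg _) hvu 2
        calc _ ≤ M₁ * (D * (1 / G)) ^ 2 := mul_le_mul_of_nonneg_left this hM₁
          _ = _ := by ring
      have h6 : s u * |v - u + mixPoly r u / G| ≤
          (C + (M₁ * D ^ 2 + M₂ * D) * C₂) * ρ := by
        have h8 := abs_mul (s u) (v - u + mixPoly r u / G)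
        rw [abs_of_pos hsu] at h8
        rw [← h8, h3]
        have h7 := mul_le_mul_of_nonneg_left hg2n (by positivity : 0 ≤ M₁ * D ^ 2 + M₂ * D)
        refine (abs_sub _ _).trans ((add_le_add ((abs_sub _ _).trans (add_le_add hS2 h1)) h4).trans ?_)
        linarith
      have h8 : |v - u + mixPoly r u / G| ≤ A * ρ := by
        rw [hA, div_mul_eq_mul_div, le_div_iff₀ hsu, mul_comm]
        exact h6
      exact h8.trans (mul_le_mul_of_nonneg_right (by linarith) hrt)
    · refine hvu.trans ?_
      have : 0 ≤ 1 / G := by positivity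
      nlinarith [mul_nonneg hA0 hrt, mul_nonneg hD0 hrt, mul_nonneg hA0 this]

/-- Formal inversion of a cubic perturbation of the identity. -/
theorem cubic_inversion {a c C K : ℝ} (hC : 0 ≤ C) (hK : 0 ≤ K) : ∃ C', 0 ≤ C' ∧
    ∀ ε x v : ℝ, 0 ≤ ε → ε ≤ 1 → |x| ≤ K → (0 ≤ x → 0 ≤ v) → (x ≤ 0 → v ≤ 0) →
      |v - (x + ε * a * (x * |x|) + ε ^ 2 * c * x ^ 3)| ≤ C * ε ^ 3 →
      |x - (v - ε * a * (v * |v|) + ε ^ 2 * (2 * a ^ 2 - c) * v ^ 3)| ≤ C' * ε ^ 3 := by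
  obtain ⟨D₂, hD₂⟩ : ∃ D₂, D₂ = |c| * K ^ 3 + C := ⟨_, rfl⟩
  obtain ⟨D, hD⟩ : ∃ D, D = |a| * K ^ 2 + D₂ := ⟨_, rfl⟩
  have hD₂0 : 0 ≤ D₂ := by rw [hD₂]; positivity
  have hD0 : 0 ≤ D := by rw [hD]; positivity
  refine ⟨C + 2 * |a| * K * D₂ + |a| * D ^ 2 + |2 * a ^ 2 - c| * (D * (3 * (K + D) ^ 2)),
    by positivity, ?_⟩
  intro ε x v hε hε1 hx hxv hxv' h
  wlog hx0 : 0 ≤ x generalizing x v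
  -- The map x ↦ x + εa x|x| + ε²c x³ is odd; since v shares the sign of x, both absolute values
  -- disappear after the reflection.
  · have := this (-x) (-v) (by rwa [abs_neg])
      (fun h0 => by linarith [hxv' (by linarith)]) (fun h0 => by linarith [hxv (by linarith)]) (by
      rw [← abs_neg] at h
      rw [abs_neg]
      convert h using 2
      ring) (by linarith)
    rw [← abs_neg, abs_neg v] at this
    convert this using 2
    ring
  have hv0 := hxv hx0
  rw [abs_of_nonneg hx0] at hx h
  rw [abs_of_nonneg hv0]
  have hε2 : 0 ≤ ε ^ 2 := by positivity
  have hε3 : 0 ≤ ε ^ 3 := by positivity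
  have hε32 : ε ^ 3 ≤ ε ^ 2 := by nlinarith
  have hε21 : ε ^ 2 ≤ ε := by nlinarith
  set R := v - (x + ε * a * (x * x) + ε ^ 2 * c * x ^ 3) with hR
  have hx3 : x ^ 3 ≤ K ^ 3 := pow_le_pow_left₀ hx0 hx 3
  have hx2 : x ^ 2 ≤ K ^ 2 := pow_le_pow_left₀ hx0 hx 2
  set d₂ := v - x - ε * a * x ^ 2 with hd₂
  have hd₂le : |d₂| ≤ D₂ * ε ^ 2 := by
    have e : d₂ = ε ^ 2 * c * x ^ 3 + R := by rw [hd₂, hR]; ring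
    have h1 : |ε ^ 2 * c * x ^ 3| ≤ |c| * K ^ 3 * ε ^ 2 := by
      rw [abs_mul, abs_mul, abs_of_nonneg hε2, abs_of_nonneg (by positivity : 0 ≤ x ^ 3)]
      calc ε ^ 2 * |c| * x ^ 3 ≤ ε ^ 2 * |c| * K ^ 3 := by gcongr
        _ = _ := by ring
    have h2 : C * ε ^ 3 ≤ C * ε ^ 2 := mul_le_mul_of_nonneg_left hε32 hC
    rw [e]
    refine (abs_add_le _ _).trans ?_
    rw [hD₂]
    linarith
  have hdle : |v - x| ≤ D * ε := by
    have e : v - x = ε * a * x ^ 2 + d₂ := by rw [hd₂]; ring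
    have h1 : |ε * a * x ^ 2| ≤ |a| * K ^ 2 * ε := by
      rw [abs_mul, abs_mul, abs_of_nonneg hε, abs_of_nonneg (by positivity : 0 ≤ x ^ 2)]
      calc ε * |a| * x ^ 2 ≤ ε * |a| * K ^ 2 := by gcongr
        _ = _ := by ring
    have h2 : D₂ * ε ^ 2 ≤ D₂ * ε := mul_le_mul_of_nonneg_left hε21 hD₂0
    rw [e]
    refine (abs_add_le _ _).trans ?_
    rw [hD]
    linarith
  have hvK : v ≤ K + D := by
    have := (abs_le.1 hdle).2
    have : D * ε ≤ D := mul_le_of_le_one_right hD0 hε1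
    linarith
  have hcube : |v ^ 3 - x ^ 3| ≤ D * (3 * (K + D) ^ 2) * ε := by
    have e : v ^ 3 - x ^ 3 = (v - x) * (v ^ 2 + v * x + x ^ 2) := by ring
    have h1 : v ^ 2 + v * x + x ^ 2 ≤ 3 * (K + D) ^ 2 := by
      have hxK : x ≤ K + D := by linarith
      have h1 := pow_le_pow_left₀ hv0 hvK 2
      have h2 := pow_le_pow_left₀ hx0 hxK 2
      have h3 : v * x ≤ (K + D) * (K + D) := mul_le_mul hvK hxK hx0 (by linarith)
      linarith
    rw [e, abs_mul, abs_of_nonneg (by positivity : 0 ≤ v ^ 2 + v * x + x ^ 2)]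
    calc _ ≤ D * ε * (3 * (K + D) ^ 2) := mul_le_mul hdle h1 (by positivity) (by positivity)
      _ = _ := by ring
  -- The coefficient 2a² - c makes the terms of order ε² cancel; in this exact identity each
  -- remaining term is O(ε³).
  have e : x - (v - ε * a * (v * v) + ε ^ 2 * (2 * a ^ 2 - c) * v ^ 3) =
      -R + 2 * ε * a * x * d₂ + ε * a * (v - x) ^ 2 - ε ^ 2 * (2 * a ^ 2 - c) * (v ^ 3 - x ^ 3) := by
    rw [hR, hd₂]; ring
  have t2 : |2 * ε * a * x * d₂| ≤ 2 * |a| * K * D₂ * ε ^ 3 := by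
    rw [abs_mul, abs_mul, abs_mul, abs_of_nonneg (by positivity : 0 ≤ 2 * ε), abs_of_nonneg hx0]
    calc _ ≤ 2 * ε * |a| * K * (D₂ * ε ^ 2) := by gcongr
      _ = _ := by ring
  have t3 : |ε * a * (v - x) ^ 2| ≤ |a| * D ^ 2 * ε ^ 3 := by
    rw [abs_mul, abs_mul, abs_of_nonneg hε, abs_pow]
    calc _ ≤ ε * |a| * (D * ε) ^ 2 := by gcongr
      _ = _ := by ring
  have t4 : |ε ^ 2 * (2 * a ^ 2 - c) * (v ^ 3 - x ^ 3)| ≤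
      |2 * a ^ 2 - c| * (D * (3 * (K + D) ^ 2)) * ε ^ 3 := by
    rw [abs_mul, abs_mul, abs_of_nonneg hε2]
    calc _ ≤ ε ^ 2 * |2 * a ^ 2 - c| * (D * (3 * (K + D) ^ 2) * ε) := by gcongr
      _ = _ := by ring
  rw [e]
  refine (abs_sub _ _).trans ?_
  refine (add_le_add ((abs_add_le _ _).trans (add_le_add ((abs_add_le _ _).trans
    (add_le_add (abs_neg R ▸ h) t2)) t3)) t4).trans (le_of_eq ?_)
  ring

/-! ### Expansion of the argument of the limiting law in powers of 1/√g. -/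

section
variable {p : ℝ → ℝ}

theorem inflate_nonneg {G w : ℝ} (hG : 0 ≤ G) (hw : 0 ≤ w) : 0 ≤ inflate G w := by
  unfold inflate; positivity

/-- Here ε = 1/√G. The Taylor polynomial of F at xε/(2p₀), multiplied by 2/ε, gives the coefficients
with p₁ and p₂; the inflation contributes the extra ε²x³/4. Only x ≥ 0 is treated, as the expansion
is one-sided. -/
theorem RegularDensity.scaledCDF_expansion (hp : RegularDensity p) (hint : Integrable p)
    {p₁ p₂ : ℝ} (hp₁ : Tendsto (deriv p) (𝓝[>] 0) (𝓝 p₁))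
    (hp₂ : Tendsto (iteratedDeriv 2 p) (𝓝[>] 0) (𝓝 p₂)) {K : ℝ} (hK : 0 ≤ K) :
    ∃ C, 0 ≤ C ∧ ∃ ε₀, 0 < ε₀ ∧ ε₀ ≤ 1 ∧ ∀ ε, 0 < ε → ε ≤ ε₀ → ∀ x, 0 ≤ x → x ≤ K →
      |inflate (1 / ε ^ 2) (scaledCDF p (1 / ε ^ 2) (x * ε / (2 * p 0))) -
        (x + ε * (p₁ / (4 * p 0 ^ 2)) * (x * x) +
          ε ^ 2 * (p₂ / (24 * p 0 ^ 3) + 1 / 4) * x ^ 3)| ≤ C * ε ^ 3 := by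
  obtain ⟨x₁, hx₁, M, hM, hT⟩ := hp.oddCDF_taylor hint hp₁ hp₂
  have hp0 := hp.pos_zero
  set a := p₁ / (4 * p 0 ^ 2) with ha
  set b := p₂ / (24 * p 0 ^ 3) with hb
  obtain ⟨C₁, hC₁⟩ : ∃ C₁, C₁ = M * K ^ 4 / (8 * p 0 ^ 4) := ⟨_, rfl⟩
  have hC₁0 : 0 ≤ C₁ := by rw [hC₁]; positivity
  obtain ⟨D, hD⟩ : ∃ D, D = |a| * K ^ 2 + |b| * K ^ 3 + C₁ := ⟨_, rfl⟩
  have hD0 : 0 ≤ D := by rw [hD]; positivity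
  refine ⟨C₁ + D * (3 * (K + D) ^ 2) / 4, by positivity, min 1 (p 0 * x₁ / (K + 1)),
    lt_min one_pos (by positivity), min_le_left _ _, ?_⟩
  intro ε hε hε0 x hx hxK
  have hε1 : ε ≤ 1 := hε0.trans (min_le_left _ _)
  have hε2 : ε * (K + 1) ≤ p 0 * x₁ := by
    have := hε0.trans (min_le_right _ _)
    rwa [le_div_iff₀ (by positivity)] at this
  have hε32 : ε ^ 3 ≤ ε := by
    have : ε ^ 2 ≤ 1 := pow_le_one₀ hε.le hε1
    nlinarith
  have hε21 : ε ^ 2 ≤ ε := by nlinarith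
  set y := x * ε / (2 * p 0) with hy
  have hy0 : 0 ≤ y := by positivity
  have hy1 : y < x₁ := by
    rw [hy, div_lt_iff₀ (by positivity)]
    nlinarith
  have hs : √(1 / ε ^ 2) = 1 / ε := by
    rw [Real.sqrt_div zero_le_one, Real.sqrt_one, Real.sqrt_sq hε.le]
  set w := scaledCDF p (1 / ε ^ 2) y with hw
  have hw' : w = 2 / ε * oddCDF p y := by rw [hw, scaledCDF, hs]; ring
  have hw0 : 0 ≤ w := by
    rw [hw']
    exact mul_nonneg (by positivity) (hp.oddCDF_nonneg hy0)
  have h1 : |w - (x + ε * a * x ^ 2 + ε ^ 2 * b * x ^ 3)| ≤ C₁ * ε ^ 3 := by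
    have e : w - (x + ε * a * x ^ 2 + ε ^ 2 * b * x ^ 3) =
        2 / ε * (oddCDF p y - (p 0 * y + p₁ * y ^ 2 / 2 + p₂ * y ^ 3 / 6)) := by
      rw [hw', hy, ha, hb]; field_simp; ring
    rw [e, abs_mul, abs_of_pos (by positivity : 0 < 2 / ε)]
    calc _ ≤ 2 / ε * (M * y ^ 4) := mul_le_mul_of_nonneg_left (hT y hy0 hy1) (by positivity)
      _ = M * x ^ 4 / (8 * p 0 ^ 4) * ε ^ 3 := by rw [hy]; field_simp; ring
      _ ≤ M * K ^ 4 / (8 * p 0 ^ 4) * ε ^ 3 := by gcongr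
      _ = _ := by rw [hC₁]
  have h2 : |w - x| ≤ D * ε := by
    have e : w - x = (w - (x + ε * a * x ^ 2 + ε ^ 2 * b * x ^ 3)) +
      (ε * a * x ^ 2 + ε ^ 2 * b * x ^ 3) := by ring
    have t1 : |ε * a * x ^ 2| ≤ |a| * K ^ 2 * ε := by
      rw [abs_mul, abs_mul, abs_of_pos hε, abs_of_nonneg (by positivity : 0 ≤ x ^ 2)]
      calc ε * |a| * x ^ 2 ≤ ε * |a| * K ^ 2 := by gcongr
        _ = _ := by ring
    have t2 : |ε ^ 2 * b * x ^ 3| ≤ |b| * K ^ 3 * ε := by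
      rw [abs_mul, abs_mul, abs_of_nonneg (by positivity : 0 ≤ ε ^ 2),
        abs_of_nonneg (by positivity : 0 ≤ x ^ 3)]
      calc ε ^ 2 * |b| * x ^ 3 ≤ ε * |b| * K ^ 3 := by gcongr
        _ = _ := by ring
    have t3 : C₁ * ε ^ 3 ≤ C₁ * ε := mul_le_mul_of_nonneg_left hε32 hC₁0
    rw [e]
    refine (abs_add_le _ _).trans ((add_le_add h1 ((abs_add_le _ _).trans
      (add_le_add t1 t2))).trans ?_)
    rw [hD]
    linarith
  have hwK : w ≤ K + D := by
    have h3 := (abs_le.1 h2).2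
    have : D * ε ≤ D := mul_le_of_le_one_right hD0 hε1
    linarith
  have h3 : |w ^ 3 - x ^ 3| ≤ D * (3 * (K + D) ^ 2) * ε := by
    have e : w ^ 3 - x ^ 3 = (w - x) * (w ^ 2 + w * x + x ^ 2) := by ring
    have h1 : w ^ 2 + w * x + x ^ 2 ≤ 3 * (K + D) ^ 2 := by
      have hxK : x ≤ K + D := by linarith
      have h1 := pow_le_pow_left₀ hw0 hwK 2
      have h2 := pow_le_pow_left₀ hx hxK 2
      have h3 : w * x ≤ (K + D) * (K + D) := mul_le_mul hwK hxK hx (by linarith)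
      linarith
    rw [e, abs_mul, abs_of_nonneg (by positivity : 0 ≤ w ^ 2 + w * x + x ^ 2)]
    calc _ ≤ D * ε * (3 * (K + D) ^ 2) := mul_le_mul h2 h1 (by positivity) (by positivity)
      _ = _ := by ring
  have e : inflate (1 / ε ^ 2) w - (x + ε * a * (x * x) + ε ^ 2 * (b + 1 / 4) * x ^ 3) =
      (w - (x + ε * a * x ^ 2 + ε ^ 2 * b * x ^ 3)) + ε ^ 2 / 4 * (w ^ 3 - x ^ 3) := by
    rw [inflate]; field_simp; ring
  rw [e]
  refine (abs_add_le _ _).trans ?_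
  rw [add_mul]
  refine add_le_add h1 ?_
  rw [abs_mul, abs_of_nonneg (by positivity : 0 ≤ ε ^ 2 / 4)]
  calc _ ≤ ε ^ 2 / 4 * (D * (3 * (K + D) ^ 2) * ε) := by gcongr
    _ = _ := by ring

/-- The argument of the limiting distribution as a cubic perturbation of the quantile level. -/
theorem RegularDensity.inflate_scaledCDF_expansion (hp : RegularDensity p) (hint : Integrable p)
    {p₁ p₂ : ℝ} (hp₁ : Tendsto (deriv p) (𝓝[>] 0) (𝓝 p₁))
    (hp₂ : Tendsto (iteratedDeriv 2 p) (𝓝[>] 0) (𝓝 p₂)) {K : ℝ} (hK : 0 ≤ K) :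
    ∃ C, 0 ≤ C ∧ ∃ W, 0 ≤ W ∧ ∃ G₀, 1 ≤ G₀ ∧ ∀ G, G₀ ≤ G → ∀ x v, |x| ≤ K →
      v = inflate G (scaledCDF p G (x / (2 * p 0 * √G))) →
      |v - (x + 1 / √G * (p₁ / (4 * p 0 ^ 2)) * (x * |x|) +
          (1 / √G) ^ 2 * (p₂ / (24 * p 0 ^ 3) + 1 / 4) * x ^ 3)| ≤ C * (1 / √G) ^ 3 ∧
      (0 ≤ x → 0 ≤ v) ∧ (x ≤ 0 → v ≤ 0) ∧ |v| ≤ W := by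
  obtain ⟨C, hC, ε₀, hε₀, hε₀1, h⟩ := hp.scaledCDF_expansion hint hp₁ hp₂ hK
  have hp0 := hp.pos_zero
  set a := p₁ / (4 * p 0 ^ 2) with ha
  set c := p₂ / (24 * p 0 ^ 3) + 1 / 4 with hc
  refine ⟨C, hC, K + |a| * K ^ 2 + |c| * K ^ 3 + C, by positivity, 1 / ε₀ ^ 2,
    one_le_one_div (by positivity) (pow_le_one₀ hε₀.le hε₀1), ?_⟩
  intro G hG x v hx hv
  have hG0 : 0 < G := lt_of_lt_of_le (by positivity) hG
  have hsG : 0 < √G := Real.sqrt_pos.2 hG0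
  obtain ⟨ε, hε⟩ : ∃ ε, ε = 1 / √G := ⟨_, rfl⟩
  have hε0 : 0 < ε := by rw [hε]; positivity
  have hεG : 1 / ε ^ 2 = G := by
    rw [hε, div_pow, Real.sq_sqrt hG0.le]; field_simp
  have hεle : ε ≤ ε₀ := by
    rw [hε, div_le_iff₀ hsG, ← div_le_iff₀' hε₀]
    refine Real.le_sqrt_of_sq_le ?_
    rw [div_pow, one_pow]; exact hG
  have hy : x / (2 * p 0 * √G) = x * ε / (2 * p 0) := by
    rw [hε]; field_simp
  rw [← hε]
  rw [hy] at hv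
  have main : ∀ x v, 0 ≤ x → x ≤ K → v = inflate G (scaledCDF p G (x * ε / (2 * p 0))) →
      |v - (x + ε * a * (x * x) + ε ^ 2 * c * x ^ 3)| ≤ C * ε ^ 3 ∧ 0 ≤ v ∧
      |v| ≤ K + |a| * K ^ 2 + |c| * K ^ 3 + C := by
    intro x v hx hxK hv
    have h1 := h ε hε0 hεle x hx hxK
    rw [hεG, ← hv] at h1
    have hv0 : 0 ≤ v := by
      rw [hv]
      refine inflate_nonneg hG0.le ?_
      exact mul_nonneg (by positivity) (hp.oddCDF_nonneg (by positivity))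
    refine ⟨h1, hv0, ?_⟩
    have hε1 := hεle.trans hε₀1
    have e : v = (v - (x + ε * a * (x * x) + ε ^ 2 * c * x ^ 3)) + x + ε * a * (x * x) +
      ε ^ 2 * c * x ^ 3 := by ring
    have t1 : |ε * a * (x * x)| ≤ |a| * K ^ 2 := by
      rw [abs_mul, abs_mul, abs_of_pos hε0, abs_of_nonneg (by positivity : 0 ≤ x * x)]
      calc ε * |a| * (x * x) ≤ 1 * |a| * (K * K) := by gcongr
        _ = _ := by ring
    have t2 : |ε ^ 2 * c * x ^ 3| ≤ |c| * K ^ 3 := by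
      rw [abs_mul, abs_mul, abs_of_nonneg (by positivity : 0 ≤ ε ^ 2),
        abs_of_nonneg (by positivity : 0 ≤ x ^ 3)]
      calc ε ^ 2 * |c| * x ^ 3 ≤ 1 ^ 2 * |c| * K ^ 3 := by gcongr
        _ = _ := by ring
    have t3 : C * ε ^ 3 ≤ C := mul_le_of_le_one_right hC (pow_le_one₀ hε0.le hε1)
    rw [e]
    refine (abs_add_le _ _).trans ((add_le_add ((abs_add_le _ _).trans (add_le_add
      ((abs_add_le _ _).trans (add_le_add h1 (abs_of_nonneg hx).le)) t1)) t2).trans ?_)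
    linarith
  rcases le_total 0 x with hx0 | hx0
  · rw [abs_of_nonneg hx0] at hx ⊢
    obtain ⟨m1, m2, m3⟩ := main x v hx0 hx hv
    refine ⟨m1, fun _ => m2, fun h0 => ?_, m3⟩
    have : x = 0 := le_antisymm h0 hx0
    rw [hv, this]
    simp [scaledCDF, oddCDF, inflate]
  · rw [abs_of_nonpos hx0] at hx ⊢
    obtain ⟨m1, m2, m3⟩ := main (-x) (-v) (by linarith) hx (by
      rw [hv, neg_mul, neg_div, hp.scaledCDF_neg, inflate_neg])
    refine ⟨?_, fun h0 => ?_, fun _ => by linarith, by rwa [abs_neg] at m3⟩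
    · rw [← abs_neg] at m1
      convert m1 using 2
      ring
    · have : x = 0 := le_antisymm hx0 h0
      rw [hv, this]
      simp [scaledCDF, oddCDF, inflate]

theorem continuous_inflate_scaledCDF (hint : Integrable p) (G c : ℝ) :
    Continuous fun x => inflate G (scaledCDF p G (x / c)) := by
  have h1 : Continuous (oddCDF p) :=
    intervalIntegral.continuous_primitive (fun a b => hint.intervalIntegrable) 0
  unfold inflate scaledCDF
  fun_prop

end

/-! ### Limits along n, quantiles and the final substitution. -/

theorem tendsto_rate {r : ℝ} (hr : 0 < r) : Tendsto (rate r) atTop (𝓝 0) := by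
  by_cases h : r = 3 / 2
  · have h1 : Tendsto (fun x : ℝ => Real.log x * x ^ (-(3 / 2) : ℝ)) atTop (𝓝 0) := by
      have := (isLittleO_log_rpow_atTop (by norm_num : (0 : ℝ) < 3 / 2)).tendsto_div_nhds_zero
      refine this.congr' ?_
      filter_upwards [eventually_gt_atTop 0] with x hx
      rw [Real.rpow_neg hx.le, div_eq_mul_inv]
    have h2 := h1.comp tendsto_natCast_atTop_atTop
    refine h2.congr fun n => ?_
    simp [rate, h]
  · have h1 := (tendsto_rpow_neg_atTop (lt_min hr (by norm_num : (0 : ℝ) < 3 / 2))).comp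
      tendsto_natCast_atTop_atTop
    refine h1.congr fun n => ?_
    simp [rate, h]

theorem tendsto_one_div_sqrt_g {r : ℝ} (hr : 0 < r) :
    Tendsto (fun n => 1 / √(g r n)) atTop (𝓝 0) :=
  (tendsto_const_nhds (x := (1 : ℝ))).div_atTop
    (Real.tendsto_sqrt_atTop.comp (tendsto_g hr))

theorem tendsto_mixApprox {r : ℝ} (hr : 0 < r) {v : ℕ → ℝ} {K : ℝ}
    (hv : Tendsto v atTop (𝓝 K)) :
    Tendsto (fun n => mixApprox r (g r n) (v n)) atTop
      (𝓝 (∫ t in (0 : ℝ)..K, studentDensity (2 * r) t)) := by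
  have hν : 0 < 2 * r := by positivity
  have h1 := (integral_studentDensity_hasDerivAt hν K).continuousAt.tendsto.comp hv
  have h2 : Tendsto (fun n => studentDensity (2 * r) (v n) * mixPoly r (v n) / g r n) atTop
      (𝓝 0) :=
    ((((continuous_studentDensity hν).tendsto K).comp hv).mul
      (((contDiff_mixPoly r).continuous.tendsto K).comp hv)).div_atTop (tendsto_g hr)
  unfold mixApprox
  split_ifs
  · simpa using h1.add h2
  · simpa using! h1

theorem integral_studentDensity_strictMono {ν : ℝ} (hν : 0 < ν) :
    StrictMono fun w => ∫ t in (0 : ℝ)..w, studentDensity ν t :=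
  strictMono_of_hasDerivAt_pos (fun w => integral_studentDensity_hasDerivAt hν w)
    fun w => studentDensity_pos hν w

section
variable {p : ℝ → ℝ}

theorem RegularDensity.tendsto_inflate_scaledCDF (hp : RegularDensity p) (hint : Integrable p)
    {p₁ p₂ : ℝ} (hp₁ : Tendsto (deriv p) (𝓝[>] 0) (𝓝 p₁))
    (hp₂ : Tendsto (iteratedDeriv 2 p) (𝓝[>] 0) (𝓝 p₂)) {r : ℝ} (hr : 0 < r) (x : ℝ) :
    Tendsto (fun n => inflate (g r n) (scaledCDF p (g r n) (x / (2 * p 0 * √(g r n))))) atTop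
      (𝓝 x) := by
  obtain ⟨C, hC, W, hW, G₀, hG₀, h⟩ := hp.inflate_scaledCDF_expansion hint hp₁ hp₂ (abs_nonneg x)
  set a := p₁ / (4 * p 0 ^ 2)
  set c := p₂ / (24 * p 0 ^ 3) + 1 / 4
  have hε := tendsto_one_div_sqrt_g hr
  have h1 : Tendsto (fun n => x + 1 / √(g r n) * a * (x * |x|) + (1 / √(g r n)) ^ 2 * c * x ^ 3)
      atTop (𝓝 (x + 0 * a * (x * |x|) + 0 ^ 2 * c * x ^ 3)) :=
    (tendsto_const_nhds.add ((hε.mul_const a).mul_const _)).add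
      (((hε.pow 2).mul_const c).mul_const _)
  have h2 : Tendsto (fun n => inflate (g r n) (scaledCDF p (g r n) (x / (2 * p 0 * √(g r n)))) -
      (x + 1 / √(g r n) * a * (x * |x|) + (1 / √(g r n)) ^ 2 * c * x ^ 3)) atTop (𝓝 0) := by
    refine squeeze_zero_norm' (a := fun n => C * (1 / √(g r n)) ^ 3) ?_ ?_
    · filter_upwards [(tendsto_g hr).eventually_ge_atTop G₀] with n hn
      exact (h _ hn x _ le_rfl rfl).1
    · simpa using (hε.pow 3).const_mul C
  simpa using h2.add h1

end

theorem abs_mul_abs_sub_le {u v W : ℝ} (hu : |u| ≤ W) (hv : |v| ≤ W) :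
    |v * (|v|) - u * (|u|)| ≤ 2 * W * |v - u| := by
  have e : v * |v| - u * |u| = (v - u) * |v| + u * (|v| - |u|) := by ring
  rw [e]
  refine (abs_add_le _ _).trans ?_
  rw [abs_mul, abs_mul, abs_abs]
  have h1 := abs_abs_sub_abs_le v u
  nlinarith [abs_nonneg (v - u), abs_nonneg u, abs_nonneg (|v| - |u|)]

theorem abs_cube_sub_le {u v W : ℝ} (hu : |u| ≤ W) (hv : |v| ≤ W) :
    |v ^ 3 - u ^ 3| ≤ 3 * W ^ 2 * |v - u| := by
  have e : v ^ 3 - u ^ 3 = (v ^ 2 + v * u + u ^ 2) * (v - u) := by ring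
  rw [e, abs_mul]
  refine mul_le_mul_of_nonneg_right ?_ (abs_nonneg _)
  have hW : 0 ≤ W := (abs_nonneg u).trans hu
  have h1 : v ^ 2 ≤ W ^ 2 := sq_le_sq' (by linarith [(abs_le.1 hv).1]) (abs_le.1 hv).2
  have h2 : u ^ 2 ≤ W ^ 2 := sq_le_sq' (by linarith [(abs_le.1 hu).1]) (abs_le.1 hu).2
  rw [abs_le]
  constructor <;> nlinarith [sq_nonneg (v - u), sq_nonneg (v + u)]

/-- Substitution of the expansion of the argument into the inverted cubic. -/
theorem quantile_substitution (r a c q : ℝ) {W C₁ C₂ C₃ : ℝ} (hW : 0 ≤ W) (hC₁ : 0 ≤ C₁)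
    (hC₂ : 0 ≤ C₂) (hC₃ : 0 ≤ C₃) : ∃ C, 0 ≤ C ∧ ∀ ε ρ x u v : ℝ, 0 ≤ ε → ε ≤ 1 → 0 ≤ ρ →
      ε ^ 3 ≤ C₃ * ρ → (r ≤ 1 → ε ^ 2 ≤ C₃ * ρ) → (r ≤ 1 / 2 → ε ≤ C₃ * ρ) →
      |u| ≤ W → |v| ≤ W →
      |x - (v - ε * a * (v * |v|) + ε ^ 2 * (2 * a ^ 2 - c) * v ^ 3)| ≤ C₁ * ε ^ 3 →
      |v - u + if 1 < r then ε ^ 2 * q else 0| ≤ C₂ * ρ →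
      |v - u| ≤ C₂ * (ρ + if 1 < r then ε ^ 2 else 0) →
      |x - (u - (if 1 / 2 < r then ε * a * (u * |u|) else 0) +
        if 1 < r then ε ^ 2 * ((2 * a ^ 2 - c) * u ^ 3 - q) else 0)| ≤ C * ρ := by
  obtain ⟨B, hB⟩ : ∃ B, B = 2 * a ^ 2 - c := ⟨_, rfl⟩
  rw [← hB]
  obtain ⟨E₁, hE₁⟩ : ∃ E, E = |a| * (2 * W) * (C₂ * (1 + C₃)) := ⟨_, rfl⟩
  obtain ⟨E₂, hE₂⟩ : ∃ E, E = |B| * (3 * W ^ 2) * (C₂ * (1 + C₃)) := ⟨_, rfl⟩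
  obtain ⟨E₃, hE₃⟩ : ∃ E, E = |a| * W ^ 2 * C₃ := ⟨_, rfl⟩
  obtain ⟨E₄, hE₄⟩ : ∃ E, E = |B| * W ^ 3 * C₃ := ⟨_, rfl⟩
  have n1 : 0 ≤ E₁ := by rw [hE₁]; positivity
  have n2 : 0 ≤ E₂ := by rw [hE₂]; positivity
  have n3 : 0 ≤ E₃ := by rw [hE₃]; positivity
  have n4 : 0 ≤ E₄ := by rw [hE₄]; positivity
  refine ⟨C₁ * C₃ + C₂ + E₁ + E₂ + E₃ + E₄, by positivity, ?_⟩
  intro ε ρ x u v hε hε1 hρ hε3 hε2r hε1r hu hv h1 h2 h3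
  have hε2 : 0 ≤ ε ^ 2 := by positivity
  have hε21 : ε ^ 2 ≤ ε := by nlinarith
  have m1 := mul_nonneg n1 hρ
  have m2 := mul_nonneg n2 hρ
  have m3 := mul_nonneg n3 hρ
  have m4 := mul_nonneg n4 hρ
  have k1 : C₁ * ε ^ 3 ≤ C₁ * C₃ * ρ := by
    rw [mul_assoc]; exact mul_le_mul_of_nonneg_left hε3 hC₁
  have hvv : |v * (|v|)| ≤ W ^ 2 := by
    rw [abs_mul, abs_abs, pow_two]; exact mul_le_mul hv hv (abs_nonneg _) hW
  have hv3 : |v ^ 3| ≤ W ^ 3 := by rw [abs_pow]; exact pow_le_pow_left₀ (abs_nonneg _) hv 3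
  -- An extra factor ε turns the bound ρ + ε² on v - u into ρ + ε³, which is within the rate; hence
  -- v may be replaced by u in the correction terms.
  have hεvu : ε * |v - u| ≤ C₂ * (1 + C₃) * ρ := by
    have h4 : ε * (ρ + if 1 < r then ε ^ 2 else 0) ≤ (1 + C₃) * ρ := by
      have h5 : ε * ρ ≤ ρ := mul_le_of_le_one_left hρ hε1
      split_ifs
      · nlinarith
      · have := mul_nonneg hC₃ hρ
        linarith
    calc ε * |v - u| ≤ ε * (C₂ * (ρ + if 1 < r then ε ^ 2 else 0)) :=
          mul_le_mul_of_nonneg_left h3 hε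
      _ = C₂ * (ε * (ρ + if 1 < r then ε ^ 2 else 0)) := by ring
      _ ≤ C₂ * ((1 + C₃) * ρ) := mul_le_mul_of_nonneg_left h4 hC₂
      _ = _ := by ring
  have k2 : |ε * a * (v * (|v|) - u * (|u|))| ≤ E₁ * ρ := by
    rw [abs_mul, abs_mul, abs_of_nonneg hε, hE₁]
    calc _ ≤ ε * |a| * (2 * W * |v - u|) :=
          mul_le_mul_of_nonneg_left (abs_mul_abs_sub_le hu hv) (by positivity)
      _ = |a| * (2 * W) * (ε * |v - u|) := by ring
      _ ≤ |a| * (2 * W) * (C₂ * (1 + C₃) * ρ) :=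
          mul_le_mul_of_nonneg_left hεvu (by positivity)
      _ = _ := by ring
  have k3 : |ε ^ 2 * B * (v ^ 3 - u ^ 3)| ≤ E₂ * ρ := by
    rw [abs_mul, abs_mul, abs_of_nonneg hε2, hE₂]
    calc _ ≤ ε * |B| * (3 * W ^ 2 * |v - u|) :=
          mul_le_mul (mul_le_mul_of_nonneg_right hε21 (abs_nonneg _)) (abs_cube_sub_le hu hv)
            (abs_nonneg _) (by positivity)
      _ = |B| * (3 * W ^ 2) * (ε * |v - u|) := by ring
      _ ≤ |B| * (3 * W ^ 2) * (C₂ * (1 + C₃) * ρ) :=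
          mul_le_mul_of_nonneg_left hεvu (by positivity)
      _ = _ := by ring
  have k4 : r ≤ 1 → |ε ^ 2 * B * v ^ 3| ≤ E₄ * ρ := fun hr => by
    rw [abs_mul, abs_mul, abs_of_nonneg hε2, hE₄]
    calc _ ≤ C₃ * ρ * |B| * W ^ 3 :=
          mul_le_mul (mul_le_mul_of_nonneg_right (hε2r hr) (abs_nonneg _)) hv3
            (abs_nonneg _) (by positivity)
      _ = _ := by ring
  have k5 : r ≤ 1 / 2 → |ε * a * (v * |v|)| ≤ E₃ * ρ := fun hr => by
    rw [abs_mul, abs_mul, abs_of_nonneg hε, hE₃]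
    calc _ ≤ C₃ * ρ * |a| * W ^ 2 :=
          mul_le_mul (mul_le_mul_of_nonneg_right (hε1r hr) (abs_nonneg _)) hvv
            (abs_nonneg _) (by positivity)
      _ = _ := by ring
  have h1' := h1.trans k1
  rcases lt_or_ge 1 r with hr | hr
  · have hr2 : 1 / 2 < r := by linarith
    simp only [if_pos hr, if_pos hr2] at h2 ⊢
    rw [abs_le] at *
    constructor <;> linarith [h1'.1, h1'.2, h2.1, h2.2, k2.1, k2.2, k3.1, k3.2]
  · replace k4 := k4 hr
    simp only [if_neg (not_lt.2 hr), add_zero] at h2 ⊢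
    rcases lt_or_ge (1 / 2) r with hr2 | hr2
    · simp only [if_pos hr2]
      rw [abs_le] at *
      constructor <;> linarith [h1'.1, h1'.2, h2.1, h2.2, k2.1, k2.2, k4.1, k4.2]
    · replace k5 := k5 hr2
      simp only [if_neg (not_lt.2 hr2), sub_zero]
      rw [abs_le] at *
      constructor <;> linarith [h1'.1, h1'.2, h2.1, h2.2, k5.1, k5.2, k4.1, k4.2]

theorem IsQuantile.le_of_lt {Ω : Type*} [MeasurableSpace Ω] {P : Measure Ω} [IsProbabilityMeasure P]
    {T : Ω → ℝ} {α x K : ℝ} (h : IsQuantile P T α x) (hK : α < P.real {ω | T ω ≤ K}) : x ≤ K := by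
  by_contra hlt
  push Not at hlt
  have : P.real {ω | T ω ≤ K} ≤ P.real {ω | T ω < x} :=
    measureReal_mono fun ω (hω : T ω ≤ K) => hω.trans_lt hlt
  linarith [h.1]

theorem IsQuantile.lt_of_lt {Ω : Type*} [MeasurableSpace Ω] {P : Measure Ω} [IsProbabilityMeasure P]
    {T : Ω → ℝ} {α x K : ℝ} (h : IsQuantile P T α x) (hK : P.real {ω | T ω ≤ K} < α) : K < x := by
  by_contra hle
  push Not at hle
  have : P.real {ω | T ω ≤ x} ≤ P.real {ω | T ω ≤ K} :=
    measureReal_mono fun ω (hω : T ω ≤ x) => hω.trans hle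
  linarith [h.2]

/-- A continuous approximation of a distribution function is close to `α` at an `α`-quantile. -/
theorem IsQuantile.abs_sub_le {Ω : Type*} [MeasurableSpace Ω] {P : Measure Ω}
    [IsProbabilityMeasure P] {T : Ω → ℝ} {α x δ : ℝ} {E : ℝ → ℝ} (h : IsQuantile P T α x)
    (hE : ContinuousAt E x) (hT : ∀ y ∈ Set.Ioc (x - 1) x, |P.real {ω | T ω ≤ y} - E y| ≤ δ) :
    |E x - α| ≤ δ := by
  rw [abs_sub_le_iff]
  constructor
  -- T may have an atom at x, so the upper bound is taken at points y < x, where P(T ≤ y) ≤ P(T < x)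
  -- ≤ α, and carried to x by continuity of E.
  · have h1 : Tendsto (fun y => E y - α) (𝓝[<] x) (𝓝 (E x - α)) :=
      (hE.tendsto.mono_left nhdsWithin_le_nhds).sub_const α
    refine le_of_tendsto h1 ?_
    filter_upwards [Ioo_mem_nhdsLT (by linarith : x - 1 < x)] with y hy
    have h2 := (abs_le.1 (hT y ⟨hy.1, hy.2.le⟩)).1
    have h3 : P.real {ω | T ω ≤ y} ≤ P.real {ω | T ω < x} :=
      measureReal_mono fun ω (hω : T ω ≤ y) => hω.trans_lt hy.2
    linarith [h.1]
  · have h2 := (abs_le.1 (hT x ⟨by linarith, le_rfl⟩)).2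
    linarith [h.2]

/-- The distribution functions converge pointwise to Student's, which is strictly increasing, so at
±(|u| + 1) they eventually lie strictly on either side of α. The approximations are uniform only on
bounded sets, so this must come first. -/
theorem eventually_abs_quantile_le {p : ℝ → ℝ} (hp : RegularDensity p) (hint : Integrable p) {p₁ p₂ : ℝ}
    (hp₁ : Tendsto (deriv p) (𝓝[>] 0) (𝓝 p₁))
    (hp₂ : Tendsto (iteratedDeriv 2 p) (𝓝[>] 0) (𝓝 p₂)) {r : ℝ} (hr : 0 < r)
    {Ω : Type*} [MeasurableSpace Ω] {P : Measure Ω} [IsProbabilityMeasure P] {T : ℕ → Ω → ℝ}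
    (hT : ∀ K, 0 ≤ K → ∃ C, 0 ≤ C ∧ ∀ᶠ n : ℕ in atTop, ∀ x, |x| ≤ K →
      |P.real {ω | T n ω ≤ x} - 1 / 2 -
        mixApprox r (g r n) (inflate (g r n) (scaledCDF p (g r n) (x / (2 * p 0 * √(g r n)))))| ≤
      C * rate r n)
    {α u : ℝ} (hu : studentCDF (2 * r) u = α) {x : ℕ → ℝ}
    (hx : ∀ n, 1 ≤ n → IsQuantile P (T n) α (x n)) :
    ∀ᶠ n in atTop, |x n| ≤ |u| + 1 := by
  have hν : 0 < 2 * r := by positivity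
  have hS : ∫ t in (0 : ℝ)..u, studentDensity (2 * r) t = α - 1 / 2 := by
    rw [studentCDF_eq hr] at hu; linarith
  have hmono := integral_studentDensity_strictMono hν
  have hlim : ∀ y, Tendsto (fun n => P.real {ω | T n ω ≤ y}) atTop
      (𝓝 (1 / 2 + ∫ t in (0 : ℝ)..y, studentDensity (2 * r) t)) := by
    intro y
    obtain ⟨C, hC, h⟩ := hT |y| (abs_nonneg y)
    have h1 := tendsto_mixApprox hr (hp.tendsto_inflate_scaledCDF hint hp₁ hp₂ hr y)
    have h2 : Tendsto (fun n => P.real {ω | T n ω ≤ y} - 1 / 2 - mixApprox r (g r n)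
        (inflate (g r n) (scaledCDF p (g r n) (y / (2 * p 0 * √(g r n)))))) atTop (𝓝 0) := by
      refine squeeze_zero_norm' (a := fun n => C * rate r n) ?_ ?_
      · filter_upwards [h] with n hn
        exact hn y le_rfl
      · simpa using (tendsto_rate hr).const_mul C
    have h3 := (h2.add h1).const_add (1 / 2)
    rw [zero_add] at h3
    refine h3.congr fun n => ?_
    ring
  have huK : u < |u| + 1 := by linarith [le_abs_self u]
  have hKu : -(|u| + 1) < u := by linarith [neg_abs_le u]
  have e1 := (hlim (|u| + 1)).eventually_const_lt (u := α) (by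
    have : _ < _ := hmono huK
    simp only [hS] at this
    linarith)
  have e2 := (hlim (-(|u| + 1))).eventually_lt_const (u := α) (by
    have : _ < _ := hmono hKu
    simp only [hS] at this
    linarith)
  filter_upwards [e1, e2, eventually_ge_atTop 1] with n h1 h2 hn
  exact abs_le.2 ⟨((hx n hn).lt_of_lt h2).le, (hx n hn).le_of_lt h1⟩

set_option maxHeartbeats 1000000 in
/-- Expansion of the quantiles of statistics whose distribution functions have the second-order
approximation of the randomly sampled median. -/
theorem quantile_expansion {p : ℝ → ℝ} (hp : RegularDensity p) (hint : Integrable p) {p₁ p₂ : ℝ}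
    (hp₁ : Tendsto (deriv p) (𝓝[>] 0) (𝓝 p₁))
    (hp₂ : Tendsto (iteratedDeriv 2 p) (𝓝[>] 0) (𝓝 p₂)) {r : ℝ} (hr : 0 < r)
    {Ω : Type*} [MeasurableSpace Ω] {P : Measure Ω} [IsProbabilityMeasure P] {T : ℕ → Ω → ℝ}
    (hT : ∀ K, 0 ≤ K → ∃ C, 0 ≤ C ∧ ∀ᶠ n : ℕ in atTop, ∀ x, |x| ≤ K →
      |P.real {ω | T n ω ≤ x} - 1 / 2 -
        mixApprox r (g r n) (inflate (g r n) (scaledCDF p (g r n) (x / (2 * p 0 * √(g r n)))))| ≤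
      C * rate r n)
    {α u : ℝ} (hu : studentCDF (2 * r) u = α) {x : ℕ → ℝ}
    (hx : ∀ n, 1 ≤ n → IsQuantile P (T n) α (x n)) :
    (fun n : ℕ => x n -
      (u - (if 1 / 2 < r then p₁ * u * |u| / (4 * p 0 ^ 2 * √(g r n)) else 0)
        + (if 1 < r then B₂ r (p 0) p₁ p₂ u / g r n else 0))) =O[atTop] rate r := by
  have hp0 := hp.pos_zero
  have hS : ∫ t in (0 : ℝ)..u, studentDensity (2 * r) t = α - 1 / 2 := by
    rw [studentCDF_eq hr] at hu; linarith
  have hbd := eventually_abs_quantile_le hp hint hp₁ hp₂ hr hT hu hx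
  obtain ⟨K, hK⟩ : ∃ K, K = |u| + 1 := ⟨_, rfl⟩
  have hK0 : 0 ≤ K := by rw [hK]; positivity
  rw [← hK] at hbd
  -- One unit more than K, because `IsQuantile.abs_sub_le` looks at points down to x - 1.
  obtain ⟨C, hC, hmix⟩ := hT (K + 1) (by linarith)
  obtain ⟨C₁, hC₁, W, hW, G₀, hG₀, hexp⟩ := hp.inflate_scaledCDF_expansion hint hp₁ hp₂ hK0
  set a := p₁ / (4 * p 0 ^ 2) with ha
  set c := p₂ / (24 * p 0 ^ 3) + 1 / 4 with hc
  obtain ⟨C₂, hC₂, hinv⟩ := mixApprox_inversion hr u W hC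
  obtain ⟨C₃, hC₃, hcub⟩ := cubic_inversion (a := a) (c := c) hC₁ hK0
  obtain ⟨D₃, hD₃, hg3⟩ := g_rpow_neg_le_rate hr (min_le_right r (3 / 2))
  -- For r ≤ 1 a term of order 1/g is below the rate, and likewise 1/√g for r ≤ 1/2; hence the
  -- indicator functions in the expansion.
  obtain ⟨D₂, hD₂, hg2⟩ : ∃ D, 0 ≤ D ∧ ∀ n : ℕ, 3 ≤ n → r ≤ 1 →
      g r n ^ (-1 : ℝ) ≤ D * rate r n := by
    by_cases h : r ≤ 1
    · obtain ⟨D, hD, h'⟩ := g_rpow_neg_le_rate hr ((min_le_left r (3 / 2)).trans h)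
      exact ⟨D, hD, fun n hn _ => h' n hn⟩
    · exact ⟨0, le_rfl, fun n _ h' => absurd h' h⟩
  obtain ⟨D₁, hD₁, hg1⟩ : ∃ D, 0 ≤ D ∧ ∀ n : ℕ, 3 ≤ n → r ≤ 1 / 2 →
      g r n ^ (-(1 / 2) : ℝ) ≤ D * rate r n := by
    by_cases h : r ≤ 1 / 2
    · obtain ⟨D, hD, h'⟩ := g_rpow_neg_le_rate hr ((min_le_left r (3 / 2)).trans h)
      exact ⟨D, hD, fun n hn _ => h' n hn⟩
    · exact ⟨0, le_rfl, fun n _ h' => absurd h' h⟩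
  obtain ⟨C₄, hC₄, hsub⟩ := quantile_substitution r a c (mixPoly r u) (W := max W |u|)
    (hW.trans (le_max_left _ _)) hC₃ hC₂ (by positivity : 0 ≤ D₁ + D₂ + D₃)
  refine Asymptotics.IsBigO.of_bound C₄ ?_
  filter_upwards [hbd, hmix, eventually_ge_atTop 3, (tendsto_g hr).eventually_ge_atTop G₀]
    with n hxn hmixn hn hG
  have hG1 : 1 ≤ g r n := hG₀.trans hG
  have hG0 : 0 < g r n := by linarith
  have hρ := rate_nonneg (r := r) hn
  obtain ⟨v, hv⟩ : ∃ v, v = inflate (g r n)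
    (scaledCDF p (g r n) (x n / (2 * p 0 * √(g r n)))) := ⟨_, rfl⟩
  obtain ⟨x1, x2, x3, x4⟩ := hexp (g r n) hG (x n) v hxn hv
  have hq : |mixApprox r (g r n) v - ∫ t in (0 : ℝ)..u, studentDensity (2 * r) t| ≤
      C * rate r n := by
    have h1 := (hx n (by omega)).abs_sub_le (δ := C * rate r n)
      (E := fun y => 1 / 2 + mixApprox r (g r n)
        (inflate (g r n) (scaledCDF p (g r n) (y / (2 * p 0 * √(g r n))))))
      (continuous_const.add ((continuous_mixApprox hr _).comp
        (continuous_inflate_scaledCDF hint _ _))).continuousAt (fun y hy => by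
          have := hmixn y (by
            rw [abs_le] at hxn ⊢
            constructor <;> linarith [hy.1, hy.2, hxn.1, hxn.2])
          rwa [sub_sub] at this)
    rw [← hv] at h1
    rw [hS]
    convert h1 using 2
    ring
  obtain ⟨i1, i2⟩ := hinv n hn hG1 v x4 hq
  have hsq : (1 / √(g r n)) ^ 2 = 1 / g r n := by
    rw [div_pow, Real.sq_sqrt hG0.le, one_pow]
  have hpow : ∀ m : ℕ, (1 / √(g r n)) ^ m = g r n ^ (-(m / 2) : ℝ) := by
    intro m
    rw [Real.sqrt_eq_rpow, one_div, ← Real.rpow_neg hG0.le, ← Real.rpow_natCast,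
      ← Real.rpow_mul hG0.le]
    congr 1
    ring
  have hsG : 1 ≤ √(g r n) := Real.one_le_sqrt.2 hG1
  have hε1 : 1 / √(g r n) ≤ 1 := by
    rw [div_le_one (by linarith)]; exact hsG
  have hε0 : 0 ≤ 1 / √(g r n) := by positivity
  have hcu := hcub _ (x n) v hε0 hε1 hxn x2 x3 x1
  have hfin := hsub (1 / √(g r n)) (rate r n) (x n) u v hε0 hε1 hρ
    (by
      have h1 := hg3 n hn
      rw [hpow 3]
      push_cast
      nlinarith)
    (fun h => by
      have h1 := hg2 n hn h
      rw [hpow 2]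
      norm_num at h1 ⊢
      nlinarith)
    (fun h => by
      have h1 := hg1 n hn h
      have h2 := hpow 1
      rw [pow_one] at h2
      rw [h2]
      push_cast
      nlinarith)
    (le_max_right _ _) (x4.trans (le_max_left _ _)) hcu
    (by
      rw [hsq]
      convert i1 using 4
      ring)
    (by rw [hsq]; exact i2)
  rw [Real.norm_eq_abs, Real.norm_eq_abs, abs_of_nonneg hρ]
  convert hfin using 6
  · rw [ha]
    have : √(g r n) ≠ 0 := by positivity
    field_simp
  -- B₂ is (2a² - c) u³ minus `mixPoly r u`, with a = p₁/(4p₀²) and c = p₂/(24p₀³) + 1/4.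
  · rw [hsq, B₂, mixPoly, ha, hc]
    field_simp
    ring

end RandomMedian

theorem corollary6p2 {Ω : Type*} [MeasurableSpace Ω] (P : Measure Ω) [IsProbabilityMeasure P]
    (p : ℝ → ℝ) (hp : RandomMedian.RegularDensity p)
    (p₁ p₂ : ℝ)
    (hp₁ : Tendsto (deriv p) (𝓝[>] 0) (𝓝 p₁))
    (hp₂ : Tendsto (iteratedDeriv 2 p) (𝓝[>] 0) (𝓝 p₂))
    (θ : ℝ) (X : ℕ → Ω → ℝ)
    (hX_meas : ∀ i, Measurable (X i))
    (hX_law : ∀ i, P.map (X i) = volume.withDensity (fun t => ENNReal.ofReal (p (t - θ))))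
    (hX_indep : iIndepFun X P)
    (r : ℝ) (hr : 0 < r) (N : ℕ → Ω → ℕ)
    (hN_meas : ∀ n, 1 ≤ n → Measurable (N n))
    (hN_law : ∀ n, 1 ≤ n → ∀ j, 1 ≤ j →
      P.real {ω | N n ω = j} = RandomMedian.negBinMass r n j)
    (hN_indep : ∀ n, 1 ≤ n → IndepFun (N n) (fun ω i => X i ω) P)
    (α : ℝ) (hα : α ∈ Set.Ioo (0 : ℝ) 1)
    (u : ℝ) (hu : RandomMedian.studentCDF (2 * r) u = α)
    (x : ℕ → ℝ)
    (hx : ∀ n, 1 ≤ n → RandomMedian.IsQuantile P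
      (fun ω => RandomMedian.standardizedMedian (p 0) (RandomMedian.g r n) θ
        (fun i => X i ω) (N n ω)) α (x n)) :
    (fun n : ℕ => x n -
      (u - (if 1 / 2 < r then p₁ * u * |u| / (4 * p 0 ^ 2 * √(RandomMedian.g r n)) else 0)
        + (if 1 < r then RandomMedian.B₂ r (p 0) p₁ p₂ u / RandomMedian.g r n else 0)))
      =O[atTop] RandomMedian.rate r := by
  -- That p has total mass 1 is not part of `RegularDensity`; it is read off from the law of a
  -- centred observation.
  have hprob : IsProbabilityMeasure (volume.withDensity fun t => ENNReal.ofReal (p t)) := by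
    rw [← RandomMedian.map_sub_const_eq_withDensity (hX_meas 0) (hX_law 0)]
    exact Measure.isProbabilityMeasure_map ((hX_meas 0).sub_const θ).aemeasurable
  obtain ⟨hint, -⟩ := RandomMedian.integrable_of_withDensity hp.measurable hp.nonneg
  exact RandomMedian.quantile_expansion hp hint hp₁ hp₂ hr
    (fun K hK => hp.prob_mixture_approx hX_meas hX_law hX_indep hr hN_meas hN_law hN_indep hK) hu hx
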